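/- **Setting.** Consider the linear system $x[t+1]=Ax[t]+Bu[t]+w[t]$ with $x[t]\in\mathbb R^{n_x}$, $u[t]\in\mathbb R^{n_u}$. There are $H\ge 1$ source tasks $h=1,\dots,H$ and one target task $H+1$, with expert controllers $u[t]=K^{(h)}x[t]+z[t]$, $K^{(h)}=F_\star^{(h)}\Phi_\star$, $F_\star^{(h)}\in\mathbb R^{n_u\times k}$, $\Phi_\star\in\mathbb R^{k\times n_x}$, $k\ge 1$, $2k\le n_x$, actuator noise $z[t]\sim\mathcal N(0,\sigma_z^2I)$ with $\sigma_z>0$, and process noise $w[t]\sim\mathcal N(0,\Sigma_w^{(h)})$ with $\Sigma_w^{(h)}\succ0$. Assume $\rho(A+BK^{(h)})<1$ for every $h\in\{1,\dots,H+1\}$, let $\Sigma_x^{(h)}$ be the solution of $\Sigma_x^{(h)}=(A+BK^{(h)})\Sigma_x^{(h)}(A+BK^{(h)})^\top+\sigma_z^2BB^\top+\Sigma_w^{(h)}$, and put $A_{\mathsf{cl}}=A+BK^{(H+1)}$. Norms of matrices are spectral norms, $\mathcal J(M)=\sum_{t\ge0}\|M^t\|$ and $\kappa=\lambda_{\max}/\lambda_{\min}$.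 Let $$c=\min_{h\le H}\lambda_{\min}\big((\Sigma_x^{(H+1)})^{-1/2}\Sigma_x^{(h)}(\Sigma_x^{(H+1)})^{-1/2}\big),\quad \bar\lambda=\max_{h\le H}\lambda_{\max}(\Sigma_x^{(h)}),\quad \underline\lambda=\min_{h\le H}\lambda_{\min}(\Sigma_x^{(h)}).$$ Let $\mathbf F_\star$ be the matrix obtained by stacking $F_\star^{(1)},\dots,F_\star^{(H)}$ vertically and $\mathbf F_\star^\dagger$ its Moore–Penrose inverse. Assume that the rows of $F_\star^{(H+1)}$ lie in the row space of $\mathbf F_\star$ (i.e. $F_\star^{(H+1)}\mathbf F_\star^\dagger\mathbf F_\star=F_\star^{(H+1)}$) and that $\|F_\star^{(H+1)}\mathbf F_\star^\dagger\|^2\le D/H$ for a constant $D>0$. **Data.** One observes, for $t=0,\dots,T-1$, the states and inputs of $N_1$ expert trajectories of each source task and of $N_2$ expert trajectories of the target task, all independent and with $x[0]\sim\mathcal N(0,\Sigma_x^{(h)})$. From the source data one computes, measurably, a representation $\hat\Phi\in\mathbb R^{k\times n_x}$ which together with some $\hat F^{(1)},\dots,\hat F^{(H)}$ almost surely minimizes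 $\sum_{h,i,t}\|F^{(h)}\Phi x_i^{(h)}[t]-u_i^{(h)}[t]\|^2$; then $\hat F^{(H+1)}$ almost surely minimizes $\sum_{i,t}\|F\hat\Phi x_i^{(H+1)}[t]-u_i^{(H+1)}[t]\|^2$. Put $\hat K=\hat F^{(H+1)}\hat\Phi$ and $$\mathrm{ER}(\hat\Phi,\hat F^{(H+1)})=\frac1{2T}\,\mathbb E\sum_{t=0}^{T-1}\|(K^{(H+1)}-\hat K)x[t]\|^2,$$ the expectation being over an independent expert target trajectory. **LQR cost.** For $Q\succeq0$, $R\succeq0$ let $h(x_{1:T},K)=\max_{1\le t\le T}\left\|\begin{bmatrix}Q^{1/2}\\R^{1/2}K\end{bmatrix}x[t]\right\|$. Let $\mathcal P^\star_{1:T}$ and $\hat{\mathcal P}_{1:T}$ be the laws of the target task closed loops $x[t+1]=(A+BK)x[t]+Bz[t]+w[t]$, $x[0]\sim\mathcal N(0,\Sigma_x^{(H+1)})$, with $K=K^{(H+1)}$ and $K=\hat K$ respectively (new noise, independent of the data). **Proposition.** There is a universal constant $C_1>0$, and for every $D>0$ a constant $C_2>0$ depending only on $D$, such that the following holds in the above setting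 whenever $T\ge2$, $\delta\in(0,1)$ and $$N_1T\ge C_1\max_{h\le H}\mathcal J(A+BK^{(h)})^2\kappa(\Sigma_x^{(h)})\big(n_x+\log\tfrac H\delta\big),\qquad N_2T\ge C_1\,\mathcal J(A_{\mathsf{cl}})^2\kappa(\Sigma_x^{(H+1)})\big(k+\log\tfrac1\delta\big).$$ With probability at least $1-\delta$ over the data, if the burn-in condition $8\,\mathcal J(A_{\mathsf{cl}})^2\|B\|^2\,\mathrm{ER}(\hat\Phi,\hat F^{(H+1)})\le\lambda_{\min}(\Sigma_x^{(H+1)})$ holds, then $$\Big|\mathbb E_{\hat{\mathcal P}_{1:T}}h(\hat x_{1:T},\hat K)-\mathbb E_{\mathcal P^\star_{1:T}}h(x^\star_{1:T},K^{(H+1)})\Big|\le C_2\,\mathcal C^{(H+1)}\sigma_z\sqrt{\log T}\,\sqrt{\frac{kn_x\log\big(N_1T\bar\lambda/\underline\lambda\big)}{cN_1TH}+\frac{kn_u+\log(1/\delta)}{\min(N_2,cN_1)\,T}},$$ where $$\mathcal C^{(H+1)}=\mathcal J(A_{\mathsf{cl}})\|B\|\Big(\lambda_{\max}(Q)^{1/2}+\lambda_{\max}(R)^{1/2}\|K^{(H+1)}\|\Big)+\lambda_{\max}(R)^{1/2}\sqrt{\frac{\operatorname{tr}\Sigma_x^{(H+1)}}{\lambda_{\min}(\Sigma_x^{(H+1)})}}.$$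 In particular, if $N_2\le cN_1$ the second denominator is $N_2T$. -/

import Mathlib

open MeasureTheory ProbabilityTheory Matrix
open scoped Matrix.Norms.L2Operator

/-! Multi-task imitation learning of linear controllers for a linear system: an expert for each of
`H` source tasks and one target task, learned by a shared linear representation.
Matrix norms `‖M‖` are spectral norms; states and inputs live in Euclidean spaces. -/

namespace MTIL

noncomputable section

/-- `ℝⁿ` with the Euclidean norm. -/
abbrev Vec (n : ℕ) := EuclideanSpace ℝ (Fin n)

/-! ### Linear algebra -/

/-- Smallest eigenvalue of a (nonempty) real symmetric matrix. -/
def lamMin {n : ℕ} (M : Matrix (Fin n) (Fin n) ℝ) : ℝ := sInf (spectrum ℝ M)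

/-- Largest eigenvalue of a (nonempty) real symmetric matrix. -/
def lamMax {n : ℕ} (M : Matrix (Fin n) (Fin n) ℝ) : ℝ := sSup (spectrum ℝ M)

/-- Condition number `λ_max / λ_min` of a positive definite matrix. -/
def cond {n : ℕ} (M : Matrix (Fin n) (Fin n) ℝ) : ℝ := lamMax M / lamMin M

/-- `S^{-1/2}` for a positive definite matrix, by functional calculus. -/
def invSqrt {n : ℕ} (S : Matrix (Fin n) (Fin n) ℝ) : Matrix (Fin n) (Fin n) ℝ :=
  cfc (fun x : ℝ => (√x)⁻¹) S

/-- The spectral radius is less than one. -/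
def IsSchurStable {n : ℕ} (M : Matrix (Fin n) (Fin n) ℝ) : Prop :=
  spectralRadius ℂ (M.map (algebraMap ℝ ℂ)) < 1

/-- `𝒥(M) = ∑_{t ≥ 0} ‖M ^ t‖`, a convergent series for Schur stable `M`. -/
def calJ {n : ℕ} (M : Matrix (Fin n) (Fin n) ℝ) : ℝ := ∑' t : ℕ, ‖M ^ t‖

/-- Moore-Penrose pseudo-inverse `(MᵀM)† Mᵀ`, where `(MᵀM)†` inverts the nonzero eigenvalues of the
symmetric matrix `MᵀM`; see `pinv_penrose` for the defining identities. -/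
def pinv {m n : Type*} [Fintype m] [Fintype n] [DecidableEq n] (M : Matrix m n ℝ) :
    Matrix n m ℝ :=
  cfc (fun x : ℝ => x⁻¹) (Mᵀ * M) * Mᵀ

theorem pinv_penrose {m n : Type*} [Fintype m] [Fintype n] [DecidableEq n] (M : Matrix m n ℝ) :
    M * pinv M * M = M ∧ pinv M * M * pinv M = pinv M ∧
      (M * pinv M)ᵀ = M * pinv M ∧ (pinv M * M)ᵀ = pinv M * M := by
  have hG : IsSelfAdjoint (Mᵀ * M) := by
    rw [isSelfAdjoint_iff, star_eq_conjTranspose, conjTranspose_eq_transpose_of_trivial]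
    simp
  have hcont : ∀ f : ℝ → ℝ, ContinuousOn f (spectrum ℝ (Mᵀ * M)) := fun f =>
    (Matrix.finite_real_spectrum).continuousOn f
  set G := Mᵀ * M with hGdef
  set I := cfc (fun x : ℝ => x⁻¹) G with hI
  have hGt : Gᵀ = G := by simp [hGdef]
  have hIt : Iᵀ = I := by
    have h : IsSelfAdjoint I := cfc_predicate _ _
    rwa [isSelfAdjoint_iff, star_eq_conjTranspose, conjTranspose_eq_transpose_of_trivial] at h
  have hid : cfc (fun x : ℝ => x) G = G := cfc_id' ℝ G
  have hcomm : I * G = G * I := by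
    have h := cfc_commute_cfc (fun x : ℝ => x⁻¹) (fun x : ℝ => x) G
    rw [hid] at h
    exact h
  have hGIG : G * I * G = G := by
    have h1 : cfc (fun x : ℝ => x * x⁻¹ * x) G = G * I * G := by
      rw [cfc_mul _ _ _ (hcont _) (hcont _), cfc_mul _ _ _ (hcont _) (hcont _), hid]
    rw [← h1]
    conv_rhs => rw [← hid]
    congr 1
    ext x
    by_cases hx : x = 0 <;> simp [hx]
  have hIGI : I * G * I = I := by
    have h1 : cfc (fun x : ℝ => x⁻¹ * x * x⁻¹) G = I * G * I := by
      rw [cfc_mul _ _ _ (hcont _) (hcont _), cfc_mul _ _ _ (hcont _) (hcont _), hid]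
    rw [← h1, hI]
    congr 1
    ext x
    by_cases hx : x = 0 <;> simp [hx]
  have hp : pinv M = I * Mᵀ := rfl
  refine ⟨?_, ?_, ?_, ?_⟩
  · have h0 : (M * (I * G) - M)ᵀ * (M * (I * G) - M) = 0 := by
      have e1 : (M * (I * G) - M)ᵀ = G * I * Mᵀ - Mᵀ := by
        simp [Matrix.transpose_sub, Matrix.transpose_mul, hGt, hIt]
      rw [e1, Matrix.sub_mul, Matrix.mul_sub, Matrix.mul_sub]
      have e2 : G * I * Mᵀ * (M * (I * G)) = G := by
        calc G * I * Mᵀ * (M * (I * G)) = (G * I * G) * I * G := by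
              simp only [hGdef, Matrix.mul_assoc]
          _ = G := by rw [hGIG, hGIG]
      have e3 : G * I * Mᵀ * M = G := by
        rw [Matrix.mul_assoc (G * I)]; exact hGIG
      have e4 : Mᵀ * (M * (I * G)) = G := by
        rw [← Matrix.mul_assoc, ← Matrix.mul_assoc]; exact hGIG
      rw [e2, e3, e4]
      simp [hGdef]
    have h1 : M * (I * G) - M = 0 := by
      rw [← conjTranspose_eq_transpose_of_trivial] at h0
      exact Matrix.conjTranspose_mul_self_eq_zero.mp h0
    rw [hp]
    calc M * (I * Mᵀ) * M = M * (I * G) := by simp only [hGdef, Matrix.mul_assoc]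
      _ = M := sub_eq_zero.mp h1
  · rw [hp]
    calc I * Mᵀ * M * (I * Mᵀ) = (I * G * I) * Mᵀ := by simp only [hGdef, Matrix.mul_assoc]
      _ = I * Mᵀ := by rw [hIGI]
  · rw [hp]
    simp [Matrix.transpose_mul, hIt, Matrix.mul_assoc]
  · rw [hp, Matrix.mul_assoc, ← hGdef, Matrix.transpose_mul, hIt, hGt, hcomm]

/-! ### Trajectories of a linear system under linear feedback -/

/-- Randomness of one trajectory: initial state, actuator noise `z[0..T-1]`, process noise
`w[0..T-1]`. -/
abbrev Noise (nx nu T : ℕ) := Vec nx × (Fin T → Vec nu) × (Fin T → Vec nx)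

/-- Recorded states and inputs `(x[t], u[t])`, `t = 0, …, T-1`. -/
abbrev Traj (nx nu T : ℕ) := Fin T → Vec nx × Vec nu

/-- Closed-loop states `x[0] = x₀`, `x[t+1] = A x[t] + B (K x[t] + z[t]) + w[t]` for `t < T`
(noise after time `T - 1` is set to zero and never used). -/
def state {nx nu T : ℕ} (A : Matrix (Fin nx) (Fin nx) ℝ) (B : Matrix (Fin nx) (Fin nu) ℝ)
    (K : Matrix (Fin nu) (Fin nx) ℝ) (ω : Noise nx nu T) : ℕ → Vec nx
  | 0 => ω.1
  | t + 1 =>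
      toEuclideanLin A (state A B K ω t)
        + toEuclideanLin B (toEuclideanLin K (state A B K ω t)
            + if h : t < T then ω.2.1 ⟨t, h⟩ else 0)
        + if h : t < T then ω.2.2 ⟨t, h⟩ else 0

/-- The demonstration `(x[t], u[t])` with `u[t] = K x[t] + z[t]`, `t = 0, …, T-1`. -/
def demo {nx nu T : ℕ} (A : Matrix (Fin nx) (Fin nx) ℝ) (B : Matrix (Fin nx) (Fin nu) ℝ)
    (K : Matrix (Fin nu) (Fin nx) ℝ) (ω : Noise nx nu T) : Traj nx nu T :=
  fun t => (state A B K ω t, toEuclideanLin K (state A B K ω t) + ω.2.1 t)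

/-- Root LQR cost `max_{1 ≤ t ≤ T} (x[t]ᵀ (Q + KᵀRK) x[t])^{1/2}`, which is
`max_t ‖[Q^{1/2}; R^{1/2}K] x[t]‖`; the index `t : Fin T` stands for time `t + 1`. -/
def lqrCost {nx nu : ℕ} (T : ℕ) (Q : Matrix (Fin nx) (Fin nx) ℝ) (R : Matrix (Fin nu) (Fin nu) ℝ)
    (K : Matrix (Fin nu) (Fin nx) ℝ) (x : ℕ → Vec nx) : ℝ :=
  ⨆ t : Fin T, √((x (t + 1)).ofLp ⬝ᵥ (Q + Kᵀ * R * K) *ᵥ (x (t + 1)).ofLp)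

/-! ### The multi-task problem -/

/-- The data of a problem: the system `(A, B)`, the actuator noise level, the shared representation
`Φ⋆`, and for each task the weights `F⋆`, the process noise covariance and the stationary state
covariance. The source tasks are `Fin.castSucc h` for `h : Fin H`, the target is `Fin.last H`. -/
structure Problem (nx nu k H : ℕ) where
  A : Matrix (Fin nx) (Fin nx) ℝ
  B : Matrix (Fin nx) (Fin nu) ℝ
  sigz : ℝ
  Phi : Matrix (Fin k) (Fin nx) ℝ
  F : Fin (H + 1) → Matrix (Fin nu) (Fin k) ℝ
  Sw : Fin (H + 1) → Matrix (Fin nx) (Fin nx) ℝ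
  Sx : Fin (H + 1) → Matrix (Fin nx) (Fin nx) ℝ

namespace Problem

variable {nx nu k H : ℕ} (P : Problem nx nu k H)

/-- Expert controller `K = F⋆ Φ⋆` of a task. -/
def K (h : Fin (H + 1)) : Matrix (Fin nu) (Fin nx) ℝ := P.F h * P.Phi

/-- Expert closed-loop matrix `A + B K`. -/
def Acl (h : Fin (H + 1)) : Matrix (Fin nx) (Fin nx) ℝ := P.A + P.B * P.K h

/-- The standing assumptions. The last one is the discrete Lyapunov equation that determines the
stationary covariance. -/
structure Valid : Prop where
  dim : 2 * k ≤ nx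
  sigz_pos : 0 < P.sigz
  noise_posDef : ∀ h, (P.Sw h).PosDef
  stable : ∀ h, IsSchurStable (P.Acl h)
  lyapunov : ∀ h, P.Sx h =
    P.Acl h * P.Sx h * (P.Acl h)ᵀ + P.sigz ^ 2 • (P.B * P.Bᵀ) + P.Sw h

/-- The source weights `F⋆⁽¹⁾, …, F⋆⁽ᴴ⁾` stacked on top of each other. -/
def stackedF : Matrix (Fin H × Fin nu) (Fin k) ℝ :=
  Matrix.of fun p j => P.F p.1.castSucc p.2 j

/-- Diverse source controllers, with `D` the constant in `O(1/H)`. The first condition says that the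
rows of the target weights lie in the row space of the stacked source weights, as is the case when
the stack has full column rank. -/
def DiverseSources (D : ℝ) : Prop :=
  P.F (Fin.last H) * pinv P.stackedF * P.stackedF = P.F (Fin.last H) ∧
    ‖P.F (Fin.last H) * pinv P.stackedF‖ ^ 2 ≤ D / H

/-- Target task covariance coverage
`c = min_h λ_min (Σ_target^{-1/2} Σ_h Σ_target^{-1/2})`. -/
def coverage : ℝ :=
  ⨅ h : Fin H, lamMin
    (invSqrt (P.Sx (Fin.last H)) * P.Sx h.castSucc * invSqrt (P.Sx (Fin.last H)))

/-- Largest eigenvalue of the source state covariances. -/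
def lamBar : ℝ := ⨆ h : Fin H, lamMax (P.Sx h.castSucc)

/-- Smallest eigenvalue of the source state covariances. -/
def lamUnder : ℝ := ⨅ h : Fin H, lamMin (P.Sx h.castSucc)

/-! ### Data -/

/-- Law of the randomness of one expert trajectory of a task:
`x[0] ~ 𝒩(0, Σ_x)`, `z[t] ~ 𝒩(0, σ_z² I)`, `w[t] ~ 𝒩(0, Σ_w)`, all independent. -/
def noiseLaw (h : Fin (H + 1)) (T : ℕ) : Measure (Noise nx nu T) :=
  (multivariateGaussian 0 (P.Sx h)).prod
    ((Measure.pi fun _ : Fin T => multivariateGaussian 0 (P.sigz ^ 2 • 1)).prod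
      (Measure.pi fun _ : Fin T => multivariateGaussian 0 (P.Sw h)))

/-- Law of one expert demonstration of a task. -/
def demoLaw (h : Fin (H + 1)) (T : ℕ) : Measure (Traj nx nu T) :=
  (P.noiseLaw h T).map (demo P.A P.B (P.K h))

/-- Law of the source data: `N₁` independent demonstrations of each source task. -/
def sourceLaw (N₁ T : ℕ) : Measure (Fin H → Fin N₁ → Traj nx nu T) :=
  Measure.pi fun h => Measure.pi fun _ => P.demoLaw h.castSucc T

/-- Law of the target data: `N₂` independent demonstrations of the target task. -/
def targetLaw (N₂ T : ℕ) : Measure (Fin N₂ → Traj nx nu T) :=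
  Measure.pi fun _ => P.demoLaw (Fin.last H) T

/-! ### Performance of a learned target controller -/

/-- Excess risk `1/(2T) · E ∑_{t<T} ‖(K⁽ᴴ⁺¹⁾ - K̂) x[t]‖²` over expert target trajectories. -/
def excessRisk (T : ℕ) (Khat : Matrix (Fin nu) (Fin nx) ℝ) : ℝ :=
  1 / (2 * T) * ∫ ω, ∑ t : Fin T,
      ‖toEuclideanLin (P.K (Fin.last H) - Khat) (state P.A P.B (P.K (Fin.last H)) ω t)‖ ^ 2
    ∂(P.noiseLaw (Fin.last H) T)

/-- Expected root LQR cost of running the gain `K` in closed loop on the target task, where the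
initial state is drawn from the expert's stationary distribution. -/
def expectedCost (T : ℕ) (Q : Matrix (Fin nx) (Fin nx) ℝ) (R : Matrix (Fin nu) (Fin nu) ℝ)
    (K : Matrix (Fin nu) (Fin nx) ℝ) : ℝ :=
  ∫ ω, lqrCost T Q R K (state P.A P.B K ω) ∂(P.noiseLaw (Fin.last H) T)

/-- The constant `𝒞⁽ᴴ⁺¹⁾`. -/
def lqrConst (Q : Matrix (Fin nx) (Fin nx) ℝ) (R : Matrix (Fin nu) (Fin nu) ℝ) : ℝ :=
  calJ (P.Acl (Fin.last H)) * ‖P.B‖ * (√(lamMax Q) + √(lamMax R) * ‖P.K (Fin.last H)‖)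
    + √(lamMax R) * √((P.Sx (Fin.last H)).trace / lamMin (P.Sx (Fin.last H)))

/-- Excess risk rate divided by `σ_z²`. -/
def rate (N₁ N₂ T : ℕ) (δ : ℝ) : ℝ :=
  k * nx * Real.log (N₁ * T * (P.lamBar / P.lamUnder)) / (P.coverage * N₁ * T * H)
    + (k * nu + Real.log (1 / δ)) / (min (N₂ : ℝ) (P.coverage * N₁) * T)

/-- Sample size requirements for the data, with absolute constant `C`. -/
def EnoughData (C : ℝ) (N₁ N₂ T : ℕ) (δ : ℝ) : Prop :=
  (∀ h : Fin H, C * (calJ (P.Acl h.castSucc) ^ 2 * cond (P.Sx h.castSucc)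
      * (nx + Real.log (H / δ))) ≤ N₁ * T) ∧
    C * (calJ (P.Acl (Fin.last H)) ^ 2 * cond (P.Sx (Fin.last H)) * (k + Real.log (1 / δ)))
      ≤ N₂ * T

end Problem

/-! ### Empirical risk minimization -/

/-- Sum of squared errors of the gain `K` on `N` demonstrations. -/
def sqLoss {nx nu T N : ℕ} (K : Matrix (Fin nu) (Fin nx) ℝ) (d : Fin N → Traj nx nu T) : ℝ :=
  ∑ i, ∑ t, ‖toEuclideanLin K (d i t).1 - (d i t).2‖ ^ 2

/-- `(Φ, F⁽¹⁾, …, F⁽ᴴ⁾)` solves the pre-training problem on the source data. -/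
def IsPretrained {nx nu k H T N : ℕ} (d : Fin H → Fin N → Traj nx nu T)
    (Φ : Matrix (Fin k) (Fin nx) ℝ) (F : Fin H → Matrix (Fin nu) (Fin k) ℝ) : Prop :=
  ∀ (Φ' : Matrix (Fin k) (Fin nx) ℝ) (F' : Fin H → Matrix (Fin nu) (Fin k) ℝ),
    ∑ h, sqLoss (F h * Φ) (d h) ≤ ∑ h, sqLoss (F' h * Φ') (d h)

/-- `F` solves the target training problem on the target data with the representation `Φ`. -/
def IsTargetTrained {nx nu k T N : ℕ} (d : Fin N → Traj nx nu T)
    (Φ : Matrix (Fin k) (Fin nx) ℝ) (F : Matrix (Fin nu) (Fin k) ℝ) : Prop :=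
  ∀ F' : Matrix (Fin nu) (Fin k) ℝ, sqLoss (F * Φ) d ≤ sqLoss (F' * Φ) d

end

end MTIL

/-!
The state of an expert trajectory is a stationary Gaussian process whose autocovariances decay like
`‖A_cl ^ d‖`. All quantities of interest are therefore quadratic or bilinear in Gaussian vectors,
and the proof consists of exponential moment bounds for them, a deterministic analysis of least
squares on the resulting good events, and a comparison of two closed loops driven by the same noise.

*Concentration.* For a direction `r` with `rᵀ Σ_x r = 1`, the autocovariance matrix of `⟪r, x[t]⟫`
has trace `T` and norm at most `2 κ 𝒥`, so the empirical second moment concentrates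
(`Problem.lintegral_eexp_sum_inner_sq_le`); a net of the unit sphere makes this uniform over a
subspace (`Problem.measure_exists_sum_inner_sq_deviation_le`). The correlation of the actuator noise
with linear images of the states is a martingale, and likelihood ratios of perturbations by a linear
feedback are its exponential supermartingales (`Problem.lintegral_eexp_score_le`); integrating these
against a Gaussian prior on the coefficients
gives a self-normalized bound, uniform over all coefficient matrices with rows in a given subspace
(`measure_exists_score_sq_gt_le`).

*Source tasks.* The rows of all errors `F̂⁽ʰ⁾ Φ̂ - K⁽ʰ⁾` lie in one random subspace of dimension at
most `2k`. A union bound over subspaces spanned by grid vectors (`exists_grid_approx`) turns the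
self-normalized bound into one for this random subspace, at the price of `k n_x` times the logarithm
of the sample size and of the conditioning. The basic inequality of least squares then bounds the
sum over the tasks of the prediction errors (`Problem.sourceError_le`).

*Target task.* Since the rows of the target weights lie in the row space of the stacked source
weights, applying `F_⋆⁽ᴴ⁺¹⁾ 𝐅_⋆†` to the source errors produces a head on top of `Φ̂` with error at
most `D / (c H)` times the source error (`Problem.exists_wsq_mul_sub_le`). Conditionally on the
source data, least squares on the target data competes with this head (`Problem.wsq_target_le`). The
good event for the target data is closed jointly in the representation and the data, which provides
the measurability needed to integrate over the source data.

*Cost.* If `𝒥(A_cl) ‖B‖ ‖K̂ - K‖ ≤ 1/2`, which follows from the burn-in condition, the learned and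
the expert closed loop with the same noise differ by at most `2 𝒥(A_cl) ‖B‖` times the largest
prediction error `‖(K̂ - K) x[t]‖` along the expert trajectory (`norm_state_sub_le`), and the
expectation of this maximum of Gaussian norms is of order `√log T` times the root of the excess risk
(`Problem.exists_integrable_bound`).
-/

namespace MTIL

/-! ### Quadratic forms of symmetric matrices -/

section LinearAlgebra

variable {m n l : ℕ}

theorem toEuclideanLin_mul (M : Matrix (Fin m) (Fin n) ℝ) (N : Matrix (Fin n) (Fin l) ℝ)
    (x : Vec l) : toEuclideanLin (M * N) x = toEuclideanLin M (toEuclideanLin N x) := by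
  simp

theorem toEuclideanLin_one (x : Vec n) :
    toEuclideanLin (1 : Matrix (Fin n) (Fin n) ℝ) x = x := by
  simp

theorem inner_toEuclideanLin (M : Matrix (Fin m) (Fin n) ℝ) (x : Vec m) (y : Vec n) :
    inner ℝ x (toEuclideanLin M y) = inner ℝ (toEuclideanLin Mᵀ x) y := by
  simp only [EuclideanSpace.inner_eq_star_dotProduct, toLpLin_apply, star_trivial]
  rw [Matrix.mulVec_transpose, dotProduct_comm, Matrix.dotProduct_mulVec, dotProduct_comm]

theorem norm_toEuclideanLin_le (M : Matrix (Fin m) (Fin n) ℝ) (x : Vec n) :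
    ‖toEuclideanLin M x‖ ≤ ‖M‖ * ‖x‖ :=
  (toEuclideanLin ≪≫ₗ LinearMap.toContinuousLinearMap) M |>.le_opNorm x

theorem norm_le_of_forall_toEuclideanLin {M : Matrix (Fin m) (Fin n) ℝ} {c : ℝ} (hc : 0 ≤ c)
    (h : ∀ x, ‖toEuclideanLin M x‖ ≤ c * ‖x‖) : ‖M‖ ≤ c :=
  ContinuousLinearMap.opNorm_le_bound _ hc h

/-- The quadratic form `r ↦ rᵀ S r` on Euclidean space. -/
noncomputable def qf (S : Matrix (Fin n) (Fin n) ℝ) (r : Vec n) : ℝ :=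
  inner ℝ r (toEuclideanLin S r)

theorem qf_eq_dotProduct (S : Matrix (Fin n) (Fin n) ℝ) (r : Vec n) :
    qf S r = r.ofLp ⬝ᵥ S *ᵥ r.ofLp := by
  simp only [qf, EuclideanSpace.inner_eq_star_dotProduct, toLpLin_apply, star_trivial]
  rw [dotProduct_comm]

theorem qf_smul (S : Matrix (Fin n) (Fin n) ℝ) (a : ℝ) (r : Vec n) :
    qf S (a • r) = a ^ 2 * qf S r := by
  simp only [qf, map_smul, inner_smul_left, inner_smul_right]
  simp; ring

theorem qf_nonneg {S : Matrix (Fin n) (Fin n) ℝ} (hS : S.PosSemidef) (r : Vec n) :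
    0 ≤ qf S r := by
  rw [qf_eq_dotProduct]
  simpa using hS.dotProduct_mulVec_nonneg r.ofLp

theorem qf_pos {S : Matrix (Fin n) (Fin n) ℝ} (hS : S.PosDef) {r : Vec n} (hr : r ≠ 0) :
    0 < qf S r := by
  rw [qf_eq_dotProduct]
  simpa using hS.dotProduct_mulVec_pos (x := r.ofLp) (by simpa using hr)

theorem qf_sub_le {S : Matrix (Fin n) (Fin n) ℝ} (hS : S.PosSemidef) (r s : Vec n) :
    qf S (r - s) ≤ 2 * qf S r + 2 * qf S s := by
  have h := qf_nonneg hS (r + s)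
  simp only [qf, map_add, map_sub, inner_add_left, inner_add_right, inner_sub_left,
    inner_sub_right] at h ⊢
  linarith

theorem qf_eq_sum_eigenvalues {S : Matrix (Fin n) (Fin n) ℝ} (hS : S.IsHermitian) (x : Vec n) :
    qf S x = ∑ i, hS.eigenvalues i * inner ℝ (hS.eigenvectorBasis i) x ^ 2 := by
  have hx := hS.eigenvectorBasis.sum_repr' x
  have h1 : toEuclideanLin S x
      = ∑ i, inner ℝ (hS.eigenvectorBasis i) x • hS.eigenvalues i • hS.eigenvectorBasis i := by
    conv_lhs => rw [← hx]
    rw [map_sum]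
    refine Finset.sum_congr rfl fun i _ => ?_
    rw [map_smul]
    congr 1
    apply (WithLp.equiv 2 _).injective
    simpa [toLpLin_apply] using hS.mulVec_eigenvectorBasis i
  rw [qf, h1, inner_sum]
  refine Finset.sum_congr rfl fun i _ => ?_
  rw [inner_smul_right, inner_smul_right, real_inner_comm]
  ring

theorem sum_sq_inner_eigenvectorBasis {S : Matrix (Fin n) (Fin n) ℝ} (hS : S.IsHermitian)
    (x : Vec n) : ∑ i, inner ℝ (hS.eigenvectorBasis i) x ^ 2 = ‖x‖ ^ 2 :=
  hS.eigenvectorBasis.sum_sq_inner_right x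

theorem lamMin_le_eigenvalues {S : Matrix (Fin n) (Fin n) ℝ} (hS : S.IsHermitian) (i : Fin n) :
    lamMin S ≤ hS.eigenvalues i :=
  csInf_le (Matrix.finite_real_spectrum).bddBelow (hS.eigenvalues_mem_spectrum_real i)

theorem eigenvalues_le_lamMax {S : Matrix (Fin n) (Fin n) ℝ} (hS : S.IsHermitian) (i : Fin n) :
    hS.eigenvalues i ≤ lamMax S :=
  le_csSup (Matrix.finite_real_spectrum).bddAbove (hS.eigenvalues_mem_spectrum_real i)

theorem exists_eigenvalues_eq_lamMin {S : Matrix (Fin n) (Fin n) ℝ} (hn : 0 < n)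
    (hS : S.IsHermitian) : ∃ i, hS.eigenvalues i = lamMin S := by
  have h : lamMin S ∈ spectrum ℝ S := by
    refine Set.Nonempty.csInf_mem ⟨_, hS.eigenvalues_mem_spectrum_real ⟨0, hn⟩⟩
      Matrix.finite_real_spectrum
  rw [hS.spectrum_real_eq_range_eigenvalues] at h
  exact h

theorem lamMin_mul_le_qf {S : Matrix (Fin n) (Fin n) ℝ} (hS : S.IsHermitian) (x : Vec n) :
    lamMin S * ‖x‖ ^ 2 ≤ qf S x := by
  rw [qf_eq_sum_eigenvalues hS, ← sum_sq_inner_eigenvectorBasis hS, Finset.mul_sum]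
  exact Finset.sum_le_sum fun i _ =>
    mul_le_mul_of_nonneg_right (lamMin_le_eigenvalues hS i) (sq_nonneg _)

theorem qf_le_lamMax_mul {S : Matrix (Fin n) (Fin n) ℝ} (hS : S.IsHermitian) (x : Vec n) :
    qf S x ≤ lamMax S * ‖x‖ ^ 2 := by
  rw [qf_eq_sum_eigenvalues hS, ← sum_sq_inner_eigenvectorBasis hS, Finset.mul_sum]
  exact Finset.sum_le_sum fun i _ =>
    mul_le_mul_of_nonneg_right (eigenvalues_le_lamMax hS i) (sq_nonneg _)

theorem lamMin_pos {S : Matrix (Fin n) (Fin n) ℝ} (hn : 0 < n) (hS : S.PosDef) :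
    0 < lamMin S := by
  obtain ⟨i, hi⟩ := exists_eigenvalues_eq_lamMin hn hS.isHermitian
  rw [← hi]
  exact hS.eigenvalues_pos i

theorem lamMin_le_lamMax {S : Matrix (Fin n) (Fin n) ℝ} (hn : 0 < n) (hS : S.IsHermitian) :
    lamMin S ≤ lamMax S :=
  (lamMin_le_eigenvalues hS ⟨0, hn⟩).trans (eigenvalues_le_lamMax hS ⟨0, hn⟩)

theorem lamMax_nonneg {S : Matrix (Fin n) (Fin n) ℝ} (hS : S.PosSemidef) : 0 ≤ lamMax S := by
  refine Real.sSup_nonneg fun x hx => ?_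
  rw [hS.isHermitian.spectrum_real_eq_range_eigenvalues] at hx
  obtain ⟨i, rfl⟩ := hx
  exact hS.eigenvalues_nonneg i

theorem lamMin_le_trace {S : Matrix (Fin n) (Fin n) ℝ} (hn : 0 < n) (hS : S.PosDef) :
    lamMin S ≤ S.trace := by
  rw [hS.isHermitian.trace_eq_sum_eigenvalues]
  refine (lamMin_le_eigenvalues hS.isHermitian ⟨0, hn⟩).trans ?_
  simp only [RCLike.ofReal_real_eq_id, id]
  exact Finset.single_le_sum (f := hS.isHermitian.eigenvalues)
    (fun i _ => (hS.eigenvalues_pos i).le) (Finset.mem_univ _)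

open scoped MatrixOrder in
/-- The positive semidefinite square root `S^{1/2}`. -/
noncomputable def matSqrt (S : Matrix (Fin n) (Fin n) ℝ) : Matrix (Fin n) (Fin n) ℝ :=
  CFC.sqrt S

open scoped MatrixOrder in
theorem matSqrt_transpose (S : Matrix (Fin n) (Fin n) ℝ) : (matSqrt S)ᵀ = matSqrt S := by
  have h1 : IsSelfAdjoint (matSqrt S) := (CFC.sqrt_nonneg S).isSelfAdjoint
  rwa [isSelfAdjoint_iff, star_eq_conjTranspose, conjTranspose_eq_transpose_of_trivial] at h1

open scoped MatrixOrder in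
theorem matSqrt_mul_self {S : Matrix (Fin n) (Fin n) ℝ} (hS : S.PosSemidef) :
    matSqrt S * matSqrt S = S :=
  CFC.sqrt_mul_sqrt_self S hS.nonneg

theorem qf_eq_norm_sq_matSqrt {S : Matrix (Fin n) (Fin n) ℝ} (hS : S.PosSemidef) (r : Vec n) :
    qf S r = ‖toEuclideanLin (matSqrt S) r‖ ^ 2 := by
  have h4 : toEuclideanLin S r = toEuclideanLin (matSqrt S) (toEuclideanLin (matSqrt S) r) := by
    rw [← toEuclideanLin_mul, matSqrt_mul_self hS]
  rw [qf, h4, inner_toEuclideanLin, matSqrt_transpose, real_inner_self_eq_norm_sq]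

theorem norm_toEuclideanLin_sq_le {S : Matrix (Fin n) (Fin n) ℝ} (hS : S.PosSemidef)
    (r : Vec n) : ‖toEuclideanLin S r‖ ^ 2 ≤ lamMax S * qf S r := by
  have hq := qf_eq_norm_sq_matSqrt hS
  have h := qf_le_lamMax_mul hS.isHermitian (toEuclideanLin (matSqrt S) r)
  rwa [hq, ← toEuclideanLin_mul, matSqrt_mul_self hS, ← hq] at h

/-- The quadratic form of a positive definite matrix has an orthonormal basis on each subspace. -/
theorem exists_qf_orthonormal {S : Matrix (Fin n) (Fin n) ℝ} (hS : S.PosDef)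
    (R : Submodule ℝ (Vec n)) :
    ∃ b : Fin (Module.finrank ℝ R) → Vec n, (∀ j, b j ∈ R) ∧
      (∀ r ∈ R, ∃ c : EuclideanSpace ℝ (Fin (Module.finrank ℝ R)), r = ∑ j, c j • b j) ∧
      ∀ c : EuclideanSpace ℝ (Fin (Module.finrank ℝ R)), qf S (∑ j, c j • b j) = ‖c‖ ^ 2 := by
  have hq := qf_eq_norm_sq_matSqrt hS.posSemidef
  set Q := matSqrt S
  have hinj : Function.Injective (toEuclideanLin Q) := by
    rw [← LinearMap.ker_eq_bot, LinearMap.ker_eq_bot']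
    intro x hx
    by_contra hne
    have := qf_pos hS hne
    rw [hq, hx] at this
    simp at this
  set R' := R.map (toEuclideanLin Q) with hR'
  let e : R ≃ₗ[ℝ] R' := Submodule.equivMapOfInjective _ hinj R
  have hfin : Module.finrank ℝ R' = Module.finrank ℝ R := e.symm.finrank_eq
  let o : OrthonormalBasis (Fin (Module.finrank ℝ R)) ℝ R' :=
    (stdOrthonormalBasis ℝ R').reindex (finCongr hfin)
  have he : ∀ y : R', toEuclideanLin Q (e.symm y : Vec n) = y := by
    intro y
    have : (e (e.symm y) : Vec n) = toEuclideanLin Q (e.symm y : Vec n) :=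
      Submodule.coe_equivMapOfInjective_apply _ hinj R _
    rw [← this, e.apply_symm_apply]
  refine ⟨fun j => (e.symm (o j) : Vec n), fun j => (e.symm (o j)).2, fun r hr => ?_,
    fun c => ?_⟩
  · refine ⟨o.repr (e ⟨r, hr⟩), ?_⟩
    have h1 : e.symm (∑ j, o.repr (e ⟨r, hr⟩) j • o j) = ⟨r, hr⟩ := by
      rw [o.sum_repr, e.symm_apply_apply]
    have h2 := congrArg (Subtype.val) h1
    rw [map_sum] at h2
    simp only [map_smul] at h2
    refine h2.symm.trans ?_
    simp
  · rw [hq, map_sum]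
    have h1 : ∑ j, toEuclideanLin Q (c j • (e.symm (o j) : Vec n))
        = ((o.repr.symm c : R') : Vec n) := by
      rw [← o.sum_repr (o.repr.symm c)]
      simp [he]
    rw [h1]
    have : ‖((o.repr.symm c : R') : Vec n)‖ = ‖o.repr.symm c‖ := rfl
    rw [this, LinearIsometryEquiv.norm_map]

theorem invSqrt_transpose (S : Matrix (Fin n) (Fin n) ℝ) : (invSqrt S)ᵀ = invSqrt S := by
  have h : IsSelfAdjoint (invSqrt S) := cfc_predicate _ _
  rwa [isSelfAdjoint_iff, star_eq_conjTranspose, conjTranspose_eq_transpose_of_trivial] at h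

theorem invSqrt_mul_mul {S : Matrix (Fin n) (Fin n) ℝ} (hS : S.PosDef) :
    invSqrt S * S * invSqrt S = 1 ∧ invSqrt S * S = S * invSqrt S := by
  have hcont : ∀ f : ℝ → ℝ, ContinuousOn f (spectrum ℝ S) := fun f =>
    (Matrix.finite_real_spectrum).continuousOn f
  have hsa : IsSelfAdjoint S := hS.isHermitian
  have hid : cfc (fun x : ℝ => x) S = S := cfc_id' ℝ S
  constructor
  · have h1 : cfc (fun x : ℝ => (√x)⁻¹ * x * (√x)⁻¹) S = invSqrt S * S * invSqrt S := by
      rw [cfc_mul _ _ _ (hcont _) (hcont _), cfc_mul _ _ _ (hcont _) (hcont _), hid]; rfl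
    rw [← h1, ← cfc_one ℝ S]
    refine cfc_congr fun x hx => ?_
    rw [hS.isHermitian.spectrum_real_eq_range_eigenvalues] at hx
    obtain ⟨i, rfl⟩ := hx
    have hp := hS.eigenvalues_pos i
    have h2 : √(hS.isHermitian.eigenvalues i) ≠ 0 := (Real.sqrt_pos.2 hp).ne'
    have h3 := Real.mul_self_sqrt hp.le
    simp only [Pi.one_apply]
    field_simp
    nlinarith
  · have h := cfc_commute_cfc (fun x : ℝ => (√x)⁻¹) (fun x : ℝ => x) S
    rw [hid] at h
    exact h

/-- The whitened smallest eigenvalue compares the two quadratic forms. -/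
theorem lamMin_whitened_mul_le {S S' : Matrix (Fin n) (Fin n) ℝ} (hS : S.PosDef)
    (hS' : S'.IsHermitian) (r : Vec n) :
    lamMin (invSqrt S * S' * invSqrt S) * qf S r ≤ qf S' r := by
  obtain ⟨h1, h2⟩ := invSqrt_mul_mul hS
  set P := invSqrt S
  have hPt : Pᵀ = P := invSqrt_transpose S
  have hSt : Sᵀ = S := by simpa using hS.isHermitian.eq
  have hH : (P * S' * P).IsHermitian := by
    have h3 : S'ᵀ = S' := by simpa using hS'.eq
    rw [IsHermitian, conjTranspose_eq_transpose_of_trivial]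
    simp [Matrix.transpose_mul, hPt, h3, Matrix.mul_assoc]
  have h := lamMin_mul_le_qf hH (toEuclideanLin (S * P) r)
  have hM : (S * P)ᵀ * (S * P) = S := by
    rw [Matrix.transpose_mul, hPt, hSt, ← h2, ← Matrix.mul_assoc, h1, Matrix.one_mul]
  have e1 : ‖toEuclideanLin (S * P) r‖ ^ 2 = qf S r := by
    rw [← real_inner_self_eq_norm_sq, inner_toEuclideanLin, ← toEuclideanLin_mul, hM,
      real_inner_comm, qf]
  have e2 : qf (P * S' * P) (toEuclideanLin (S * P) r) = qf S' r := by
    have h4 : toEuclideanLin P (toEuclideanLin (S * P) r) = r := by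
      rw [← toEuclideanLin_mul, ← Matrix.mul_assoc, h1, toEuclideanLin_one]
    rw [qf, toEuclideanLin_mul (P * S'), h4, toEuclideanLin_mul P, inner_toEuclideanLin, hPt, h4,
      qf]
  rwa [e1, e2] at h

theorem lamMin_whitened_pos {S S' : Matrix (Fin n) (Fin n) ℝ} (hn : 0 < n) (hS : S.PosDef)
    (hS' : S'.PosDef) : 0 < lamMin (invSqrt S * S' * invSqrt S) := by
  obtain ⟨h1, -⟩ := invSqrt_mul_mul hS
  refine lamMin_pos hn ?_
  have hinj : Function.Injective (invSqrt S).mulVec := by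
    intro x y hxy
    have h2 : S * invSqrt S * invSqrt S = 1 := by
      rw [Matrix.mul_assoc] at h1
      exact mul_eq_one_comm.mp (by rw [← h1] )
    have := congrArg (fun v => (S * invSqrt S).mulVec v) hxy
    simpa [Matrix.mulVec_mulVec, h2] using this
  have := hS'.conjTranspose_mul_mul_same hinj
  rwa [conjTranspose_eq_transpose_of_trivial, invSqrt_transpose] at this

end LinearAlgebra


/-! ### Weighted Frobenius norms -/

section WeightedNorm

variable {m n : ℕ}

/-- Row `i` of a matrix, as a Euclidean vector. -/
noncomputable def rowVec {ι : Type*} (D : Matrix ι (Fin n) ℝ) (i : ι) : Vec n :=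
  WithLp.toLp 2 (D i)

theorem toEuclideanLin_apply_rowVec (D : Matrix (Fin m) (Fin n) ℝ) (x : Vec n) (i : Fin m) :
    toEuclideanLin D x i = inner ℝ (rowVec D i) x := by
  simp only [toLpLin_apply, EuclideanSpace.inner_eq_star_dotProduct, star_trivial, rowVec,
    Matrix.mulVec]
  rw [dotProduct_comm]

theorem norm_sq_toEuclideanLin (D : Matrix (Fin m) (Fin n) ℝ) (x : Vec n) :
    ‖toEuclideanLin D x‖ ^ 2 = ∑ i, inner ℝ (rowVec D i) x ^ 2 := by
  rw [EuclideanSpace.real_norm_sq_eq]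
  simp only [toEuclideanLin_apply_rowVec]

/-- `tr (D S Dᵀ)`, the squared norm of `D` weighted by `S`. -/
noncomputable def wsq (S : Matrix (Fin n) (Fin n) ℝ) (D : Matrix (Fin m) (Fin n) ℝ) : ℝ :=
  ∑ i, qf S (rowVec D i)

theorem wsq_nonneg {S : Matrix (Fin n) (Fin n) ℝ} (hS : S.PosSemidef)
    (D : Matrix (Fin m) (Fin n) ℝ) : 0 ≤ wsq S D :=
  Finset.sum_nonneg fun _ _ => qf_nonneg hS _

theorem rowVec_sub {ι : Type*} (D E : Matrix ι (Fin n) ℝ) (i : ι) :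
    rowVec (D - E) i = rowVec D i - rowVec E i := rfl

theorem rowVec_mul {ι κ : Type*} [Fintype κ] (G : Matrix ι κ ℝ) (X : Matrix κ (Fin n) ℝ) (i : ι) :
    rowVec (G * X) i = ∑ j, G i j • rowVec X j := by
  ext a
  simp [rowVec, Matrix.mul_apply]

theorem wsq_sub_le {S : Matrix (Fin n) (Fin n) ℝ} (hS : S.PosSemidef)
    (D E : Matrix (Fin m) (Fin n) ℝ) : wsq S (D - E) ≤ 2 * wsq S D + 2 * wsq S E := by
  simp only [wsq, Finset.mul_sum, ← Finset.sum_add_distrib, rowVec_sub]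
  exact Finset.sum_le_sum fun _ _ => qf_sub_le hS _ _

theorem wsq_mul_le {ι : Type*} [Fintype ι] [DecidableEq ι] {S : Matrix (Fin n) (Fin n) ℝ}
    (hS : S.PosSemidef)
    (G : Matrix (Fin m) ι ℝ) (X : Matrix ι (Fin n) ℝ) :
    wsq S (G * X) ≤ ‖G‖ ^ 2 * ∑ j, qf S (rowVec X j) := by
  have hq := qf_eq_norm_sq_matSqrt hS
  set R := matSqrt S
  simp only [wsq, hq, EuclideanSpace.real_norm_sq_eq, Finset.mul_sum]
  rw [Finset.sum_comm, Finset.sum_comm (s := (Finset.univ : Finset ι))]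
  refine Finset.sum_le_sum fun a _ => ?_
  let y : EuclideanSpace ℝ ι := WithLp.toLp 2 fun j => toEuclideanLin R (rowVec X j) a
  have h := G.l2_opNorm_mulVec y
  have h2 : ‖(EuclideanSpace.equiv (Fin m) ℝ).symm (G *ᵥ y)‖ ^ 2 ≤ ‖G‖ ^ 2 * ‖y‖ ^ 2 := by
    rw [← mul_pow]
    exact pow_le_pow_left₀ (norm_nonneg _) h 2
  rw [EuclideanSpace.real_norm_sq_eq, EuclideanSpace.real_norm_sq_eq, Finset.mul_sum] at h2
  refine le_of_eq_of_le (Finset.sum_congr rfl fun i _ => ?_) h2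
  rw [rowVec_mul, map_sum]
  simp [y, Matrix.mulVec, dotProduct]

theorem norm_sq_le_sum_rowVec (D : Matrix (Fin m) (Fin n) ℝ) :
    ‖D‖ ^ 2 ≤ ∑ i, ‖rowVec D i‖ ^ 2 := by
  have h0 : 0 ≤ ∑ i, ‖rowVec D i‖ ^ 2 := Finset.sum_nonneg fun _ _ => sq_nonneg _
  have h : ‖D‖ ≤ √(∑ i, ‖rowVec D i‖ ^ 2) := by
    refine norm_le_of_forall_toEuclideanLin (Real.sqrt_nonneg _) fun x => ?_
    rw [← abs_of_nonneg (norm_nonneg x), ← Real.sqrt_sq_eq_abs, ← Real.sqrt_mul h0]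
    refine Real.le_sqrt_of_sq_le ?_
    rw [norm_sq_toEuclideanLin, Finset.sum_mul]
    refine Finset.sum_le_sum fun i _ => ?_
    rw [← mul_pow, sq_le_sq, abs_of_nonneg (by positivity : 0 ≤ ‖rowVec D i‖ * ‖x‖)]
    exact abs_real_inner_le_norm _ _
  calc ‖D‖ ^ 2 ≤ √(∑ i, ‖rowVec D i‖ ^ 2) ^ 2 := pow_le_pow_left₀ (norm_nonneg _) h 2
    _ = _ := Real.sq_sqrt h0

theorem lamMin_mul_norm_sq_le_wsq {S : Matrix (Fin n) (Fin n) ℝ} (hn : 0 < n) (hS : S.PosDef)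
    (D : Matrix (Fin m) (Fin n) ℝ) : lamMin S * ‖D‖ ^ 2 ≤ wsq S D := by
  refine (mul_le_mul_of_nonneg_left (norm_sq_le_sum_rowVec D) (lamMin_pos hn hS).le).trans ?_
  rw [Finset.mul_sum]
  exact Finset.sum_le_sum fun i _ => lamMin_mul_le_qf hS.isHermitian _

end WeightedNorm

/-! ### Schur stable matrices and the Lyapunov equation -/

section Stability

variable {n : ℕ}

/-- The spectral radius is that of the complexification, so Gelfand's formula is applied there; the
real spectral norm is dominated by the complex one. -/
theorem norm_le_norm_map_complex (M : Matrix (Fin n) (Fin n) ℝ) :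
    ‖M‖ ≤ ‖M.map (algebraMap ℝ ℂ)‖ := by
  refine norm_le_of_forall_toEuclideanLin (norm_nonneg _) fun x => ?_
  let y : EuclideanSpace ℂ (Fin n) := WithLp.toLp 2 fun j => (x j : ℂ)
  have hy : ‖y‖ = ‖x‖ := by
    rw [EuclideanSpace.norm_eq, EuclideanSpace.norm_eq]
    simp [y]
  have h := (M.map (algebraMap ℝ ℂ)).l2_opNorm_mulVec y
  have hz : ‖(EuclideanSpace.equiv (Fin n) ℂ).symm (M.map (algebraMap ℝ ℂ) *ᵥ y)‖
      = ‖toEuclideanLin M x‖ := by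
    rw [EuclideanSpace.norm_eq, EuclideanSpace.norm_eq]
    congr 1
    refine Finset.sum_congr rfl fun i _ => ?_
    have : ((EuclideanSpace.equiv (Fin n) ℂ).symm (M.map (algebraMap ℝ ℂ) *ᵥ y)) i
        = ((toEuclideanLin M x i : ℝ) : ℂ) := by
      simp [y, Matrix.mulVec, dotProduct, toLpLin_apply]
    rw [this, Complex.norm_real]
  rwa [hz, hy] at h

/-- By Gelfand's formula, the powers of a Schur stable matrix decay geometrically. -/
theorem IsSchurStable.summable_norm_pow {M : Matrix (Fin n) (Fin n) ℝ} (hM : IsSchurStable M) :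
    Summable fun t : ℕ => ‖M ^ t‖ := by
  have hG := spectrum.pow_norm_pow_one_div_tendsto_nhds_spectralRadius (M.map (algebraMap ℝ ℂ))
  obtain ⟨r, hr1, hr2⟩ := exists_between hM
  have hrt : r ≠ ⊤ := ne_top_of_lt hr2
  have hr3 : r.toReal < 1 := by
    rw [← ENNReal.toReal_one]
    exact (ENNReal.toReal_lt_toReal hrt ENNReal.one_ne_top).2 hr2
  have hev := (hG.eventually_lt_const hr1)
  refine Summable.of_norm_bounded_eventually_nat
    (summable_geometric_of_lt_one ENNReal.toReal_nonneg hr3) ?_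
  filter_upwards [hev, Filter.eventually_gt_atTop 0] with t ht ht0
  rw [norm_norm]
  have h1 : ‖M.map (algebraMap ℝ ℂ) ^ t‖ ^ (1 / t : ℝ) ≤ r.toReal :=
    (ENNReal.ofReal_le_iff_le_toReal hrt).1 ht.le
  have h2 : ‖M.map (algebraMap ℝ ℂ) ^ t‖ ≤ r.toReal ^ t := by
    have h3 := pow_le_pow_left₀ (Real.rpow_nonneg (norm_nonneg _) _) h1 t
    rwa [one_div, Real.rpow_inv_natCast_pow (norm_nonneg _) ht0.ne'] at h3
  refine (norm_le_norm_map_complex _).trans (le_trans (le_of_eq ?_) h2)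
  rw [Matrix.map_pow]

theorem IsSchurStable.sum_le_calJ {M : Matrix (Fin n) (Fin n) ℝ} (hM : IsSchurStable M)
    (s : Finset ℕ) : ∑ t ∈ s, ‖M ^ t‖ ≤ calJ M :=
  hM.summable_norm_pow.sum_le_tsum s fun _ _ => norm_nonneg _

theorem IsSchurStable.one_le_calJ {M : Matrix (Fin n) (Fin n) ℝ} (hM : IsSchurStable M)
    (hn : 0 < n) : 1 ≤ calJ M := by
  have : Nonempty (Fin n) := ⟨⟨0, hn⟩⟩
  refine le_trans ?_ (hM.sum_le_calJ {0})
  have := CStarRing.norm_one (E := Matrix (Fin n) (Fin n) ℝ)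
  simp [this]

theorem calJ_nonneg (M : Matrix (Fin n) (Fin n) ℝ) : 0 ≤ calJ M :=
  tsum_nonneg fun _ => norm_nonneg _

/-- The solution of a discrete Lyapunov equation with stable dynamics and positive definite
right-hand side is positive definite. Iterating the equation shows that
`Sᵀ - S = M ^ t (Sᵀ - S) (M ^ t)ᵀ → 0` and that the quadratic form of `S` dominates that of `W`. -/
theorem posDef_of_lyapunov {M S W : Matrix (Fin n) (Fin n) ℝ} (hM : IsSchurStable M)
    (hW : W.PosDef) (h : S = M * S * Mᵀ + W) : S.PosDef := by
  have hWt : Wᵀ = W := by simpa using hW.isHermitian.eq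
  have hlim : Filter.Tendsto (fun t : ℕ => ‖M ^ t‖) Filter.atTop (nhds 0) :=
    hM.summable_norm_pow.tendsto_atTop_zero
  have htr : ∀ X : Matrix (Fin n) (Fin n) ℝ, ‖Xᵀ‖ = ‖X‖ := fun X => by
    rw [← conjTranspose_eq_transpose_of_trivial, l2_opNorm_conjTranspose]
  have hconj : ∀ X : Matrix (Fin n) (Fin n) ℝ,
      Filter.Tendsto (fun t : ℕ => M ^ t * X * (M ^ t)ᵀ) Filter.atTop (nhds 0) := by
    intro X
    rw [tendsto_zero_iff_norm_tendsto_zero]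
    refine squeeze_zero (fun _ => norm_nonneg _)
      (fun t => ((l2_opNorm_mul _ _).trans (mul_le_mul_of_nonneg_right (l2_opNorm_mul _ _)
        (norm_nonneg _)))) ?_
    simp only [htr]
    simpa using (hlim.mul_const ‖X‖).mul hlim
  have hsym : Sᵀ = S := by
    have hD : Sᵀ - S = M * (Sᵀ - S) * Mᵀ := by
      have h' : Sᵀ = M * Sᵀ * Mᵀ + W := by
        conv_lhs => rw [h]
        simp [Matrix.transpose_mul, hWt, Matrix.mul_assoc]
      calc Sᵀ - S = (M * Sᵀ * Mᵀ + W) - (M * S * Mᵀ + W) := by rw [← h', ← h]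
        _ = M * (Sᵀ - S) * Mᵀ := by rw [Matrix.mul_sub, Matrix.sub_mul]; abel
    have hDt : ∀ t : ℕ, Sᵀ - S = M ^ t * (Sᵀ - S) * (M ^ t)ᵀ := by
      intro t
      induction t with
      | zero => simp
      | succ t ih =>
        conv_lhs => rw [ih, hD]
        rw [pow_succ, Matrix.transpose_mul]
        simp only [Matrix.mul_assoc]
    have h0 := hconj (Sᵀ - S)
    simp only [← hDt] at h0
    exact sub_eq_zero.1 (tendsto_nhds_unique tendsto_const_nhds h0)
  have hge : ∀ t : ℕ, ∀ x : Vec n, qf W x + qf (M ^ (t + 1) * S * (M ^ (t + 1))ᵀ) x ≤ qf S x := by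
    have hadd : ∀ (X Y : Matrix (Fin n) (Fin n) ℝ) (x : Vec n),
        qf (X + Y) x = qf X x + qf Y x := fun X Y x => by
      simp [qf, inner_add_right]
    have hcj : ∀ (X Y : Matrix (Fin n) (Fin n) ℝ) (x : Vec n),
        qf (X * Y * Xᵀ) x = qf Y (toEuclideanLin Xᵀ x) := fun X Y x => by
      rw [qf, Matrix.mul_assoc, toEuclideanLin_mul X, inner_toEuclideanLin, toEuclideanLin_mul Y,
        qf]
    intro t
    induction t with
    | zero =>
      intro x
      conv_rhs => rw [h, hadd]
      simp [add_comm]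
    | succ t ih =>
      intro x
      have e : M ^ (t + 1) * S * (M ^ (t + 1))ᵀ
          = M ^ (t + 1 + 1) * S * (M ^ (t + 1 + 1))ᵀ + M ^ (t + 1) * W * (M ^ (t + 1))ᵀ := by
        conv_lhs => rw [h]
        rw [Matrix.mul_add, Matrix.add_mul, pow_succ M (t + 1), Matrix.transpose_mul]
        simp only [Matrix.mul_assoc]
      have h1 := ih x
      rw [e, hadd, hcj _ W] at h1
      have := qf_nonneg hW.posSemidef (toEuclideanLin (M ^ (t + 1))ᵀ x)
      linarith
  refine Matrix.PosDef.of_dotProduct_mulVec_pos (by simpa [IsHermitian] using hsym) ?_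
  intro x hx
  have hq : 0 < qf W (WithLp.toLp 2 x) := qf_pos hW (by simpa using hx)
  have hl : qf W (WithLp.toLp 2 x) ≤ qf S (WithLp.toLp 2 x) := by
    have h0 : Filter.Tendsto (fun t : ℕ => qf W (WithLp.toLp 2 x)
        + qf (M ^ (t + 1) * S * (M ^ (t + 1))ᵀ) (WithLp.toLp 2 x)) Filter.atTop
        (nhds (qf W (WithLp.toLp 2 x) + 0)) := by
      refine tendsto_const_nhds.add ?_
      rw [tendsto_zero_iff_norm_tendsto_zero]
      refine squeeze_zero (g := fun t => ‖M ^ (t + 1) * S * (M ^ (t + 1))ᵀ‖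
          * (‖(WithLp.toLp 2 x : Vec n)‖ * ‖(WithLp.toLp 2 x : Vec n)‖))
        (fun _ => norm_nonneg _) (fun t => ?_) ?_
      · rw [qf, Real.norm_eq_abs]
        refine (abs_real_inner_le_norm _ _).trans ?_
        have := mul_le_mul_of_nonneg_left (norm_toEuclideanLin_le
          (M ^ (t + 1) * S * (M ^ (t + 1))ᵀ) (WithLp.toLp 2 x)) (norm_nonneg (WithLp.toLp 2 x : Vec n))
        linarith
      · have h1 := ((Filter.tendsto_add_atTop_iff_nat 1).2 (hconj S)).norm.mul_const
          (‖(WithLp.toLp 2 x : Vec n)‖ * ‖(WithLp.toLp 2 x : Vec n)‖)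
        simpa using h1
    rw [add_zero] at h0
    exact le_of_tendsto h0 (Filter.Eventually.of_forall fun t => hge t _)
  have := hq.trans_le hl
  rw [qf_eq_dotProduct] at this
  simpa using this

end Stability

namespace Problem

variable {nx nu k H : ℕ} {P : Problem nx nu k H}

theorem Valid.posDef_Sx (hP : P.Valid) (h : Fin (H + 1)) : (P.Sx h).PosDef := by
  have hl := hP.lyapunov h
  rw [add_assoc] at hl
  refine posDef_of_lyapunov (hP.stable h) ?_ hl
  refine Matrix.PosDef.posSemidef_add ?_ (hP.noise_posDef h)
  have := Matrix.posSemidef_self_mul_conjTranspose P.B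
  rw [conjTranspose_eq_transpose_of_trivial] at this
  exact this.smul (sq_nonneg _)

end Problem


/-! ### Exponential moments of Gaussian vectors -/

section GaussianTools

/-- The exponential of a real number, as an extended nonnegative real. -/
noncomputable def eexp (x : ℝ) : ENNReal := ENNReal.ofReal (Real.exp x)

theorem eexp_add (x y : ℝ) : eexp (x + y) = eexp x * eexp y := by
  rw [eexp, Real.exp_add, ENNReal.ofReal_mul (Real.exp_nonneg _)]; rfl

theorem eexp_zero : eexp 0 = 1 := by simp [eexp]

theorem eexp_sum {ι : Type*} (s : Finset ι) (f : ι → ℝ) :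
    eexp (∑ i ∈ s, f i) = ∏ i ∈ s, eexp (f i) := by
  rw [eexp, Real.exp_sum, ENNReal.ofReal_prod_of_nonneg fun _ _ => Real.exp_nonneg _]; rfl

theorem eexp_mono {x y : ℝ} (h : x ≤ y) : eexp x ≤ eexp y :=
  ENNReal.ofReal_le_ofReal (Real.exp_le_exp.2 h)

theorem eexp_ne_zero (x : ℝ) : eexp x ≠ 0 := by
  simp [eexp, Real.exp_pos]

theorem eexp_ne_top (x : ℝ) : eexp x ≠ ⊤ := ENNReal.ofReal_ne_top

theorem eexp_nsmul (n : ℕ) (x : ℝ) : eexp (n * x) = eexp x ^ n := by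
  rw [eexp, Real.exp_nat_mul, ENNReal.ofReal_pow (Real.exp_nonneg _)]; rfl

theorem measurable_eexp : Measurable eexp :=
  Real.measurable_exp.ennreal_ofReal

theorem _root_.Measurable.eexp {α : Type*} [MeasurableSpace α] {f : α → ℝ} (hf : Measurable f) :
    Measurable fun x => MTIL.eexp (f x) := measurable_eexp.comp hf

/-- Exponential Markov inequality. -/
theorem measure_le_of_lintegral_eexp_le {Ω : Type*} [MeasurableSpace Ω] {μ : Measure Ω}
    {f : Ω → ℝ} (hf : Measurable f) {b : ℝ} (h : ∫⁻ ω, eexp (f ω) ∂μ ≤ eexp b) (c : ℝ) :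
    μ {ω | c ≤ f ω} ≤ eexp (b - c) := by
  have h1 := mul_meas_ge_le_lintegral (μ := μ) hf.eexp (eexp c)
  have h2 : {ω | c ≤ f ω} ⊆ {ω | eexp c ≤ eexp (f ω)} := fun ω hω => eexp_mono hω
  have h3 : eexp c * μ {ω | c ≤ f ω} ≤ eexp c * eexp (b - c) := by
    rw [← eexp_add, add_sub_cancel]
    exact (mul_le_mul_right (measure_mono h2) _).trans (h1.trans h)
  exact (ENNReal.mul_le_mul_iff_right (eexp_ne_zero c) (eexp_ne_top c)).1 h3

/-- Logarithm of `E exp (s g² + a g)` for a standard Gaussian `g`. -/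
noncomputable def gaussCgf (s a : ℝ) : ℝ :=
  -(Real.log (1 - 2 * s)) / 2 + a ^ 2 / (2 * (1 - 2 * s))

theorem lintegral_eexp_gaussianReal {s : ℝ} (hs : s < 1 / 2) (a : ℝ) :
    ∫⁻ g, eexp (s * g ^ 2 + a * g) ∂(gaussianReal 0 1) = eexp (gaussCgf s a) := by
  have hd : 0 < 1 - 2 * s := by linarith
  set v : NNReal := ⟨(1 - 2 * s)⁻¹, (inv_pos.2 hd).le⟩ with hv
  have hv0 : v ≠ 0 := by
    intro h
    have h' : (1 - 2 * s)⁻¹ = 0 := congrArg NNReal.toReal h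
    exact (inv_pos.2 hd).ne' h'
  have hvc : (v : ℝ) = (1 - 2 * s)⁻¹ := rfl
  have hmeas : Measurable fun g : ℝ => eexp (s * g ^ 2 + a * g) :=
    Measurable.eexp (by fun_prop)
  rw [gaussianReal_of_var_ne_zero _ one_ne_zero,
    lintegral_withDensity_eq_lintegral_mul _ (measurable_gaussianPDF 0 1) hmeas]
  have hpt : ∀ g : ℝ, (gaussianPDF 0 1 * fun g : ℝ => eexp (s * g ^ 2 + a * g)) g
      = eexp (gaussCgf s a) * gaussianPDF (a / (1 - 2 * s)) v g := by
    intro g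
    simp only [Pi.mul_apply, gaussianPDF, eexp]
    rw [← ENNReal.ofReal_mul (gaussianPDFReal_nonneg _ _ _),
      ← ENNReal.ofReal_mul (Real.exp_nonneg _)]
    congr 1
    have h2p : (0 : ℝ) < 2 * Real.pi := by positivity
    have hsq : √(2 * Real.pi * v) = √(2 * Real.pi) / √(1 - 2 * s) := by
      rw [hvc, ← div_eq_mul_inv, Real.sqrt_div h2p.le]
    have hls : Real.exp (-(Real.log (1 - 2 * s)) / 2) = (√(1 - 2 * s))⁻¹ := by
      rw [neg_div, Real.exp_neg, Real.sqrt_eq_rpow, Real.rpow_def_of_pos hd]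
      congr 2; ring
    simp only [gaussianPDFReal, gaussCgf, hsq, Real.exp_add, hls, NNReal.coe_one, mul_one, sub_zero]
    have hs0 : √(1 - 2 * s) ≠ 0 := (Real.sqrt_pos.2 hd).ne'
    have hp0 : √(2 * Real.pi) ≠ 0 := (Real.sqrt_pos.2 h2p).ne'
    have key : Real.exp (-g ^ 2 / 2) * (Real.exp (s * g ^ 2) * Real.exp (a * g))
        = Real.exp (a ^ 2 / (2 * (1 - 2 * s))) * Real.exp (-(g - a / (1 - 2 * s)) ^ 2 / (2 * v)) := by
      rw [← Real.exp_add, ← Real.exp_add, ← Real.exp_add, hvc]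
      congr 1
      field_simp
      ring
    calc (√(2 * Real.pi))⁻¹ * Real.exp (-g ^ 2 / 2) * (Real.exp (s * g ^ 2) * Real.exp (a * g))
        = (√(2 * Real.pi))⁻¹ * (Real.exp (-g ^ 2 / 2) *
            (Real.exp (s * g ^ 2) * Real.exp (a * g))) := by ring
      _ = _ := by
          rw [key, inv_div]
          field_simp
  rw [lintegral_congr hpt, lintegral_const_mul _ (measurable_gaussianPDF _ _),
    lintegral_gaussianPDF_eq_one _ hv0, mul_one]

theorem lintegral_pi_prod {ι : Type*} [Fintype ι] {α : ι → Type*} [∀ i, MeasurableSpace (α i)]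
    (μ : ∀ i, Measure (α i)) [∀ i, IsProbabilityMeasure (μ i)] {f : ∀ i, α i → ENNReal}
    (hf : ∀ i, Measurable (f i)) :
    ∫⁻ x, ∏ i, f i (x i) ∂(Measure.pi μ) = ∏ i, ∫⁻ y, f i y ∂(μ i) := by
  rw [lintegral_prod_eq_prod_lintegral_of_indepFun Finset.univ (fun i (x : ∀ i, α i) => f i (x i))
    (iIndepFun_pi fun i => (hf i).aemeasurable) fun i => (hf i).comp (measurable_pi_apply i)]
  refine Finset.prod_congr rfl fun i _ => ?_
  exact (measurePreserving_eval μ i).lintegral_comp (hf i)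

section StdGaussian

variable {E : Type*} [NormedAddCommGroup E] [InnerProductSpace ℝ E] [FiniteDimensional ℝ E]
  [MeasurableSpace E] [BorelSpace E] {ι : Type*} [Fintype ι]

/-- Exponential moments of a quadratic polynomial that is diagonal in an orthonormal basis. -/
theorem lintegral_eexp_stdGaussian (b : OrthonormalBasis ι ℝ E) {s : ι → ℝ}
    (hs : ∀ i, s i < 1 / 2) (a : ι → ℝ) :
    ∫⁻ g, eexp (∑ i, (s i * inner ℝ (b i) g ^ 2 + a i * inner ℝ (b i) g)) ∂(stdGaussian E)
      = eexp (∑ i, gaussCgf (s i) (a i)) := by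
  rw [stdGaussian_eq_map_pi_orthonormalBasis b, lintegral_map]
  · have h : ∀ x : ι → ℝ, eexp (∑ i, (s i * inner ℝ (b i) (∑ j, x j • b j) ^ 2
        + a i * inner ℝ (b i) (∑ j, x j • b j))) = ∏ i, eexp (s i * x i ^ 2 + a i * x i) := by
      intro x
      rw [eexp_sum]
      refine Finset.prod_congr rfl fun i _ => ?_
      rw [b.orthonormal.inner_right_fintype]
    rw [lintegral_congr h, lintegral_pi_prod (fun _ : ι => gaussianReal 0 1)
      (f := fun i y => eexp (s i * y ^ 2 + a i * y))
      (fun i => Measurable.eexp (by fun_prop)), eexp_sum]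
    exact Finset.prod_congr rfl fun i _ => lintegral_eexp_gaussianReal (hs i) _
  · exact Measurable.eexp (by fun_prop)
  · fun_prop

end StdGaussian

/-- Gaussian mixture of exponential tilts. -/
theorem lintegral_eexp_inner_sub_sq {ι : Type*} [Fintype ι] (a : EuclideanSpace ℝ ι) :
    ∫⁻ g, eexp (inner ℝ a g - ‖g‖ ^ 2 / 2) ∂(stdGaussian (EuclideanSpace ℝ ι))
      = eexp (‖a‖ ^ 2 / 4 - Fintype.card ι * (Real.log 2 / 2)) := by
  have h := lintegral_eexp_stdGaussian (EuclideanSpace.basisFun ι ℝ) (s := fun _ => -1 / 2)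
    (fun _ => by norm_num) (fun i => a i)
  have e1 : ∀ g : EuclideanSpace ℝ ι, ∑ i, ((-1 / 2 : ℝ)
      * inner ℝ (EuclideanSpace.basisFun ι ℝ i) g ^ 2
      + a i * inner ℝ (EuclideanSpace.basisFun ι ℝ i) g) = inner ℝ a g - ‖g‖ ^ 2 / 2 := by
    intro g
    simp only [EuclideanSpace.basisFun_inner]
    rw [EuclideanSpace.real_norm_sq_eq, Finset.sum_div, PiLp.inner_apply, ← Finset.sum_sub_distrib]
    refine Finset.sum_congr rfl fun i _ => ?_
    simp; ring
  simp only [e1] at h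
  rw [h]
  congr 1
  rw [EuclideanSpace.real_norm_sq_eq]
  simp only [gaussCgf]
  norm_num [Finset.sum_add_distrib, Finset.sum_div]
  ring

/-- **Self-normalized tail bound** by the method of mixtures: if `⟨a, g⟩ - q(g)` is an exponential
supermartingale increment for every direction `g`, then `‖a‖²` is large with small probability
on the part of the space where the normalization `q` is at most `‖g‖² / 2`. -/
theorem measure_selfNormalized_le {Ω ι : Type*} [MeasurableSpace Ω] {μ : Measure Ω} [SFinite μ]
    [Fintype ι]
    {a : Ω → EuclideanSpace ℝ ι} (ha : Measurable a) {q : Ω → EuclideanSpace ℝ ι → ℝ}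
    (hq : Measurable fun p : Ω × EuclideanSpace ℝ ι => q p.1 p.2)
    (h : ∀ g, ∫⁻ ω, eexp (inner ℝ (a ω) g - q ω g) ∂μ ≤ 1) {B : Set Ω} {A : ℝ}
    (hB : ∀ ω ∈ B, (∀ g, q ω g ≤ ‖g‖ ^ 2 / 2) ∧ A ≤ ‖a ω‖ ^ 2) :
    μ B ≤ eexp (Fintype.card ι * (Real.log 2 / 2) - A / 4) := by
  set γ := stdGaussian (EuclideanSpace ℝ ι)
  have hm : Measurable fun p : Ω × EuclideanSpace ℝ ι =>
      eexp (inner ℝ (a p.1) p.2 - q p.1 p.2) :=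
    Measurable.eexp (((ha.comp measurable_fst).inner measurable_snd).sub hq)
  set F : Ω → ENNReal := fun ω => ∫⁻ g, eexp (inner ℝ (a ω) g - q ω g) ∂γ with hF
  have hFm : Measurable F := hm.lintegral_prod_right'
  have hFi : ∫⁻ ω, F ω ∂μ ≤ 1 := by
    rw [hF, lintegral_lintegral_swap hm.aemeasurable]
    calc ∫⁻ g, ∫⁻ ω, eexp (inner ℝ (a ω) g - q ω g) ∂μ ∂γ ≤ ∫⁻ _, 1 ∂γ :=
          lintegral_mono h
      _ = 1 := by simp
  set c := A / 4 - Fintype.card ι * (Real.log 2 / 2) with hc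
  have hsub : B ⊆ {ω | eexp c ≤ F ω} := by
    intro ω hω
    obtain ⟨h1, h2⟩ := hB ω hω
    calc eexp c ≤ eexp (‖a ω‖ ^ 2 / 4 - Fintype.card ι * (Real.log 2 / 2)) :=
          eexp_mono (by rw [hc]; linarith)
      _ = ∫⁻ g, eexp (inner ℝ (a ω) g - ‖g‖ ^ 2 / 2) ∂γ := (lintegral_eexp_inner_sub_sq _).symm
      _ ≤ F ω := lintegral_mono fun g => eexp_mono (by linarith [h1 g])
  have h3 := mul_meas_ge_le_lintegral (μ := μ) hFm (eexp c)
  have h4 : eexp c * μ B ≤ eexp c * eexp (-c) := by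
    rw [← eexp_add, add_neg_cancel, eexp_zero]
    exact (mul_le_mul_right (measure_mono hsub) _).trans (h3.trans hFi)
  have h5 := (ENNReal.mul_le_mul_iff_right (eexp_ne_zero c) (eexp_ne_top c)).1 h4
  rwa [hc, neg_sub] at h5

/-! ### Quadratic forms of Gaussian vectors with a given covariance -/

theorem multivariateGaussian_zero_eq_map {n : ℕ} (S : Matrix (Fin n) (Fin n) ℝ) :
    multivariateGaussian 0 S = (stdGaussian (Vec n)).map (toEuclideanLin (matSqrt S)) := by
  rw [multivariateGaussian]
  simp only [zero_add]
  rfl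

theorem measurable_toEuclideanLin {m n : ℕ} (M : Matrix (Fin m) (Fin n) ℝ) :
    Measurable (toEuclideanLin M) :=
  (LinearMap.continuous_of_finiteDimensional _).measurable

theorem lintegral_eexp_norm_sq_multivariateGaussian {n : ℕ} {S : Matrix (Fin n) (Fin n) ℝ}
    (hS : S.PosSemidef) {s : ℝ} (hs : ∀ i, s * hS.isHermitian.eigenvalues i < 1 / 2) :
    ∫⁻ y, eexp (s * ‖y‖ ^ 2) ∂(multivariateGaussian 0 S)
      = eexp (∑ i, gaussCgf (s * hS.isHermitian.eigenvalues i) 0) := by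
  rw [multivariateGaussian_zero_eq_map,
    lintegral_map (Measurable.eexp (by fun_prop)) (measurable_toEuclideanLin _),
    ← lintegral_eexp_stdGaussian hS.isHermitian.eigenvectorBasis hs fun _ => 0]
  refine lintegral_congr fun g => ?_
  congr 1
  rw [← qf_eq_norm_sq_matSqrt hS, qf_eq_sum_eigenvalues hS.isHermitian, Finset.mul_sum]
  refine Finset.sum_congr rfl fun i _ => ?_
  ring

theorem lintegral_eexp_inner_multivariateGaussian {n : ℕ} {S : Matrix (Fin n) (Fin n) ℝ}
    (hS : S.PosSemidef) (v : Vec n) :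
    ∫⁻ y, eexp (inner ℝ y v) ∂(multivariateGaussian 0 S) = eexp (qf S v / 2) := by
  rw [multivariateGaussian_zero_eq_map,
    lintegral_map (Measurable.eexp (by fun_prop)) (measurable_toEuclideanLin _)]
  set u := toEuclideanLin (matSqrt S) v with hu
  have h := lintegral_eexp_stdGaussian (EuclideanSpace.basisFun (Fin n) ℝ) (s := fun _ => 0)
    (fun _ => by norm_num) (fun i => u i)
  have e1 : ∀ g : Vec n, ∑ i, ((0 : ℝ) * inner ℝ (EuclideanSpace.basisFun (Fin n) ℝ i) g ^ 2
      + u i * inner ℝ (EuclideanSpace.basisFun (Fin n) ℝ i) g)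
      = inner ℝ (toEuclideanLin (matSqrt S) g) v := by
    intro g
    have e2 : inner ℝ (toEuclideanLin (matSqrt S) g) v = inner ℝ u g := by
      rw [real_inner_comm, inner_toEuclideanLin, matSqrt_transpose]
    rw [e2, PiLp.inner_apply]
    simp only [EuclideanSpace.basisFun_inner]
    simp [mul_comm]
  simp only [e1] at h
  rw [h]
  congr 1
  rw [qf_eq_norm_sq_matSqrt hS, ← hu, EuclideanSpace.real_norm_sq_eq, Finset.sum_div]
  simp [gaussCgf]

theorem gaussCgf_zero_le {u : ℝ} (h1 : -(1 / 4) ≤ u) (h2 : u ≤ 1 / 4) :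
    gaussCgf u 0 ≤ u + 2 * u ^ 2 := by
  have hd : 0 < 1 - 2 * u := by linarith
  have key : 1 ≤ Real.exp (2 * u + 4 * u ^ 2) * (1 - 2 * u) := by
    rcases le_total 0 u with h | h
    · have h3 := Real.quadratic_le_exp_of_nonneg (x := 2 * u + 4 * u ^ 2) (by positivity)
      refine le_trans ?_ (mul_le_mul_of_nonneg_right h3 hd.le)
      have h4 : 0 ≤ u ^ 2 * (2 - 4 * u - 8 * u ^ 2 - 16 * u ^ 3) := by
        refine mul_nonneg (sq_nonneg _) ?_
        have : u ^ 2 ≤ 1 / 16 := by nlinarith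
        have : u ^ 3 ≤ 1 / 64 := by nlinarith
        linarith
      nlinarith
    · have h3 := Real.add_one_le_exp (2 * u + 4 * u ^ 2)
      refine le_trans ?_ (mul_le_mul_of_nonneg_right h3 hd.le)
      nlinarith [pow_nonneg (neg_nonneg.2 h) 3]
  have hlog := Real.log_le_log one_pos key
  rw [Real.log_one, Real.log_mul (Real.exp_pos _).ne' hd.ne', Real.log_exp] at hlog
  simp only [gaussCgf]
  norm_num
  linarith

theorem gaussCgf_zero_le_log_two {u : ℝ} (h2 : u ≤ 1 / 4) : gaussCgf u 0 ≤ Real.log 2 / 2 := by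
  have h := Real.log_le_log (by norm_num : (0 : ℝ) < 1 / 2) (by linarith : 1 / 2 ≤ 1 - 2 * u)
  rw [one_div, Real.log_inv] at h
  simp only [gaussCgf]
  norm_num
  linarith

theorem eigenvalues_le_of_qf_le {n : ℕ} {S : Matrix (Fin n) (Fin n) ℝ} (hS : S.IsHermitian)
    {L : ℝ} (hL : ∀ r, qf S r ≤ L * ‖r‖ ^ 2) (i : Fin n) : hS.eigenvalues i ≤ L := by
  have h := hL (hS.eigenvectorBasis i)
  rw [qf_eq_sum_eigenvalues hS] at h
  simp only [hS.eigenvectorBasis.inner_eq_ite, hS.eigenvectorBasis.norm_eq_one] at h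
  simpa using h

theorem lintegral_eexp_norm_sq_le {n : ℕ} {S : Matrix (Fin n) (Fin n) ℝ} (hS : S.PosSemidef)
    {L : ℝ} (hL : ∀ r, qf S r ≤ L * ‖r‖ ^ 2) {s : ℝ} (hs0 : 0 ≤ s) (hs : s * L ≤ 1 / 4) :
    ∫⁻ y, eexp (s * ‖y‖ ^ 2) ∂(multivariateGaussian 0 S) ≤ eexp (n * (Real.log 2 / 2)) := by
  have hi : ∀ i, s * hS.isHermitian.eigenvalues i ≤ 1 / 4 := fun i =>
    (mul_le_mul_of_nonneg_left (eigenvalues_le_of_qf_le hS.isHermitian hL i) hs0).trans hs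
  rw [lintegral_eexp_norm_sq_multivariateGaussian hS fun i => (hi i).trans_lt (by norm_num)]
  refine eexp_mono ((Finset.sum_le_sum fun i _ => gaussCgf_zero_le_log_two (hi i)).trans ?_)
  simp

/-- Hanson-Wright type bound: a quadratic moment generating function controlled by the trace and
the spectral norm of the covariance. -/
theorem lintegral_eexp_norm_sq_le_trace {n : ℕ} {S : Matrix (Fin n) (Fin n) ℝ} (hS : S.PosSemidef)
    {L : ℝ} (hL : ∀ r, qf S r ≤ L * ‖r‖ ^ 2) {s : ℝ} (hs : |s| * L ≤ 1 / 4) :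
    ∫⁻ y, eexp (s * ‖y‖ ^ 2) ∂(multivariateGaussian 0 S)
      ≤ eexp ((s + 2 * s ^ 2 * L) * S.trace) := by
  have h0 : ∀ i, 0 ≤ hS.isHermitian.eigenvalues i := hS.eigenvalues_nonneg
  have hLi := eigenvalues_le_of_qf_le hS.isHermitian hL
  have hi : ∀ i, |s * hS.isHermitian.eigenvalues i| ≤ 1 / 4 := fun i => by
    rw [abs_mul, abs_of_nonneg (h0 i)]
    exact (mul_le_mul_of_nonneg_left (hLi i) (abs_nonneg _)).trans hs
  rw [lintegral_eexp_norm_sq_multivariateGaussian hS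
    fun i => (le_abs_self _).trans_lt ((hi i).trans_lt (by norm_num))]
  refine eexp_mono ?_
  rw [hS.isHermitian.trace_eq_sum_eigenvalues, Finset.mul_sum]
  refine Finset.sum_le_sum fun i _ => ?_
  refine (gaussCgf_zero_le (abs_le.1 (hi i)).1 (abs_le.1 (hi i)).2).trans ?_
  have := mul_le_mul_of_nonneg_left (hLi i) (h0 i)
  simp only [RCLike.ofReal_real_eq_id, id]
  nlinarith [sq_nonneg s]

end GaussianTools


/-! ### Covering the unit sphere -/

section Net

variable {E : Type*} [NormedAddCommGroup E] [InnerProductSpace ℝ E] [FiniteDimensional ℝ E]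

/-- A maximal separated subset of the sphere is a net; its cardinality is bounded by comparing
volumes. -/
theorem exists_sphere_net (E : Type*) [NormedAddCommGroup E] [InnerProductSpace ℝ E]
    [FiniteDimensional ℝ E] :
    ∃ s : Finset E, s.card ≤ 5 ^ Module.finrank ℝ E ∧ (∀ c ∈ s, ‖c‖ = 1) ∧
      ∀ v : E, ‖v‖ = 1 → ∃ c ∈ s, ‖v - c‖ ≤ 1 / 2 := by
  classical
  -- a separated subset of the sphere of radius `2` with the largest possible number of points
  let p : ℕ → Prop := fun n => ∃ s : Finset E, s.card = n ∧ (∀ c ∈ s, ‖c‖ = 2) ∧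
    ∀ c ∈ s, ∀ d ∈ s, c ≠ d → 1 ≤ ‖c - d‖
  have hp : ∀ n, p n → n ≤ 5 ^ Module.finrank ℝ E := by
    rintro n ⟨s, rfl, h1, h2⟩
    exact Besicovitch.card_le_of_separated s (fun c hc => (h1 c hc).le) h2
  have hp0 : p 0 := ⟨∅, by simp⟩
  obtain ⟨s, hs, h1, h2⟩ : p (Nat.findGreatest p (5 ^ Module.finrank ℝ E)) :=
    Nat.findGreatest_spec (Nat.zero_le _) hp0
  refine ⟨s.image fun c => (1 / 2 : ℝ) • c, ?_, ?_, ?_⟩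
  · exact Finset.card_image_le.trans (hs ▸ Nat.findGreatest_le _)
  · intro c hc
    obtain ⟨d, hd, rfl⟩ := Finset.mem_image.1 hc
    rw [norm_smul, h1 d hd]; norm_num
  · intro v hv
    by_contra hcon
    push Not at hcon
    have hv2 : ‖(2 : ℝ) • v‖ = 2 := by rw [norm_smul, hv]; norm_num
    have hfar : ∀ c ∈ s, 1 ≤ ‖(2 : ℝ) • v - c‖ := by
      intro c hc
      have h := hcon _ (Finset.mem_image_of_mem _ hc)
      have e : (2 : ℝ) • v - c = (2 : ℝ) • (v - (1 / 2 : ℝ) • c) := by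
        rw [smul_sub, smul_smul]; norm_num
      rw [e, norm_smul]
      norm_num at h ⊢
      linarith
    have hnot : (2 : ℝ) • v ∉ s := by
      intro hmem
      have := hfar _ hmem
      simp at this
      linarith
    have hbig : p (s.card + 1) := by
      refine ⟨insert ((2 : ℝ) • v) s, Finset.card_insert_of_notMem hnot, ?_, ?_⟩
      · intro c hc
        rcases Finset.mem_insert.1 hc with rfl | hc
        · exact hv2
        · exact h1 c hc
      · intro c hc d hd hcd
        rcases Finset.mem_insert.1 hc with rfl | hc <;> rcases Finset.mem_insert.1 hd with rfl | hd
        · exact absurd rfl hcd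
        · exact hfar d hd
        · rw [norm_sub_rev]; exact hfar c hc
        · exact h2 c hc d hd hcd
    have := Nat.le_findGreatest (P := p) (hp _ hbig) hbig
    omega

/-- A symmetric bilinear form is controlled by its values on a net of the unit sphere. -/
theorem abs_le_of_le_on_net (b : E →ₗ[ℝ] E →ₗ[ℝ] ℝ) (hb : ∀ v w, b v w = b w v) {s : Finset E}
    (hs1 : ∀ v : E, ‖v‖ = 1 → ∃ c ∈ s, ‖v - c‖ ≤ 1 / 2) (hs2 : ∀ c ∈ s, ‖c‖ = 1) {η : ℝ}
    (h : ∀ c ∈ s, |b c c| ≤ η) (v : E) : |b v v| ≤ 32 * η * ‖v‖ ^ 2 := by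
  rcases eq_or_ne v 0 with rfl | hv
  · simp
  have hcont : Continuous fun v => |b v v| := by
    have h1 : Continuous fun v => b.toContinuousBilinearMap v v := by fun_prop
    exact continuous_abs.comp h1
  have hne : (Metric.sphere (0 : E) 1).Nonempty :=
    ⟨‖v‖⁻¹ • v, by simp [norm_smul, hv]⟩
  obtain ⟨w, hw, hmax⟩ := (isCompact_sphere (0 : E) 1).exists_isMaxOn hne hcont.continuousOn
  have hw1 : ‖w‖ = 1 := by simpa using hw
  set M := |b w w| with hM
  have hM0 : 0 ≤ M := abs_nonneg _
  have hall : ∀ x : E, |b x x| ≤ M * ‖x‖ ^ 2 := by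
    intro x
    rcases eq_or_ne x 0 with rfl | hx
    · simp
    have hx' : ‖x‖ ≠ 0 := norm_ne_zero_iff.2 hx
    have h1 : |b (‖x‖⁻¹ • x) (‖x‖⁻¹ • x)| ≤ M :=
      hmax (by simp [norm_smul, hx] : ‖x‖⁻¹ • x ∈ Metric.sphere (0 : E) 1)
    simp only [map_smul, LinearMap.smul_apply, smul_eq_mul, abs_mul, abs_inv, abs_norm] at h1
    calc |b x x| = (‖x‖⁻¹ * (‖x‖⁻¹ * |b x x|)) * ‖x‖ ^ 2 := by field_simp
      _ ≤ M * ‖x‖ ^ 2 := mul_le_mul_of_nonneg_right h1 (sq_nonneg _)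
  obtain ⟨c, hc, hwc⟩ := hs1 w hw1
  have hc1 := hs2 c hc
  set x := w - c with hx
  set y := w + c with hy
  have hpar : ‖x‖ ^ 2 + ‖y‖ ^ 2 = 4 := by
    have := parallelogram_law_with_norm ℝ w c
    rw [hw1, hc1] at this
    rw [hx, hy]; linarith
  have hdiff : b w w - b c c = b x y := by
    simp only [hx, hy, map_sub, map_add, LinearMap.sub_apply]
    rw [hb c w]; ring
  -- polarization with weights `2` and `1/2`, which makes the bound smaller than `M`
  have hpol : b x y = (b ((2 : ℝ) • x + (1 / 2 : ℝ) • y) ((2 : ℝ) • x + (1 / 2 : ℝ) • y)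
      - b ((2 : ℝ) • x - (1 / 2 : ℝ) • y) ((2 : ℝ) • x - (1 / 2 : ℝ) • y)) / 4 := by
    simp only [map_sub, map_add, map_smul, LinearMap.sub_apply, LinearMap.add_apply,
      LinearMap.smul_apply, smul_eq_mul]
    rw [hb y x]; ring
  have hpar2 := parallelogram_law_with_norm ℝ ((2 : ℝ) • x) ((1 / 2 : ℝ) • y)
  simp only [norm_smul] at hpar2
  norm_num at hpar2
  have h1 := abs_le.1 (hall ((2 : ℝ) • x + (1 / 2 : ℝ) • y))
  have h2 := abs_le.1 (hall ((2 : ℝ) • x - (1 / 2 : ℝ) • y))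
  have hx2 : ‖x‖ ^ 2 ≤ 1 / 4 := by nlinarith [norm_nonneg x]
  have hsum : M * (‖(2 : ℝ) • x + (1 / 2 : ℝ) • y‖ ^ 2 + ‖(2 : ℝ) • x - (1 / 2 : ℝ) • y‖ ^ 2)
      ≤ M * (31 / 8) := by
    refine mul_le_mul_of_nonneg_left ?_ hM0
    norm_num
    nlinarith
  have hbxy : |b x y| ≤ M * (31 / 32) := by
    rw [hpol, abs_le]
    constructor <;> nlinarith
  have hMle : M ≤ 32 * η := by
    have h3 := h c hc
    have h4 : M ≤ |b c c| + |b x y| := by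
      rw [hM, ← hdiff]
      calc |b w w| = |b c c + (b w w - b c c)| := by ring_nf
        _ ≤ _ := abs_add_le _ _
    linarith
  exact (hall v).trans (mul_le_mul_of_nonneg_right hMle (sq_nonneg _))

/-- Empirical second moments concentrate on a whole finite-dimensional space as soon as they do so
in each direction, up to a factor exponential in the dimension. -/
theorem measure_exists_quadratic_deviation_le {Ω J : Type*} [MeasurableSpace Ω] [Fintype J]
    {μ : Measure Ω} (f : Ω → J → E →ₗ[ℝ] ℝ) {N p η : ℝ}
    (h : ∀ v : E, ‖v‖ = 1 → μ {ω | η < |∑ j, f ω j v ^ 2 - N|} ≤ eexp p) :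
    μ {ω | ∃ v : E, 32 * η * ‖v‖ ^ 2 < |∑ j, f ω j v ^ 2 - N * ‖v‖ ^ 2|}
      ≤ eexp (Module.finrank ℝ E * Real.log 5 + p) := by
  obtain ⟨s, hcard, hs2, hs1⟩ := exists_sphere_net E
  have hsub : {ω | ∃ v : E, 32 * η * ‖v‖ ^ 2 < |∑ j, f ω j v ^ 2 - N * ‖v‖ ^ 2|}
      ⊆ ⋃ c ∈ s, {ω | η < |∑ j, f ω j c ^ 2 - N|} := by
    rintro ω ⟨v, hv⟩
    by_contra hcon
    simp only [Set.mem_iUnion, not_exists, Set.mem_ofPred_eq, not_lt] at hcon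
    let b : E →ₗ[ℝ] E →ₗ[ℝ] ℝ :=
      (∑ j, (f ω j).smulRight (f ω j)) - N • innerₗ E
    have hb : ∀ v w, b v w = ∑ j, f ω j v * f ω j w - N * inner ℝ v w := by
      intro v w; simp [b]
    have key := abs_le_of_le_on_net b (fun v w => by
      rw [hb, hb, real_inner_comm]; simp only [mul_comm]) hs1 hs2 (η := η) (fun c hc => by
        rw [hb, real_inner_self_eq_norm_sq, hs2 c hc]
        simpa [sq] using hcon c hc) v
    rw [hb, real_inner_self_eq_norm_sq] at key
    simp only [← sq] at key
    linarith
  refine (measure_mono hsub).trans ((measure_biUnion_finset_le s _).trans ?_)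
  calc ∑ c ∈ s, μ {ω | η < |∑ j, f ω j c ^ 2 - N|} ≤ ∑ c ∈ s, eexp p :=
        Finset.sum_le_sum fun c hc => h c (hs2 c hc)
    _ = s.card * eexp p := by simp
    _ ≤ (5 ^ Module.finrank ℝ E : ℕ) * eexp p := by gcongr
    _ = _ := by
      have h5 : eexp (Real.log 5) = 5 := by
        rw [eexp, Real.exp_log (by norm_num)]
        norm_num
      rw [eexp_add, eexp_nsmul, h5]
      simp

end Net

/-! ### Products of conditional densities -/

section Predictable

/-- Resampling one coordinate of a product measure leaves the measure invariant. -/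
theorem measurePreserving_update {ι : Type*} [Fintype ι] [DecidableEq ι] {α : ι → Type*}
    [∀ i, MeasurableSpace (α i)] (μ : ∀ i, Measure (α i)) [∀ i, IsProbabilityMeasure (μ i)]
    (i : ι) :
    MeasurePreserving (fun p : (∀ j, α j) × α i => Function.update p.1 i p.2)
      ((Measure.pi μ).prod (μ i)) (Measure.pi μ) := by
  have hm : Measurable fun p : (∀ j, α j) × α i => Function.update p.1 i p.2 := by
    rw [measurable_pi_iff]
    intro j
    by_cases h : j = i
    · subst h; simpa using measurable_snd
    · simp only [Function.update_of_ne h]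
      exact (measurable_pi_apply j).comp measurable_fst
  refine ⟨hm, (Measure.pi_eq fun s hs => ?_).symm⟩
  rw [Measure.map_apply hm (MeasurableSet.univ_pi hs)]
  have hpre : (fun p : (∀ j, α j) × α i => Function.update p.1 i p.2) ⁻¹' Set.univ.pi s
      = (Set.univ.pi (Function.update s i Set.univ)) ×ˢ s i := by
    ext ⟨x, y⟩
    simp only [Set.mem_preimage, Set.mem_pi, Set.mem_univ, true_imp_iff, Set.mem_prod]
    constructor
    · intro h
      refine ⟨fun j => ?_, by simpa using h i⟩
      by_cases hj : j = i
      · subst hj; simp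
      · simpa [Function.update_of_ne hj] using h j
    · rintro ⟨h1, h2⟩ j
      by_cases hj : j = i
      · subst hj; simpa using h2
      · simpa [Function.update_of_ne hj] using h1 j
  rw [hpre, Measure.prod_prod, Measure.pi_pi, ← Finset.mul_prod_erase _ _ (Finset.mem_univ i),
    ← Finset.mul_prod_erase (a := i) _ (fun j => μ j (s j)) (Finset.mem_univ i)]
  have : ∏ j ∈ Finset.univ.erase i, μ j (Function.update s i Set.univ j)
      = ∏ j ∈ Finset.univ.erase i, μ j (s j) :=
    Finset.prod_congr rfl fun j hj => by rw [Function.update_of_ne (Finset.ne_of_mem_erase hj)]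
  rw [this]
  simp [mul_comm]

/-- A product of adapted factors, each with conditional mean at most one, has mean at most one. -/
theorem lintegral_prod_adapted_le_one {T : ℕ} {α : Type*} [MeasurableSpace α]
    (μ : Fin T → Measure α) [∀ i, IsProbabilityMeasure (μ i)]
    {F : Fin T → (Fin T → α) → ENNReal} (hF : ∀ t, Measurable (F t))
    (hadapt : ∀ t s z ζ, t < s → F t (Function.update z s ζ) = F t z)
    (hmean : ∀ t z, ∫⁻ ζ, F t (Function.update z t ζ) ∂(μ t) ≤ 1) :
    ∫⁻ z, ∏ t, F t z ∂(Measure.pi μ) ≤ 1 := by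
  have key : ∀ n ≤ T, ∫⁻ z, ∏ t with t.val < n, F t z ∂(Measure.pi μ) ≤ 1 := by
    intro n
    induction n with
    | zero => intro _; simp
    | succ n ih =>
      intro hn
      let i : Fin T := ⟨n, hn⟩
      have hset : (Finset.univ.filter fun t : Fin T => t.val < n + 1)
          = insert i (Finset.univ.filter fun t : Fin T => t.val < n) := by
        ext t
        simp only [Finset.mem_filter, Finset.mem_univ, true_and, Finset.mem_insert, Fin.ext_iff, i]
        omega
      have hnot : i ∉ Finset.univ.filter fun t : Fin T => t.val < n := by simp [i]
      have hmP : Measurable fun z => ∏ t with t.val < n, F t z :=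
        Finset.measurable_prod _ fun t _ => hF t
      have hm : Measurable fun z => ∏ t with t.val < n + 1, F t z :=
        Finset.measurable_prod _ fun t _ => hF t
      have hup := measurePreserving_update μ i
      have hfub := lintegral_prod (μ := Measure.pi μ) (ν := μ i) _
        (hm.comp hup.measurable).aemeasurable
      simp only [Function.comp_apply] at hfub
      rw [← hup.lintegral_comp hm, hfub]
      refine le_trans (lintegral_mono fun z => ?_) (ih (Nat.le_of_succ_le hn))
      have hz : ∀ ζ, ∏ t with t.val < n + 1, F t (Function.update z i ζ)
          = F i (Function.update z i ζ) * ∏ t with t.val < n, F t z := by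
        intro ζ
        rw [hset, Finset.prod_insert hnot]
        congr 1
        refine Finset.prod_congr rfl fun t ht => hadapt t i z ζ ?_
        simpa [i, Fin.lt_def] using ht
      simp only [hz]
      have hmi : Measurable fun ζ => F i (Function.update z i ζ) :=
        (hF i).comp (measurable_update z)
      rw [lintegral_mul_const _ hmi]
      exact mul_le_of_le_one_left (zero_le) (hmean i z)
  have h := key T le_rfl
  simpa using h

end Predictable


/-! ### Closed-loop trajectories -/

section Trajectories

variable {nx nu T : ℕ} (A : Matrix (Fin nx) (Fin nx) ℝ) (B : Matrix (Fin nx) (Fin nu) ℝ)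
  (K : Matrix (Fin nu) (Fin nx) ℝ)

theorem state_succ {t : ℕ} (ht : t < T) (ω : Noise nx nu T) :
    state A B K ω (t + 1) = toEuclideanLin (A + B * K) (state A B K ω t)
      + (toEuclideanLin B (ω.2.1 ⟨t, ht⟩) + ω.2.2 ⟨t, ht⟩) := by
  simp only [state, ht, dite_true, map_add, LinearMap.add_apply, toEuclideanLin_mul]
  abel

/-- The state at time `t` only depends on the noise before time `t`. -/
theorem state_congr {ω ω' : Noise nx nu T} (h0 : ω.1 = ω'.1) {t : ℕ}
    (h : ∀ s : Fin T, s.val < t → ω.2.1 s = ω'.2.1 s ∧ ω.2.2 s = ω'.2.2 s) :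
    state A B K ω t = state A B K ω' t := by
  induction t with
  | zero => exact h0
  | succ t ih =>
    have ih' := ih fun s hs => h s (by omega)
    by_cases ht : t < T
    · obtain ⟨h1, h2⟩ := h ⟨t, ht⟩ (Nat.lt_succ_self t)
      rw [state_succ A B K ht, state_succ A B K ht, ih', h1, h2]
    · simp only [state, ht, dite_false, ih']

theorem isLinearMap_state (t : ℕ) :
    IsLinearMap ℝ fun ω : Noise nx nu T => state A B K ω t := by
  induction t with
  | zero => exact ⟨fun _ _ => rfl, fun _ _ => rfl⟩
  | succ t ih =>
    by_cases ht : t < T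
    · refine ⟨fun ω ω' => ?_, fun c ω => ?_⟩
      · simp only [state_succ A B K ht, ih.map_add, map_add, Prod.snd_add, Prod.fst_add,
          Pi.add_apply]
        abel
      · simp only [state_succ A B K ht, ih.map_smul, map_smul, Prod.smul_snd, Prod.smul_fst,
          Pi.smul_apply, smul_add]
    · refine ⟨fun ω ω' => ?_, fun c ω => ?_⟩
      · simp only [state, ht, dite_false, ih.map_add, map_add, add_zero]
        abel
      · simp only [state, ht, dite_false, ih.map_smul, map_smul, add_zero, smul_add]

theorem exists_stateCLM (t : ℕ) :
    ∃ L : Noise nx nu T →L[ℝ] Vec nx, ∀ ω, state A B K ω t = L ω :=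
  ⟨LinearMap.toContinuousLinearMap ((isLinearMap_state A B K t).mk' _), fun _ => rfl⟩

theorem continuous_state (t : ℕ) : Continuous fun ω : Noise nx nu T => state A B K ω t := by
  obtain ⟨L, hL⟩ := exists_stateCLM (T := T) A B K t
  simp only [hL]
  exact L.continuous

theorem measurable_state (t : ℕ) : Measurable fun ω : Noise nx nu T => state A B K ω t :=
  (continuous_state A B K t).measurable

theorem measurable_demo : Measurable (demo A B K : Noise nx nu T → Traj nx nu T) := by
  refine measurable_pi_lambda _ fun t => ?_
  have h := measurable_state (T := T) A B K t
  refine h.prodMk (((measurable_toEuclideanLin K).comp h).add ?_)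
  exact (measurable_pi_apply t).comp (measurable_fst.comp measurable_snd)

theorem demo_residual (ω : Noise nx nu T) (t : Fin T) :
    (demo A B K ω t).2 - toEuclideanLin K (demo A B K ω t).1 = ω.2.1 t := by
  simp [demo]

end Trajectories

/-! ### The law of the noise -/

section NoiseLaw

theorem isGaussian_pi {ι : Type*} [Fintype ι] {E : ι → Type*} [∀ i, NormedAddCommGroup (E i)]
    [∀ i, NormedSpace ℝ (E i)] [∀ i, CompleteSpace (E i)] [∀ i, MeasurableSpace (E i)]
    [∀ i, BorelSpace (E i)] [∀ i, SecondCountableTopology (E i)]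
    (μ : ∀ i, Measure (E i)) [∀ i, IsGaussian (μ i)] : IsGaussian (Measure.pi μ) := by
  have h1 : ∀ i, HasGaussianLaw (fun ω : ∀ i, E i => ω i) (Measure.pi μ) := fun i =>
    ⟨by rw [(measurePreserving_eval μ i).map_eq]; infer_instance⟩
  have h2 : iIndepFun (fun i (ω : ∀ i, E i) => ω i) (Measure.pi μ) :=
    iIndepFun_pi (X := fun i x => x) fun i => aemeasurable_id
  have h3 := (h2.hasGaussianLaw h1).isGaussian_map
  rwa [show (fun ω : ∀ i, E i => fun i => ω i) = id from rfl, Measure.map_id] at h3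

theorem multivariateGaussian_neg {n : ℕ} (S : Matrix (Fin n) (Fin n) ℝ) :
    MeasurePreserving (fun y : Vec n => -y) (multivariateGaussian 0 S)
      (multivariateGaussian 0 S) := by
  refine ⟨measurable_neg, ?_⟩
  have h := stdGaussian_map (LinearIsometryEquiv.neg ℝ (E := Vec n))
  rw [multivariateGaussian_zero_eq_map, Measure.map_map measurable_neg (measurable_toEuclideanLin _)]
  conv_rhs => rw [← h]
  rw [Measure.map_map (measurable_toEuclideanLin _) (by fun_prop)]
  congr 1
  ext1 x
  simp

namespace Problem

variable {nx nu k H : ℕ} (P : Problem nx nu k H)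

instance (h : Fin (H + 1)) (T : ℕ) : IsProbabilityMeasure (P.noiseLaw h T) := by
  unfold noiseLaw; infer_instance

instance (h : Fin (H + 1)) (T : ℕ) : IsGaussian (P.noiseLaw h T) := by
  have := isGaussian_pi fun _ : Fin T => multivariateGaussian (0 : Vec nu) (P.sigz ^ 2 • 1)
  have := isGaussian_pi fun _ : Fin T => multivariateGaussian (0 : Vec nx) (P.Sw h)
  unfold noiseLaw; infer_instance

instance (h : Fin (H + 1)) (T : ℕ) : IsProbabilityMeasure (P.demoLaw h T) :=
  Measure.isProbabilityMeasure_map (measurable_demo _ _ _).aemeasurable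

instance (N₁ T : ℕ) : IsProbabilityMeasure (P.sourceLaw N₁ T) := by
  unfold sourceLaw; infer_instance

instance (N₂ T : ℕ) : IsProbabilityMeasure (P.targetLaw N₂ T) := by
  unfold targetLaw; infer_instance

variable {P}

/-- The law of the noise is invariant under sign changes of each of its components. The predicates
select the times at which the actuator noise and the process noise are reflected; this symmetry
makes the mixed second moments vanish. -/
theorem measurePreserving_flip (h : Fin (H + 1)) {T : ℕ} (pz pw : Fin T → Prop)
    [DecidablePred pz] [DecidablePred pw] :
    MeasurePreserving (fun ω : Noise nx nu T =>
      ((ω.1, (fun t => if pz t then -ω.2.1 t else ω.2.1 t),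
        (fun t => if pw t then -ω.2.2 t else ω.2.2 t)) : Noise nx nu T))
      (P.noiseLaw h T) (P.noiseLaw h T) := by
  have hpi : ∀ {n : ℕ} (S : Matrix (Fin n) (Fin n) ℝ) (p : Fin T → Prop) [DecidablePred p],
      MeasurePreserving (fun z : Fin T → Vec n => fun t => if p t then -z t else z t)
        (Measure.pi fun _ => multivariateGaussian 0 S)
        (Measure.pi fun _ => multivariateGaussian 0 S) := by
    intro n S p _
    refine measurePreserving_pi (fun _ => multivariateGaussian (0 : Vec n) S)
      (fun _ => multivariateGaussian (0 : Vec n) S) (f := fun t y => if p t then -y else y) ?_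
    intro t
    by_cases hp : p t
    · simpa [hp] using multivariateGaussian_neg S
    · simp only [hp, if_false]
      exact MeasurePreserving.id (multivariateGaussian (0 : Vec n) S)
  exact (MeasurePreserving.id _).prod ((hpi _ pz).prod (hpi _ pw))

end Problem

theorem integral_eq_zero_of_odd {Ω : Type*} [MeasurableSpace Ω] {μ : Measure Ω} {Φ : Ω → Ω}
    (hΦ : MeasurePreserving Φ μ μ) {f : Ω → ℝ} (hf : Measurable f) (h : ∀ ω, f (Φ ω) = -f ω) :
    ∫ ω, f ω ∂μ = 0 := by
  have h1 : ∫ ω, f (Φ ω) ∂μ = ∫ ω, f ω ∂μ := by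
    conv_rhs => rw [← hΦ.map_eq]
    rw [integral_map hΦ.measurable.aemeasurable hf.aestronglyMeasurable]
  simp only [h, integral_neg] at h1
  linarith

/-- A centered Gaussian vector is determined by its second moments. -/
theorem map_eq_multivariateGaussian {Ω : Type*} [MeasurableSpace Ω] {μ : Measure Ω}
    {n : ℕ} {Y : Ω → Vec n} (hY : HasGaussianLaw Y μ) {S : Matrix (Fin n) (Fin n) ℝ}
    (hS : S.IsHermitian) (hmean : ∀ u, ∫ ω, inner ℝ u (Y ω) ∂μ = 0)
    (hcov : ∀ u, ∫ ω, inner ℝ u (Y ω) ^ 2 ∂μ = qf S u) :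
    S.PosSemidef ∧ μ.map Y = multivariateGaussian 0 S := by
  have hpsd : S.PosSemidef := by
    refine Matrix.PosSemidef.of_dotProduct_mulVec_nonneg hS fun x => ?_
    have := hcov (WithLp.toLp 2 x)
    rw [qf_eq_dotProduct] at this
    simp only [star_trivial]
    rw [← this]
    exact integral_nonneg fun _ => sq_nonneg _
  refine ⟨hpsd, ?_⟩
  have := hY.isProbabilityMeasure
  have := hY.isGaussian_map
  refine Measure.ext_of_charFun ?_
  ext u
  rw [hY.charFun_map_eq, charFun_multivariateGaussian hpsd, hmean u,
    variance_eq_integral (by fun_prop), hmean u]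
  simp only [sub_zero, hcov u, qf_eq_dotProduct]
  simp

end NoiseLaw


/-! ### Stationary second moments -/

theorem integral_inner_mul_inner_multivariateGaussian {n : ℕ} {S : Matrix (Fin n) (Fin n) ℝ}
    (hS : S.PosSemidef) (u v : Vec n) :
    ∫ y, inner ℝ u y * inner ℝ v y ∂(multivariateGaussian 0 S)
      = inner ℝ u (toEuclideanLin S v) := by
  have h1 := covarianceBilin_apply (μ := multivariateGaussian (0 : Vec n) S)
    IsGaussian.memLp_two_id u v
  rw [covarianceBilin_multivariateGaussian hS] at h1
  simp only [integral_id_multivariateGaussian, id, sub_zero] at h1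
  rw [← h1]
  simp only [EuclideanSpace.inner_eq_star_dotProduct, toLpLin_apply, star_trivial]
  rw [dotProduct_comm]

theorem integral_add_add_add {Ω : Type*} [MeasurableSpace Ω] {μ : Measure Ω} {f₁ f₂ f₃ f₄ : Ω → ℝ}
    (h₁ : Integrable f₁ μ) (h₂ : Integrable f₂ μ) (h₃ : Integrable f₃ μ) (h₄ : Integrable f₄ μ) :
    ∫ ω, f₁ ω + f₂ ω + (f₃ ω + f₄ ω) ∂μ
      = ∫ ω, f₁ ω ∂μ + ∫ ω, f₂ ω ∂μ + (∫ ω, f₃ ω ∂μ + ∫ ω, f₄ ω ∂μ) := by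
  have h12 : Integrable (fun ω => f₁ ω + f₂ ω) μ := h₁.add h₂
  have h34 : Integrable (fun ω => f₃ ω + f₄ ω) μ := h₃.add h₄
  rw [integral_add h12 h34, integral_add h₁ h₂, integral_add h₃ h₄]

namespace Problem

variable {nx nu k H : ℕ} {P : Problem nx nu k H}

theorem integrable_mul_of_isLinearMap (h : Fin (H + 1)) {T : ℕ} {f g : Noise nx nu T → ℝ}
    (hf : IsLinearMap ℝ f) (hg : IsLinearMap ℝ g) :
    Integrable (fun ω => f ω * g ω) (P.noiseLaw h T) := by
  have h1 : MemLp f 2 (P.noiseLaw h T) :=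
    IsGaussian.memLp_dual _ (LinearMap.toContinuousLinearMap (hf.mk' f)) 2 (by simp)
  have h2 : MemLp g 2 (P.noiseLaw h T) :=
    IsGaussian.memLp_dual _ (LinearMap.toContinuousLinearMap (hg.mk' g)) 2 (by simp)
  exact h1.integrable_mul h2

/-- The state of the expert closed loop of a task. -/
noncomputable abbrev expertState (P : Problem nx nu k H) (h : Fin (H + 1)) {T : ℕ}
    (ω : Noise nx nu T) (t : ℕ) : Vec nx := state P.A P.B (P.K h) ω t

/-- The total noise entering the state between times `t` and `t + 1`. -/
noncomputable def stepNoise (P : Problem nx nu k H) {T : ℕ} (ω : Noise nx nu T) (t : Fin T) :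
    Vec nx := toEuclideanLin P.B (ω.2.1 t) + ω.2.2 t

theorem isLinearMap_inner_state (h : Fin (H + 1)) {T : ℕ} (t : ℕ) (u : Vec nx) :
    IsLinearMap ℝ fun ω : Noise nx nu T => inner ℝ u (P.expertState h ω t) := by
  have hl := isLinearMap_state (T := T) P.A P.B (P.K h) t
  refine ⟨fun ω ω' => ?_, fun c ω => ?_⟩
  · simp only [expertState, hl.map_add, inner_add_right]
  · simp only [expertState, hl.map_smul, inner_smul_right, smul_eq_mul]

theorem isLinearMap_inner_stepNoise {T : ℕ} (t : Fin T) (u : Vec nx) :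
    IsLinearMap ℝ fun ω : Noise nx nu T => inner ℝ u (P.stepNoise ω t) := by
  refine ⟨fun ω ω' => ?_, fun c ω => ?_⟩
  · simp only [stepNoise, Prod.snd_add, Prod.fst_add, Pi.add_apply, map_add, inner_add_right]
    ring
  · simp only [stepNoise, Prod.smul_snd, Prod.smul_fst, Pi.smul_apply, map_smul,
      inner_add_right, inner_smul_right, smul_eq_mul]
    ring

theorem measurable_of_isLinearMap {T : ℕ} {f : Noise nx nu T → ℝ} (hf : IsLinearMap ℝ f) :
    Measurable f :=
  (LinearMap.continuous_of_finiteDimensional (hf.mk' f)).measurable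

/-- The noise of a step is uncorrelated with the past states. -/
theorem integral_stepNoise_mul_state (h : Fin (H + 1)) {T s : ℕ} (t : Fin T) (hst : s ≤ t)
    (u v : Vec nx) :
    ∫ ω, inner ℝ u (P.stepNoise ω t) * inner ℝ v (P.expertState h ω s) ∂(P.noiseLaw h T) = 0 := by
  refine integral_eq_zero_of_odd (measurePreserving_flip h (fun r => r = t) (fun r => r = t))
    ((measurable_of_isLinearMap (isLinearMap_inner_stepNoise t u)).mul
      (measurable_of_isLinearMap (isLinearMap_inner_state h s v))) fun ω => ?_
  have h1 : P.expertState h ((ω.1, (fun r => if r = t then -ω.2.1 r else ω.2.1 r),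
        (fun r => if r = t then -ω.2.2 r else ω.2.2 r)) : Noise nx nu T) s
      = P.expertState h ω s := by
    refine state_congr P.A P.B (P.K h) (ω := (ω.1, (fun r => if r = t then -ω.2.1 r else ω.2.1 r),
        (fun r => if r = t then -ω.2.2 r else ω.2.2 r))) (ω' := ω) rfl fun r hr => ?_
    have : r ≠ t := fun e => by subst e; omega
    simp [this]
  rw [h1]
  simp only [stepNoise, if_true, map_neg, inner_add_right, inner_neg_right]
  ring

theorem integral_stepNoise_mul_stepNoise (hP : P.Valid) (h : Fin (H + 1)) {T : ℕ} (t : Fin T)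
    (u v : Vec nx) :
    ∫ ω, inner ℝ u (P.stepNoise ω t) * inner ℝ v (P.stepNoise ω t) ∂(P.noiseLaw h T)
      = inner ℝ u (toEuclideanLin (P.sigz ^ 2 • (P.B * P.Bᵀ) + P.Sw h) v) := by
  have lz : ∀ u : Vec nx, IsLinearMap ℝ fun ω : Noise nx nu T =>
      inner ℝ (toEuclideanLin P.Bᵀ u) (ω.2.1 t) := fun u =>
    ⟨fun _ _ => by simp [inner_add_right], fun _ _ => by simp [inner_smul_right]⟩
  have lw : ∀ u : Vec nx, IsLinearMap ℝ fun ω : Noise nx nu T => inner ℝ u (ω.2.2 t) := fun u =>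
    ⟨fun _ _ => by simp [inner_add_right], fun _ _ => by simp [inner_smul_right]⟩
  have hcross : ∀ u v : Vec nx, ∫ ω : Noise nx nu T, inner ℝ (toEuclideanLin P.Bᵀ u) (ω.2.1 t)
      * inner ℝ v (ω.2.2 t) ∂(P.noiseLaw h T) = 0 := by
    intro u v
    refine integral_eq_zero_of_odd (measurePreserving_flip h (fun r => r = t) (fun _ => False))
      ((measurable_of_isLinearMap (lz u)).mul (measurable_of_isLinearMap (lw v))) fun ω => ?_
    simp
  have hpz : ∀ u v : Vec nu, ∫ ω : Noise nx nu T, inner ℝ u (ω.2.1 t) * inner ℝ v (ω.2.1 t)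
      ∂(P.noiseLaw h T) = P.sigz ^ 2 * inner ℝ u v := by
    intro u v
    have hmp : MeasurePreserving (fun ω : Noise nx nu T => ω.2.1 t) (P.noiseLaw h T)
        (multivariateGaussian 0 (P.sigz ^ 2 • 1)) :=
      (measurePreserving_eval (fun _ : Fin T => multivariateGaussian (0 : Vec nu) _) t).comp
        (measurePreserving_fst.comp measurePreserving_snd)
    have h1 := integral_map (μ := P.noiseLaw h T) hmp.measurable.aemeasurable
      (f := fun y => inner ℝ u y * inner ℝ v y) (by fun_prop)
    rw [hmp.map_eq, integral_inner_mul_inner_multivariateGaussian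
      (Matrix.PosSemidef.one.smul (sq_nonneg _))] at h1
    rw [← h1]
    simp [inner_smul_right]
  have hpw : ∀ u v : Vec nx, ∫ ω : Noise nx nu T, inner ℝ u (ω.2.2 t) * inner ℝ v (ω.2.2 t)
      ∂(P.noiseLaw h T) = inner ℝ u (toEuclideanLin (P.Sw h) v) := by
    intro u v
    have hmp : MeasurePreserving (fun ω : Noise nx nu T => ω.2.2 t) (P.noiseLaw h T)
        (multivariateGaussian 0 (P.Sw h)) :=
      (measurePreserving_eval (fun _ : Fin T => multivariateGaussian (0 : Vec nx) _) t).comp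
        (measurePreserving_snd.comp measurePreserving_snd)
    have h1 := integral_map (μ := P.noiseLaw h T) hmp.measurable.aemeasurable
      (f := fun y => inner ℝ u y * inner ℝ v y) (by fun_prop)
    rw [hmp.map_eq, integral_inner_mul_inner_multivariateGaussian
      (hP.noise_posDef h).posSemidef] at h1
    exact h1.symm
  have hexp : ∀ ω : Noise nx nu T, inner ℝ u (P.stepNoise ω t) * inner ℝ v (P.stepNoise ω t)
      = (inner ℝ (toEuclideanLin P.Bᵀ u) (ω.2.1 t) * inner ℝ (toEuclideanLin P.Bᵀ v) (ω.2.1 t)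
        + inner ℝ u (ω.2.2 t) * inner ℝ v (ω.2.2 t))
        + (inner ℝ (toEuclideanLin P.Bᵀ u) (ω.2.1 t) * inner ℝ v (ω.2.2 t)
        + inner ℝ (toEuclideanLin P.Bᵀ v) (ω.2.1 t) * inner ℝ u (ω.2.2 t)) := by
    intro ω
    simp only [stepNoise, inner_add_right, inner_toEuclideanLin]
    ring
  have i1 := integrable_mul_of_isLinearMap (P := P) h (lz u) (lz v)
  have i2 := integrable_mul_of_isLinearMap (P := P) h (lw u) (lw v)
  have i3 := integrable_mul_of_isLinearMap (P := P) h (lz u) (lw v)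
  have i4 := integrable_mul_of_isLinearMap (P := P) h (lz v) (lw u)
  simp only [hexp]
  rw [integral_add_add_add i1 i2 i3 i4, hcross,
    hcross, hpz, hpw, map_add, LinearMap.add_apply, inner_add_right]
  simp only [map_smul, LinearMap.smul_apply, inner_smul_right, toEuclideanLin_mul]
  rw [inner_toEuclideanLin P.B]
  ring

/-- Covariances of the stationary expert trajectory, by induction on the lag `d` and, for lag zero,
on the time, where the Lyapunov equation reproduces the covariance. -/
theorem integral_state_mul_state (hP : P.Valid) (h : Fin (H + 1)) {T s : ℕ} (d : ℕ)
    (hT : s + d ≤ T) (u v : Vec nx) :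
    ∫ ω, inner ℝ u (P.expertState h ω (s + d)) * inner ℝ v (P.expertState h ω s)
        ∂(P.noiseLaw h T)
      = inner ℝ u (toEuclideanLin (P.Acl h ^ d * P.Sx h) v) := by
  have hsucc : ∀ {t : ℕ} (ht : t < T) (ω : Noise nx nu T) (u : Vec nx),
      inner ℝ u (P.expertState h ω (t + 1))
        = inner ℝ (toEuclideanLin (P.Acl h)ᵀ u) (P.expertState h ω t)
          + inner ℝ u (P.stepNoise ω ⟨t, ht⟩) := by
    intro t ht ω u
    rw [expertState, state_succ P.A P.B (P.K h) ht, inner_add_right, ← inner_toEuclideanLin]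
    rfl
  induction d generalizing u with
  | zero =>
    rw [pow_zero, Matrix.one_mul, add_zero]
    induction s generalizing u v with
    | zero =>
      have hmp : MeasurePreserving (fun ω : Noise nx nu T => ω.1) (P.noiseLaw h T)
          (multivariateGaussian 0 (P.Sx h)) := measurePreserving_fst
      have h1 := integral_map (μ := P.noiseLaw h T) hmp.measurable.aemeasurable
        (f := fun y => inner ℝ u y * inner ℝ v y) (by fun_prop)
      rw [hmp.map_eq, integral_inner_mul_inner_multivariateGaussian
        (hP.posDef_Sx h).posSemidef] at h1
      exact h1.symm
    | succ s ih =>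
      have hs : s < T := by omega
      have lx := fun u => isLinearMap_inner_state (P := P) h (T := T) s u
      have ln := fun u => isLinearMap_inner_stepNoise (P := P) (⟨s, hs⟩ : Fin T) u
      have i1 := integrable_mul_of_isLinearMap (P := P) h
        (lx (toEuclideanLin (P.Acl h)ᵀ u)) (lx (toEuclideanLin (P.Acl h)ᵀ v))
      have i2 := integrable_mul_of_isLinearMap (P := P) h (ln u) (ln v)
      have i3 := integrable_mul_of_isLinearMap (P := P) h (ln u)
        (lx (toEuclideanLin (P.Acl h)ᵀ v))
      have i4 := integrable_mul_of_isLinearMap (P := P) h (ln v)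
        (lx (toEuclideanLin (P.Acl h)ᵀ u))
      have hexp : ∀ ω : Noise nx nu T,
          inner ℝ u (P.expertState h ω (s + 1)) * inner ℝ v (P.expertState h ω (s + 1))
          = (inner ℝ (toEuclideanLin (P.Acl h)ᵀ u) (P.expertState h ω s)
              * inner ℝ (toEuclideanLin (P.Acl h)ᵀ v) (P.expertState h ω s)
            + inner ℝ u (P.stepNoise ω ⟨s, hs⟩) * inner ℝ v (P.stepNoise ω ⟨s, hs⟩))
            + (inner ℝ u (P.stepNoise ω ⟨s, hs⟩)
              * inner ℝ (toEuclideanLin (P.Acl h)ᵀ v) (P.expertState h ω s)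
            + inner ℝ v (P.stepNoise ω ⟨s, hs⟩)
              * inner ℝ (toEuclideanLin (P.Acl h)ᵀ u) (P.expertState h ω s)) := by
        intro ω
        rw [hsucc hs, hsucc hs]
        ring
      simp only [hexp]
      rw [integral_add_add_add i1 i2 i3 i4,
        integral_stepNoise_mul_state h ⟨s, hs⟩ le_rfl, integral_stepNoise_mul_state h ⟨s, hs⟩ le_rfl,
        integral_stepNoise_mul_stepNoise hP, ih _ (by omega)]
      conv_rhs => rw [hP.lyapunov h]
      rw [← inner_toEuclideanLin, ← toEuclideanLin_mul, ← toEuclideanLin_mul,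
        add_assoc (P.Acl h * P.Sx h * (P.Acl h)ᵀ)]
      simp only [map_add, LinearMap.add_apply, inner_add_right]
      ring
  | succ d ih =>
    have hs : s + d < T := by omega
    have lx := fun t u => isLinearMap_inner_state (P := P) h (T := T) t u
    have ln := fun u => isLinearMap_inner_stepNoise (P := P) (⟨s + d, hs⟩ : Fin T) u
    have i1 := integrable_mul_of_isLinearMap (P := P) h
      (lx (s + d) (toEuclideanLin (P.Acl h)ᵀ u)) (lx s v)
    have i2 := integrable_mul_of_isLinearMap (P := P) h (ln u) (lx s v)
    rw [← add_assoc]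
    simp only [hsucc hs, add_mul]
    rw [integral_add i1 i2, integral_stepNoise_mul_state h ⟨s + d, hs⟩ (by simp),
      ih (by omega), ← inner_toEuclideanLin, ← toEuclideanLin_mul, ← Matrix.mul_assoc, pow_succ']
    ring

theorem integral_inner_state (h : Fin (H + 1)) {T : ℕ} (t : ℕ) (u : Vec nx) :
    ∫ ω, inner ℝ u (P.expertState h ω t) ∂(P.noiseLaw h T) = 0 := by
  have hl := isLinearMap_inner_state (P := P) h (T := T) t u
  refine integral_eq_zero_of_odd (Φ := fun ω => -ω) ?_ (measurable_of_isLinearMap hl)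
    fun ω => hl.map_neg ω
  have h1 := measurePreserving_flip (P := P) h (T := T) (fun _ => True) (fun _ => True)
  have h2 : MeasurePreserving (fun ω : Noise nx nu T => ((-ω.1, ω.2) : Noise nx nu T))
      (P.noiseLaw h T) (P.noiseLaw h T) :=
    (multivariateGaussian_neg _).prod (MeasurePreserving.id _)
  exact h2.comp h1

theorem hasGaussianLaw_of_isLinearMap {n : ℕ} (h : Fin (H + 1)) {T : ℕ}
    {f : Noise nx nu T → Vec n} (hf : IsLinearMap ℝ f) : HasGaussianLaw f (P.noiseLaw h T) :=
  IsGaussian.hasGaussianLaw_id.map (LinearMap.toContinuousLinearMap (hf.mk' f))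

end Problem


/-! ### Exponential moments along one expert trajectory -/

namespace Problem

variable {nx nu k H : ℕ} {P : Problem nx nu k H}

theorem one_le_cond {n : ℕ} {S : Matrix (Fin n) (Fin n) ℝ} (hn : 0 < n) (hS : S.PosDef) :
    1 ≤ MTIL.cond S := by
  rw [MTIL.cond, one_le_div (lamMin_pos hn hS)]
  exact lamMin_le_lamMax hn hS.isHermitian

/-- Autocovariances of a normalized linear functional of the state decay like `‖A_cl ^ d‖`. -/
theorem abs_inner_pow_mul_le (hn : 0 < nx) (hP : P.Valid) (h : Fin (H + 1)) {r : Vec nx}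
    (hr : qf (P.Sx h) r = 1) (d : ℕ) :
    |inner ℝ r (toEuclideanLin (P.Acl h ^ d * P.Sx h) r)|
      ≤ MTIL.cond (P.Sx h) * ‖P.Acl h ^ d‖ := by
  have hS := hP.posDef_Sx h
  have hl := lamMin_pos hn hS
  have h1 : ‖r‖ ^ 2 ≤ 1 / lamMin (P.Sx h) := by
    rw [le_div_iff₀ hl, mul_comm, ← hr]
    exact lamMin_mul_le_qf hS.isHermitian r
  have h2 : ‖toEuclideanLin (P.Sx h) r‖ ^ 2 ≤ lamMax (P.Sx h) := by
    simpa [hr] using norm_toEuclideanLin_sq_le hS.posSemidef r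
  have h3 : ‖r‖ * ‖toEuclideanLin (P.Sx h) r‖ ≤ MTIL.cond (P.Sx h) := by
    have hc := one_le_cond hn hS
    have h4 : (‖r‖ * ‖toEuclideanLin (P.Sx h) r‖) ^ 2 ≤ MTIL.cond (P.Sx h) := by
      rw [mul_pow, MTIL.cond, div_eq_mul_one_div, mul_comm]
      exact mul_le_mul h2 h1 (sq_nonneg _) (lamMax_nonneg hS.posSemidef)
    refine abs_le_of_sq_le_sq' (b := MTIL.cond (P.Sx h)) ?_ (by linarith) |>.2
    nlinarith
  refine (abs_real_inner_le_norm _ _).trans ?_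
  rw [toEuclideanLin_mul]
  calc ‖r‖ * ‖toEuclideanLin (P.Acl h ^ d) (toEuclideanLin (P.Sx h) r)‖
      ≤ ‖r‖ * (‖P.Acl h ^ d‖ * ‖toEuclideanLin (P.Sx h) r‖) :=
        mul_le_mul_of_nonneg_left (norm_toEuclideanLin_le _ _) (norm_nonneg _)
    _ = (‖r‖ * ‖toEuclideanLin (P.Sx h) r‖) * ‖P.Acl h ^ d‖ := by ring
    _ ≤ _ := mul_le_mul_of_nonneg_right h3 (norm_nonneg _)

/-- Bound on the spectral norm of the autocovariance matrix of a normalized functional of the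
state. -/
noncomputable def mixing (P : Problem nx nu k H) (h : Fin (H + 1)) : ℝ :=
  2 * (MTIL.cond (P.Sx h) * calJ (P.Acl h))

theorem sum_norm_pow_dist_le {M : Matrix (Fin nx) (Fin nx) ℝ} (hM : IsSchurStable M) {T : ℕ}
    (i : Fin T) : ∑ j : Fin T, ‖M ^ (Nat.dist i j)‖ ≤ 2 * calJ M := by
  rw [← Finset.sum_filter_add_sum_filter_not Finset.univ (fun j : Fin T => j ≤ i), two_mul]
  refine add_le_add ?_ ?_
  · rw [← Finset.sum_image (f := fun d => ‖M ^ d‖) (g := fun j : Fin T => Nat.dist i j)]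
    · exact hM.sum_le_calJ _
    · intro j hj j' hj' he
      simp only [Finset.coe_filter, Finset.mem_univ, true_and, Set.mem_ofPred_eq, Fin.le_def]
        at hj hj'
      simp only [Nat.dist] at he
      ext; omega
  · rw [← Finset.sum_image (f := fun d => ‖M ^ d‖) (g := fun j : Fin T => Nat.dist i j)]
    · exact hM.sum_le_calJ _
    · intro j hj j' hj' he
      simp only [Finset.coe_filter, Finset.mem_univ, true_and, Set.mem_ofPred_eq, Fin.le_def]
        at hj hj'
      simp only [Nat.dist] at he
      ext; omega

/-- Exponential moments of the empirical second moment in a normalized direction. The autocovariance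
matrix has trace `T`, and its norm is at most `mixing`, by the bound on its row sums. -/
theorem lintegral_eexp_sum_inner_sq_le (hn : 0 < nx) (hP : P.Valid) (h : Fin (H + 1)) (T : ℕ)
    {r : Vec nx} (hr : qf (P.Sx h) r = 1) {s : ℝ} (hs : |s| * P.mixing h ≤ 1 / 4) :
    ∫⁻ e, eexp (s * ∑ t, inner ℝ r (e t).1 ^ 2) ∂(P.demoLaw h T)
      ≤ eexp ((s + 2 * s ^ 2 * P.mixing h) * T) := by
  rw [demoLaw, lintegral_map (Measurable.eexp (by fun_prop)) (measurable_demo _ _ _)]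
  let Y : Noise nx nu T → Vec T := fun ω =>
    WithLp.toLp 2 fun i : Fin T => inner ℝ r (P.expertState h ω i)
  have hlin : ∀ i : Fin T, IsLinearMap ℝ fun ω : Noise nx nu T =>
      inner ℝ r (P.expertState h ω i) := fun i => isLinearMap_inner_state h i r
  have hYlin : IsLinearMap ℝ Y := by
    refine ⟨fun ω ω' => ?_, fun c ω => ?_⟩
    · ext i; exact (hlin i).map_add ω ω'
    · ext i; exact (hlin i).map_smul c ω
  set G : Matrix (Fin T) (Fin T) ℝ := Matrix.of fun i j => ∫ ω, inner ℝ r (P.expertState h ω i)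
    * inner ℝ r (P.expertState h ω j) ∂(P.noiseLaw h T) with hG
  have hGs : ∀ i j, G i j = G j i := fun i j => by simp only [hG, of_apply, mul_comm]
  have hGH : G.IsHermitian := by
    rw [IsHermitian, conjTranspose_eq_transpose_of_trivial]
    ext i j; exact hGs j i
  have hGval : ∀ i j : Fin T, i ≤ j → G j i
      = inner ℝ r (toEuclideanLin (P.Acl h ^ (j.val - i.val) * P.Sx h) r) := by
    intro i j hij
    have h1 := integral_state_mul_state hP h (T := T) (s := i) (j.val - i.val) (by omega) r r
    rw [Nat.add_sub_cancel' (Fin.le_def.1 hij)] at h1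
    exact h1
  have hGabs : ∀ i j : Fin T, |G i j| ≤ MTIL.cond (P.Sx h) * ‖P.Acl h ^ (Nat.dist i j)‖ := by
    intro i j
    rcases le_total i j with hij | hij
    · rw [hGs, hGval i j hij, Nat.dist_eq_sub_of_le (Fin.le_def.1 hij)]
      exact abs_inner_pow_mul_le hn hP h hr _
    · rw [hGval j i hij, Nat.dist_eq_sub_of_le_right (Fin.le_def.1 hij)]
      exact abs_inner_pow_mul_le hn hP h hr _
  have hrow : ∀ i : Fin T, ∑ j, |G i j| ≤ P.mixing h := by
    intro i
    calc ∑ j, |G i j| ≤ ∑ j : Fin T, MTIL.cond (P.Sx h) * ‖P.Acl h ^ (Nat.dist i j)‖ :=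
          Finset.sum_le_sum fun j _ => hGabs i j
      _ = MTIL.cond (P.Sx h) * ∑ j : Fin T, ‖P.Acl h ^ (Nat.dist i j)‖ := by
          rw [Finset.mul_sum]
      _ ≤ MTIL.cond (P.Sx h) * (2 * calJ (P.Acl h)) :=
          mul_le_mul_of_nonneg_left (sum_norm_pow_dist_le (hP.stable h) i)
            (by linarith [one_le_cond hn (hP.posDef_Sx h)])
      _ = P.mixing h := by rw [mixing]; ring
  have hqfG : ∀ c : Vec T, qf G c = ∑ i, ∑ j, c i * G i j * c j := by
    intro c
    rw [qf_eq_dotProduct]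
    simp only [dotProduct, Matrix.mulVec, Finset.mul_sum, mul_assoc]
  have hcov : ∀ c : Vec T, ∫ ω, inner ℝ c (Y ω) ^ 2 ∂(P.noiseLaw h T) = qf G c := by
    intro c
    have he : ∀ ω : Noise nx nu T, inner ℝ c (Y ω) ^ 2 = ∑ i, ∑ j, c i * c j *
        (inner ℝ r (P.expertState h ω i) * inner ℝ r (P.expertState h ω j)) := by
      intro ω
      rw [PiLp.inner_apply, sq, Finset.sum_mul_sum]
      refine Finset.sum_congr rfl fun i _ => Finset.sum_congr rfl fun j _ => ?_
      simp [Y]; ring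
    have hint : ∀ i j : Fin T, Integrable (fun ω : Noise nx nu T => c i * c j *
        (inner ℝ r (P.expertState h ω i) * inner ℝ r (P.expertState h ω j))) (P.noiseLaw h T) :=
      fun i j => (integrable_mul_of_isLinearMap h (hlin i) (hlin j)).const_mul _
    simp only [he]
    rw [integral_finsetSum _ fun i _ => integrable_finsetSum _ fun j _ => hint i j, hqfG]
    refine Finset.sum_congr rfl fun i _ => ?_
    rw [integral_finsetSum _ fun j _ => hint i j]
    refine Finset.sum_congr rfl fun j _ => ?_
    rw [integral_const_mul, hG, of_apply]
    ring
  have hmean : ∀ c : Vec T, ∫ ω, inner ℝ c (Y ω) ∂(P.noiseLaw h T) = 0 := by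
    intro c
    have he : ∀ ω : Noise nx nu T, inner ℝ c (Y ω)
        = ∑ i, c i * inner ℝ r (P.expertState h ω i) := by
      intro ω
      rw [PiLp.inner_apply]
      simp [Y, mul_comm]
    have hint : ∀ i : Fin T, Integrable (fun ω : Noise nx nu T =>
        c i * inner ℝ r (P.expertState h ω i)) (P.noiseLaw h T) := fun i => by
      refine Integrable.const_mul ?_ _
      exact IsGaussian.integrable_dual _ (LinearMap.toContinuousLinearMap ((hlin i).mk' _))
    simp only [he]
    rw [integral_finsetSum _ fun i _ => hint i]
    refine Finset.sum_eq_zero fun i _ => ?_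
    rw [integral_const_mul, integral_inner_state, mul_zero]
  obtain ⟨hpsd, hlaw⟩ := map_eq_multivariateGaussian
    (hasGaussianLaw_of_isLinearMap h hYlin) hGH hmean hcov
  have hqf : ∀ c : Vec T, qf G c ≤ P.mixing h * ‖c‖ ^ 2 := by
    intro c
    rw [hqfG]
    have h1 : ∀ i j, c i * G i j * c j ≤ |G i j| * c i ^ 2 / 2 + |G j i| * c j ^ 2 / 2 := by
      intro i j
      rw [hGs j i]
      have h2 : c i * G i j * c j ≤ |G i j| * (|c i| * |c j|) := by
        refine (le_abs_self _).trans (le_of_eq ?_)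
        rw [abs_mul, abs_mul]; ring
      have h3 : |c i| * |c j| ≤ (c i ^ 2 + c j ^ 2) / 2 := by
        rw [← sq_abs (c i), ← sq_abs (c j)]
        nlinarith [sq_nonneg (|c i| - |c j|)]
      have := mul_le_mul_of_nonneg_left h3 (abs_nonneg (G i j))
      linarith
    have hS1 : ∀ i, ∑ j, |G i j| * c i ^ 2 / 2 ≤ P.mixing h * c i ^ 2 / 2 := by
      intro i
      rw [← Finset.sum_div, ← Finset.sum_mul]
      have := mul_le_mul_of_nonneg_right (hrow i) (sq_nonneg (c i))
      linarith
    calc ∑ i, ∑ j, c i * G i j * c j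
        ≤ ∑ i, ∑ j, (|G i j| * c i ^ 2 / 2 + |G j i| * c j ^ 2 / 2) :=
          Finset.sum_le_sum fun i _ => Finset.sum_le_sum fun j _ => h1 i j
      _ = ∑ i, ∑ j, |G i j| * c i ^ 2 / 2 + ∑ j, ∑ i, |G j i| * c j ^ 2 / 2 := by
          simp only [Finset.sum_add_distrib]
          rw [Finset.sum_comm (f := fun i j => |G j i| * c j ^ 2 / 2)]
      _ ≤ ∑ i, P.mixing h * c i ^ 2 / 2 + ∑ j, P.mixing h * c j ^ 2 / 2 :=
          add_le_add (Finset.sum_le_sum fun i _ => hS1 i) (Finset.sum_le_sum fun i _ => hS1 i)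
      _ = P.mixing h * ‖c‖ ^ 2 := by
          rw [EuclideanSpace.real_norm_sq_eq, Finset.mul_sum, ← Finset.sum_add_distrib]
          exact Finset.sum_congr rfl fun i _ => by ring
  have htr : G.trace = T := by
    have : ∀ i, G.diag i = 1 := fun i => by
      rw [Matrix.diag_apply, hGval i i le_rfl]
      simpa [qf] using hr
    rw [Matrix.trace, Finset.sum_congr rfl fun i _ => this i]
    simp
  have hmain := lintegral_eexp_norm_sq_le_trace hpsd hqf hs
  have hYm : Measurable Y := (LinearMap.continuous_of_finiteDimensional (hYlin.mk' Y)).measurable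
  rw [← hlaw, lintegral_map (Measurable.eexp (by fun_prop)) hYm, htr] at hmain
  refine le_trans (le_of_eq (lintegral_congr fun ω => ?_)) hmain
  rw [EuclideanSpace.real_norm_sq_eq]
  rfl

/-- The residual `u - K x` of a demonstration, which is the actuator noise. -/
noncomputable def resid {nx nu : ℕ} (K : Matrix (Fin nu) (Fin nx) ℝ) (p : Vec nx × Vec nu) :
    Vec nu := p.2 - toEuclideanLin K p.1

theorem measurable_resid (K : Matrix (Fin nu) (Fin nx) ℝ) : Measurable (resid K) :=
  measurable_snd.sub ((measurable_toEuclideanLin K).comp measurable_fst)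

/-- The likelihood ratio of a perturbation of the actuator noise by a linear feedback has mean at
most one. -/
theorem lintegral_eexp_score_le (h : Fin (H + 1)) (T : ℕ) (G : Matrix (Fin nu) (Fin nx) ℝ) :
    ∫⁻ e, eexp (∑ t, (inner ℝ (resid (P.K h) (e t)) (toEuclideanLin G (e t).1)
        - P.sigz ^ 2 / 2 * ‖toEuclideanLin G (e t).1‖ ^ 2)) ∂(P.demoLaw h T) ≤ 1 := by
  have hG := measurable_toEuclideanLin G
  have hK := measurable_resid (P.K h)
  have hmeas : Measurable fun e : Traj nx nu T => eexp (∑ t,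
      (inner ℝ (resid (P.K h) (e t)) (toEuclideanLin G (e t).1)
        - P.sigz ^ 2 / 2 * ‖toEuclideanLin G (e t).1‖ ^ 2)) := by
    refine Measurable.eexp (Finset.measurable_sum _ fun t _ => ?_)
    have h1 : Measurable fun e : Traj nx nu T => toEuclideanLin G (e t).1 :=
      hG.comp (measurable_fst.comp (measurable_pi_apply t))
    have h2 : Measurable fun e : Traj nx nu T => resid (P.K h) (e t) :=
      hK.comp (measurable_pi_apply t)
    exact (h2.inner h1).sub ((h1.norm.pow_const 2).const_mul _)
  rw [demoLaw, lintegral_map hmeas (measurable_demo _ _ _)]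
  have hres : ∀ (ω : Noise nx nu T) (t : Fin T),
      resid (P.K h) (demo P.A P.B (P.K h) ω t) = ω.2.1 t := demo_residual P.A P.B (P.K h)
  simp only [hres]
  have hx : ∀ (ω : Noise nx nu T) (t : Fin T),
      (demo P.A P.B (P.K h) ω t).1 = P.expertState h ω t := fun _ _ => rfl
  simp only [hx]
  have hxm : ∀ t : ℕ, Measurable fun ω : Noise nx nu T => toEuclideanLin G (P.expertState h ω t) :=
    fun t => hG.comp (measurable_state P.A P.B (P.K h) t)
  have hfm : ∀ t : Fin T, Measurable fun ω : Noise nx nu T =>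
      inner ℝ (ω.2.1 t) (toEuclideanLin G (P.expertState h ω t))
        - P.sigz ^ 2 / 2 * ‖toEuclideanLin G (P.expertState h ω t)‖ ^ 2 := by
    intro t
    have h2 : Measurable fun ω : Noise nx nu T => ω.2.1 t :=
      (measurable_pi_apply t).comp (measurable_fst.comp measurable_snd)
    exact (h2.inner (hxm t)).sub (((hxm t).norm.pow_const 2).const_mul _)
  have hm : Measurable fun ω : Noise nx nu T => eexp (∑ t : Fin T,
      (inner ℝ (ω.2.1 t) (toEuclideanLin G (P.expertState h ω t))
        - P.sigz ^ 2 / 2 * ‖toEuclideanLin G (P.expertState h ω t)‖ ^ 2)) :=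
    Measurable.eexp (Finset.measurable_sum _ fun t _ => hfm t)
  rw [noiseLaw, lintegral_prod _ hm.aemeasurable]
  refine (lintegral_mono (g := fun _ => 1) fun x₀ => ?_).trans (by simp)
  have hm' : Measurable fun q : (Fin T → Vec nu) × (Fin T → Vec nx) => eexp (∑ t : Fin T,
      (inner ℝ (q.1 t) (toEuclideanLin G (P.expertState h ((x₀, q) : Noise nx nu T) t))
        - P.sigz ^ 2 / 2 *
          ‖toEuclideanLin G (P.expertState h ((x₀, q) : Noise nx nu T) t)‖ ^ 2)) :=
    hm.comp measurable_prodMk_left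
  rw [lintegral_prod_symm _ hm'.aemeasurable]
  refine (lintegral_mono (g := fun _ => 1) fun w => ?_).trans (by simp)
  simp only [eexp_sum]
  refine lintegral_prod_adapted_le_one _ (fun t => ?_) ?_ ?_
  · have h3 : Measurable fun z : Fin T → Vec nu => ((x₀, z, w) : Noise nx nu T) :=
      measurable_const.prodMk (measurable_id.prodMk measurable_const)
    exact Measurable.eexp ((hfm t).comp h3)
  · intro t s z ζ hts
    have h1 : P.expertState h ((x₀, Function.update z s ζ, w) : Noise nx nu T) t
        = P.expertState h ((x₀, z, w) : Noise nx nu T) t := by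
      refine state_congr P.A P.B (P.K h) (ω := (x₀, Function.update z s ζ, w))
        (ω' := (x₀, z, w)) rfl fun r hr => ?_
      have : r ≠ s := by rintro rfl; exact absurd hts (by rw [Fin.lt_def]; omega)
      simp [Function.update_of_ne this]
    simp only [h1, Function.update_of_ne hts.ne]
  · intro t z
    have h1 : ∀ ζ, P.expertState h ((x₀, Function.update z t ζ, w) : Noise nx nu T) t
        = P.expertState h ((x₀, z, w) : Noise nx nu T) t := by
      intro ζ
      refine state_congr P.A P.B (P.K h) (ω := (x₀, Function.update z t ζ, w))
        (ω' := (x₀, z, w)) rfl fun r hr => ?_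
      have : r ≠ t := by rintro rfl; omega
      simp [Function.update_of_ne this]
    simp only [h1, Function.update_self, sub_eq_add_neg, eexp_add]
    rw [lintegral_mul_const _ (Measurable.eexp (by fun_prop)),
      lintegral_eexp_inner_multivariateGaussian (Matrix.PosSemidef.one.smul (sq_nonneg _)),
      ← eexp_add]
    refine le_of_eq ?_
    rw [← eexp_zero]
    congr 1
    simp only [qf, map_smul, LinearMap.smul_apply, toEuclideanLin_one, inner_smul_right,
      real_inner_self_eq_norm_sq]
    ring

theorem lintegral_eexp_resid_sq_le (hP : P.Valid) (h : Fin (H + 1)) (T : ℕ) :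
    ∫⁻ e, eexp (∑ t, 1 / (4 * P.sigz ^ 2) * ‖resid (P.K h) (e t)‖ ^ 2) ∂(P.demoLaw h T)
      ≤ eexp (T * (nu * (Real.log 2 / 2))) := by
  have hs := hP.sigz_pos
  have hK := measurable_resid (P.K h)
  have hmeas : Measurable fun e : Traj nx nu T =>
      eexp (∑ t, 1 / (4 * P.sigz ^ 2) * ‖resid (P.K h) (e t)‖ ^ 2) :=
    Measurable.eexp (Finset.measurable_sum _ fun t _ =>
      ((hK.comp (measurable_pi_apply t)).norm.pow_const 2).const_mul _)
  rw [demoLaw, lintegral_map hmeas (measurable_demo _ _ _)]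
  have hres : ∀ (ω : Noise nx nu T) (t : Fin T),
      resid (P.K h) (demo P.A P.B (P.K h) ω t) = ω.2.1 t := demo_residual P.A P.B (P.K h)
  simp only [hres]
  have hmp : MeasurePreserving (fun ω : Noise nx nu T => ω.2.1) (P.noiseLaw h T)
      (Measure.pi fun _ : Fin T => multivariateGaussian 0 (P.sigz ^ 2 • 1)) :=
    measurePreserving_fst.comp measurePreserving_snd
  have hcomp := hmp.lintegral_comp
    (f := fun z => eexp (∑ t, 1 / (4 * P.sigz ^ 2) * ‖z t‖ ^ 2)) (Measurable.eexp (by fun_prop))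
  rw [hcomp]
  simp only [eexp_sum]
  rw [lintegral_pi_prod (fun _ : Fin T => multivariateGaussian (0 : Vec nu) (P.sigz ^ 2 • 1))
    (f := fun _ y => eexp (1 / (4 * P.sigz ^ 2) * ‖y‖ ^ 2))
    (fun _ => Measurable.eexp (by fun_prop)), eexp_nsmul]
  simp only [Finset.prod_const, Finset.card_univ, Fintype.card_fin]
  refine pow_le_pow_left' (lintegral_eexp_norm_sq_le
    (Matrix.PosSemidef.one.smul (sq_nonneg _)) (L := P.sigz ^ 2) ?_ (by positivity) ?_) T
  · intro r
    simp only [qf, map_smul, LinearMap.smul_apply, toEuclideanLin_one, inner_smul_right,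
      real_inner_self_eq_norm_sq, le_refl]
  · field_simp; norm_num

end Problem


/-! ### Concentration of the empirical covariance -/

namespace Problem

variable {nx nu k H : ℕ} {P : Problem nx nu k H}

theorem measurable_sum_inner_sq {N T : ℕ} (r : Vec nx) :
    Measurable fun e : Fin N → Traj nx nu T => ∑ i, ∑ t, inner ℝ r (e i t).1 ^ 2 := by
  fun_prop

theorem mixing_pos (hn : 0 < nx) (hP : P.Valid) (h : Fin (H + 1)) : 0 < P.mixing h := by
  have h1 := one_le_cond hn (hP.posDef_Sx h)
  have h2 := (hP.stable h).one_le_calJ hn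
  unfold mixing
  positivity

/-- Chernoff bound for the empirical second moment in a fixed direction. -/
theorem measure_abs_sum_inner_sq_sub_gt_le (hn : 0 < nx) (hP : P.Valid) (h : Fin (H + 1))
    (N T : ℕ) {r : Vec nx} (hr : qf (P.Sx h) r = 1) :
    (Measure.pi fun _ : Fin N => P.demoLaw h T) {e | (N * T : ℝ) / 64
        < |∑ i, ∑ t, inner ℝ r (e i t).1 ^ 2 - N * T|}
      ≤ eexp (Real.log 2 - N * T / (32768 * P.mixing h)) := by
  have hL := mixing_pos hn hP h
  have key : ∀ ε : ℝ, |ε| = 1 → (Measure.pi fun _ : Fin N => P.demoLaw h T)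
      {e | ε / (256 * P.mixing h) * (N * T) + N * T / (16384 * P.mixing h)
        ≤ ε / (256 * P.mixing h) * ∑ i, ∑ t, inner ℝ r (e i t).1 ^ 2}
      ≤ eexp (-(N * T / (32768 * P.mixing h))) := by
    intro ε hε
    have hε2 : ε ^ 2 = 1 := by rw [← sq_abs, hε, one_pow]
    set s := ε / (256 * P.mixing h) with hs
    have hsabs : |s| * P.mixing h ≤ 1 / 4 := by
      rw [hs, abs_div, hε, abs_of_pos (by positivity : 0 < 256 * P.mixing h)]
      field_simp; norm_num
    have h1 : ∫⁻ e, eexp (s * ∑ i, ∑ t, inner ℝ r (e i t).1 ^ 2)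
        ∂(Measure.pi fun _ : Fin N => P.demoLaw h T)
        ≤ eexp (N * ((s + 2 * s ^ 2 * P.mixing h) * T)) := by
      simp only [Finset.mul_sum _ _ s, eexp_sum (Finset.univ : Finset (Fin N))]
      rw [lintegral_pi_prod (fun _ : Fin N => P.demoLaw h T)
        (f := fun _ e => eexp (∑ t, s * inner ℝ r (e t).1 ^ 2))
        (fun _ => Measurable.eexp (by fun_prop)), eexp_nsmul]
      simp only [Finset.prod_const, Finset.card_univ, Fintype.card_fin]
      refine pow_le_pow_left' ?_ N
      simp only [← Finset.mul_sum]
      exact lintegral_eexp_sum_inner_sq_le hn hP h T hr hsabs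
    refine (measure_le_of_lintegral_eexp_le ((measurable_sum_inner_sq r).const_mul s) h1
      _).trans (le_of_eq ?_)
    congr 1
    have : s ^ 2 = 1 / (65536 * P.mixing h ^ 2) := by
      rw [hs, div_pow, hε2]; ring
    rw [show N * ((s + 2 * s ^ 2 * P.mixing h) * T) - (s * (N * T) + N * T
      / (16384 * P.mixing h)) = 2 * s ^ 2 * P.mixing h * (N * T) - N * T
      / (16384 * P.mixing h) by ring, this]
    field_simp
    ring
  have hsub : {e : Fin N → Traj nx nu T | (N * T : ℝ) / 64
        < |∑ i, ∑ t, inner ℝ r (e i t).1 ^ 2 - N * T|}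
      ⊆ {e | 1 / (256 * P.mixing h) * (N * T) + N * T / (16384 * P.mixing h)
          ≤ 1 / (256 * P.mixing h) * ∑ i, ∑ t, inner ℝ r (e i t).1 ^ 2}
        ∪ {e | -1 / (256 * P.mixing h) * (N * T) + N * T / (16384 * P.mixing h)
          ≤ -1 / (256 * P.mixing h) * ∑ i, ∑ t, inner ℝ r (e i t).1 ^ 2} := by
    intro e he
    simp only [Set.mem_union, Set.mem_ofPred_eq] at he ⊢
    have e1 : (N * T : ℝ) / (16384 * P.mixing h)
        = 1 / (256 * P.mixing h) * (N * T / 64) := by field_simp; ring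
    have hp : 0 < 1 / (256 * P.mixing h) := by positivity
    rw [e1, neg_div]
    rcases lt_abs.1 he with h1 | h1
    · left; nlinarith
    · right; nlinarith
  refine (measure_mono hsub).trans ((measure_union_le _ _).trans ?_)
  refine (add_le_add (key 1 (by simp)) (key (-1) (by simp))).trans (le_of_eq ?_)
  rw [sub_eq_add_neg, eexp_add, eexp, eexp, Real.exp_log two_pos, ENNReal.ofReal_ofNat, two_mul]

/-- The empirical second moments are within a factor of two of the covariance, uniformly over a
subspace, except with a probability that is exponential in its dimension. -/
theorem measure_exists_sum_inner_sq_deviation_le (hn : 0 < nx) (hP : P.Valid) (h : Fin (H + 1))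
    (N T : ℕ) (R : Submodule ℝ (Vec nx)) :
    (Measure.pi fun _ : Fin N => P.demoLaw h T) {e | ∃ r ∈ R, (N * T : ℝ) / 2 * qf (P.Sx h) r
        < |∑ i, ∑ t, inner ℝ r (e i t).1 ^ 2 - N * T * qf (P.Sx h) r|}
      ≤ eexp (Module.finrank ℝ R * Real.log 5
          + (Real.log 2 - N * T / (32768 * P.mixing h))) := by
  have hbasis := exists_qf_orthonormal (hP.posDef_Sx h) R
  generalize Module.finrank ℝ R = q at hbasis ⊢
  obtain ⟨b, -, hspan, hb⟩ := hbasis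
  let L : EuclideanSpace ℝ (Fin q) →ₗ[ℝ] Vec nx :=
    ∑ j, (LinearMap.toSpanSingleton ℝ (Vec nx) (b j)).comp
      (EuclideanSpace.proj j : EuclideanSpace ℝ (Fin q) →L[ℝ] ℝ).toLinearMap
  have hL : ∀ c, L c = ∑ j, c j • b j := by
    intro c; simp [L, LinearMap.sum_apply]
  let f : (Fin N → Traj nx nu T) → Fin N × Fin T → EuclideanSpace ℝ (Fin q) →ₗ[ℝ] ℝ :=
    fun e j => (innerₗ (Vec nx) (e j.1 j.2).1).comp L
  have hf : ∀ e c, ∑ j, f e j c ^ 2 = ∑ i, ∑ t, inner ℝ (L c) (e i t).1 ^ 2 := by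
    intro e c
    rw [Fintype.sum_prod_type]
    simp [f, real_inner_comm]
  have hmain := measure_exists_quadratic_deviation_le
    (μ := Measure.pi fun _ : Fin N => P.demoLaw h T) f (N := N * T) (η := N * T / 64)
    (p := Real.log 2 - N * T / (32768 * P.mixing h)) (fun v hv => by
      simp only [hf]
      refine measure_abs_sum_inner_sq_sub_gt_le hn hP h N T ?_
      rw [hL, hb, hv, one_pow])
  rw [finrank_euclideanSpace_fin] at hmain
  refine (measure_mono ?_).trans hmain
  rintro e ⟨r, hr, hlt⟩
  obtain ⟨c, rfl⟩ := hspan r hr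
  refine ⟨c, ?_⟩
  rw [hf, hL, ← hb]
  convert hlt using 1
  ring

end Problem

/-! ### Self-normalized noise terms -/

/-- Uniform bound for the correlation of the noise `z` with linear images of the covariates `x`, in
terms of the covariance of the latter, over all coefficient matrices with rows in a subspace. The
exponential moment hypothesis expresses that `z` is a sub-Gaussian martingale difference sequence
with respect to `x`. -/
theorem measure_exists_score_sq_gt_le {Ω ι J : Type*} [MeasurableSpace Ω] {μ : Measure Ω}
    [SFinite μ] [Fintype ι] [Fintype J] {n m : ℕ} {x : ι → J → Ω → Vec n} {z : ι → J → Ω → Vec m}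
    (hx : ∀ a j, Measurable (x a j)) (hz : ∀ a j, Measurable (z a j))
    {S : ι → Matrix (Fin n) (Fin n) ℝ} (hS : ∀ a, (S a).PosDef) (R : Submodule ℝ (Vec n))
    {σ N : ℝ} (hσ : 0 < σ) (hN : 0 < N)
    (h : ∀ G : ι → Matrix (Fin m) (Fin n) ℝ, ∫⁻ ω, eexp (∑ a, ∑ j,
      (inner ℝ (z a j ω) (toEuclideanLin (G a) (x a j ω))
        - σ ^ 2 / 2 * ‖toEuclideanLin (G a) (x a j ω)‖ ^ 2)) ∂μ ≤ 1) (A : ℝ) :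
    μ {ω | (∀ a, ∀ r ∈ R, ∑ j, inner ℝ r (x a j ω) ^ 2 ≤ 2 * N * qf (S a) r) ∧
        ∃ G : ι → Matrix (Fin m) (Fin n) ℝ, (∀ a i, rowVec (G a) i ∈ R) ∧
          A * ∑ a, wsq (S a) (G a)
            < (∑ a, ∑ j, inner ℝ (z a j ω) (toEuclideanLin (G a) (x a j ω))) ^ 2}
      ≤ eexp (Fintype.card ι * m * Module.finrank ℝ R * (Real.log 2 / 2)
          - A / (8 * σ ^ 2 * N)) := by
  have hbasis := fun a => exists_qf_orthonormal (hS a) R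
  generalize Module.finrank ℝ R = q at hbasis ⊢
  choose b hbR hspan hb using hbasis
  set β := 2 * σ ^ 2 * N with hβ
  have hβ0 : 0 < β := by positivity
  let av : Ω → EuclideanSpace ℝ (ι × Fin m × Fin q) := fun ω => WithLp.toLp 2 fun p =>
    (√β)⁻¹ * ∑ j, z p.1 j ω p.2.1 * inner ℝ (b p.1 p.2.2) (x p.1 j ω)
  let Gm : EuclideanSpace ℝ (ι × Fin m × Fin q) → ι → Matrix (Fin m) (Fin n) ℝ := fun g a =>
    Matrix.of fun i l => (√β)⁻¹ * ∑ p, g (a, i, p) * b a p l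
  have hrow : ∀ g a i, rowVec (Gm g a) i = (√β)⁻¹ • ∑ p, g (a, i, p) • b a p := by
    intro g a i
    ext l
    simp [rowVec, Gm]
  have hGx : ∀ g a i y, toEuclideanLin (Gm g a) y i
      = (√β)⁻¹ * ∑ p, g (a, i, p) * inner ℝ (b a p) y := by
    intro g a i y
    rw [toEuclideanLin_apply_rowVec, hrow, real_inner_smul_left, sum_inner]
    simp [real_inner_smul_left]
  have hscore : ∀ ω g, inner ℝ (av ω) g
      = ∑ a, ∑ j, inner ℝ (z a j ω) (toEuclideanLin (Gm g a) (x a j ω)) := by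
    intro ω g
    have h1 : ∀ a j, inner ℝ (z a j ω) (toEuclideanLin (Gm g a) (x a j ω))
        = ∑ i, ∑ p, (√β)⁻¹ * (z a j ω i * inner ℝ (b a p) (x a j ω)) * g (a, i, p) := by
      intro a j
      rw [PiLp.inner_apply]
      refine Finset.sum_congr rfl fun i _ => ?_
      rw [hGx]
      simp only [RCLike.inner_apply, conj_trivial, Finset.mul_sum, Finset.sum_mul]
      exact Finset.sum_congr rfl fun p _ => by ring
    simp only [h1]
    rw [PiLp.inner_apply, Fintype.sum_prod_type]
    refine Finset.sum_congr rfl fun a _ => ?_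
    rw [Fintype.sum_prod_type]
    refine Eq.trans ?_ (Finset.sum_comm (s := Finset.univ (α := Fin m)) (t := Finset.univ (α := J)))
    refine Finset.sum_congr rfl fun i _ => ?_
    rw [Finset.sum_comm (s := Finset.univ (α := J))]
    refine Finset.sum_congr rfl fun p _ => ?_
    simp only [RCLike.inner_apply, conj_trivial, av, Finset.mul_sum]
    exact Finset.sum_congr rfl fun j _ => by ring
  let qq : Ω → EuclideanSpace ℝ (ι × Fin m × Fin q) → ℝ := fun ω g =>
    ∑ a, ∑ j, σ ^ 2 / 2 * ‖toEuclideanLin (Gm g a) (x a j ω)‖ ^ 2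
  have hqm : Measurable fun p : Ω × EuclideanSpace ℝ (ι × Fin m × Fin q) => qq p.1 p.2 := by
    refine Finset.measurable_sum _ fun a _ => Finset.measurable_sum _ fun j _ => ?_
    have h1 : (fun p : Ω × EuclideanSpace ℝ (ι × Fin m × Fin q) => σ ^ 2 / 2 * ‖toEuclideanLin (Gm p.2 a) (x a j p.1)‖ ^ 2)
        = fun p => σ ^ 2 / 2 * ∑ i, ((√β)⁻¹ * ∑ c, p.2 (a, i, c)
          * inner ℝ (b a c) (x a j p.1)) ^ 2 := by
      funext p
      rw [EuclideanSpace.real_norm_sq_eq]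
      simp only [hGx]
    rw [h1]
    have hxm : Measurable fun p : Ω × EuclideanSpace ℝ (ι × Fin m × Fin q) => x a j p.1 := (hx a j).comp measurable_fst
    refine (Finset.measurable_sum _ fun i _ => ((Finset.measurable_sum _ fun c _ =>
      Measurable.mul ?_ (Measurable.inner measurable_const hxm)).const_mul _).pow_const 2).const_mul _
    fun_prop
  have ham : Measurable av := by
    refine (WithLp.measurable_toLp 2 _).comp (measurable_pi_lambda _ fun p => ?_)
    refine Measurable.const_mul (Finset.measurable_sum _ fun j _ => Measurable.mul ?_ ?_) _
    · have := hz p.1 j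
      fun_prop
    · exact Measurable.inner measurable_const (hx p.1 j)
  have hcard : (Fintype.card (ι × Fin m × Fin q) : ℝ) = Fintype.card ι * m * q := by
    simp [mul_assoc]
  have hmain := measure_selfNormalized_le (μ := μ) ham hqm (fun g => by
      refine le_trans (le_of_eq (lintegral_congr fun ω => ?_)) (h (Gm g))
      rw [hscore]
      simp only [qq, Finset.sum_sub_distrib]) (A := A / β)
    (B := {ω | (∀ a, ∀ r ∈ R, ∑ j, inner ℝ r (x a j ω) ^ 2 ≤ 2 * N * qf (S a) r) ∧
        ∃ G : ι → Matrix (Fin m) (Fin n) ℝ, (∀ a i, rowVec (G a) i ∈ R) ∧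
          A * ∑ a, wsq (S a) (G a)
            < (∑ a, ∑ j, inner ℝ (z a j ω) (toEuclideanLin (G a) (x a j ω))) ^ 2}) ?_
  · rw [hcard] at hmain
    refine hmain.trans (le_of_eq ?_)
    congr 2
    rw [hβ, div_div]
    ring_nf
  rintro ω ⟨hiso, G, hGR, hGlt⟩
  have hsβ : 0 < √β := Real.sqrt_pos.2 hβ0
  refine ⟨fun g => ?_, ?_⟩
  · have h1 : ∀ a i, ∑ j, toEuclideanLin (Gm g a) (x a j ω) i ^ 2
        ≤ 2 * N * (β⁻¹ * ∑ p, g (a, i, p) ^ 2) := by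
      intro a i
      have h2 := hiso a (rowVec (Gm g a) i) (by
        rw [hrow]
        exact R.smul_mem _ (R.sum_mem fun p _ => R.smul_mem _ (hbR a p)))
      simp only [toEuclideanLin_apply_rowVec]
      refine h2.trans (le_of_eq ?_)
      have h3 := hb a (WithLp.toLp 2 fun p => g (a, i, p))
      rw [EuclideanSpace.real_norm_sq_eq] at h3
      simp only at h3
      rw [hrow, qf_smul, h3, inv_pow, Real.sq_sqrt hβ0.le]
    have h4 : ‖g‖ ^ 2 = ∑ a, ∑ i, ∑ p, g (a, i, p) ^ 2 := by
      rw [EuclideanSpace.real_norm_sq_eq, Fintype.sum_prod_type]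
      simp only [Fintype.sum_prod_type]
    have h5 : qq ω g = σ ^ 2 / 2 * ∑ a, ∑ i, ∑ j,
        toEuclideanLin (Gm g a) (x a j ω) i ^ 2 := by
      simp only [qq, EuclideanSpace.real_norm_sq_eq, ← Finset.mul_sum]
      congr 1
      exact Finset.sum_congr rfl fun a _ => Finset.sum_comm
    rw [h5, h4]
    calc σ ^ 2 / 2 * ∑ a, ∑ i, ∑ j, toEuclideanLin (Gm g a) (x a j ω) i ^ 2
        ≤ σ ^ 2 / 2 * ∑ a, ∑ i, 2 * N * (β⁻¹ * ∑ p, g (a, i, p) ^ 2) :=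
          mul_le_mul_of_nonneg_left (Finset.sum_le_sum fun a _ => Finset.sum_le_sum fun i _ =>
            h1 a i) (by positivity)
      _ = (∑ a, ∑ i, ∑ p, g (a, i, p) ^ 2) / 2 := by
          simp only [← Finset.mul_sum]
          rw [hβ]
          field_simp
  · choose c hc using fun a i => hspan a _ (hGR a i)
    let g : EuclideanSpace ℝ (ι × Fin m × Fin q) := WithLp.toLp 2 fun p => √β * c p.1 p.2.1 p.2.2
    have hGg : ∀ a i, rowVec (Gm g a) i = rowVec (G a) i := by
      intro a i
      rw [hrow, hc a i, Finset.smul_sum]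
      refine Finset.sum_congr rfl fun p _ => ?_
      rw [smul_smul]
      congr 1
      simp only [g]
      field_simp
    have hGg' : Gm g = G := by
      funext a
      ext i l
      have := congrArg (fun v : Vec n => v l) (hGg a i)
      simpa [rowVec] using this
    have hg : ‖g‖ ^ 2 = β * ∑ a, wsq (S a) (G a) := by
      rw [EuclideanSpace.real_norm_sq_eq, Fintype.sum_prod_type, Finset.mul_sum]
      refine Finset.sum_congr rfl fun a _ => ?_
      rw [Fintype.sum_prod_type, wsq, Finset.mul_sum]
      refine Finset.sum_congr rfl fun i _ => ?_
      rw [hc a i, hb, EuclideanSpace.real_norm_sq_eq, Finset.mul_sum]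
      refine Finset.sum_congr rfl fun p _ => ?_
      simp only [g]
      rw [mul_pow, Real.sq_sqrt hβ0.le]
    have hs : (∑ a, ∑ j, inner ℝ (z a j ω) (toEuclideanLin (G a) (x a j ω))) ^ 2
        ≤ ‖av ω‖ ^ 2 * (β * ∑ a, wsq (S a) (G a)) := by
      rw [← hg, ← mul_pow, ← hGg', ← hscore, ← sq_abs]
      exact pow_le_pow_left₀ (abs_nonneg _) (abs_real_inner_le_norm _ _) 2
    have hw : 0 ≤ ∑ a, wsq (S a) (G a) :=
      Finset.sum_nonneg fun a _ => wsq_nonneg (hS a).posSemidef _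
    by_contra! hlt
    rw [lt_div_iff₀ hβ0] at hlt
    nlinarith

/-! ### A finite family of subspaces approximating every subspace -/

/-- Vector with coordinates in `{-M, …, M} / M`. -/
noncomputable def gridVec {n : ℕ} (M : ℕ) (g : Fin n → Fin (2 * M + 1)) : Vec n :=
  WithLp.toLp 2 fun l => ((g l : ℕ) - M : ℝ) / M

theorem exists_fin_abs_sub_le {M : ℕ} (hM : 0 < M) {x : ℝ} (hx : |x| ≤ 1) :
    ∃ a : Fin (2 * M + 1), |x - ((a : ℕ) - M : ℝ) / M| ≤ 1 / M := by
  have hM' : (0 : ℝ) < M := by exact_mod_cast hM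
  obtain ⟨h1, h2⟩ := abs_le.1 hx
  have h3 : 0 ≤ (x + 1) * M := mul_nonneg (by linarith) hM'.le
  have h4 : (⌊(x + 1) * M⌋₊ : ℝ) ≤ (x + 1) * M := Nat.floor_le h3
  have h5 : ⌊(x + 1) * M⌋₊ < 2 * M + 1 := by
    have : (⌊(x + 1) * M⌋₊ : ℝ) < ((2 * M + 1 : ℕ) : ℝ) := by push_cast; nlinarith
    exact_mod_cast this
  refine ⟨⟨_, h5⟩, ?_⟩
  have h6 := Nat.lt_floor_add_one ((x + 1) * M)
  have e : x - ((⌊(x + 1) * M⌋₊ : ℝ) - M) / M = ((x + 1) * M - ⌊(x + 1) * M⌋₊) / M := by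
    field_simp; ring
  simp only
  rw [e, abs_div, abs_of_pos hM', div_le_div_iff_of_pos_right hM', abs_of_nonneg (by linarith)]
  linarith

theorem exists_gridVec_norm_sub_sq_le {n M : ℕ} (hM : 0 < M) {x : Vec n} (hx : ‖x‖ ≤ 1) :
    ∃ g : Fin n → Fin (2 * M + 1), ‖x - gridVec M g‖ ^ 2 ≤ n / M ^ 2 := by
  choose g hg using fun l => exists_fin_abs_sub_le hM
    (x := x l) ((PiLp.norm_apply_le x l).trans hx)
  refine ⟨g, ?_⟩
  rw [EuclideanSpace.real_norm_sq_eq]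
  calc ∑ l, (x - gridVec M g) l ^ 2 ≤ ∑ _l : Fin n, 1 / (M : ℝ) ^ 2 := by
        refine Finset.sum_le_sum fun l _ => ?_
        rw [← sq_abs, ← _root_.one_div_pow]
        exact pow_le_pow_left₀ (abs_nonneg _) (hg l) 2
    _ = n / M ^ 2 := by simp [div_eq_mul_inv]

/-- Every subspace of dimension at most `p` is close to one spanned by `p` grid vectors. -/
theorem exists_grid_approx {n p M : ℕ} (hM : 0 < M) {R : Submodule ℝ (Vec n)}
    (hR : Module.finrank ℝ R ≤ p) :
    ∃ g : Fin p → Fin n → Fin (2 * M + 1), ∀ r ∈ R,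
      ∃ r' ∈ Submodule.span ℝ (Set.range fun j => gridVec M (g j)),
        ‖r - r'‖ ^ 2 ≤ p * n / M ^ 2 * ‖r‖ ^ 2 := by
  have b := stdOrthonormalBasis ℝ R
  generalize Module.finrank ℝ R = q at b hR
  choose g hg using fun j => exists_gridVec_norm_sub_sq_le hM
    (x := (b j : Vec n)) (by
      have := b.norm_eq_one j
      rw [← Submodule.coe_norm] at *
      exact this.le)
  refine ⟨fun j => if h : j.val < q then g ⟨j, h⟩ else fun _ => 0, fun r hr => ?_⟩
  have hmem : ∀ j : Fin q, gridVec M (g j) ∈ Submodule.span ℝ (Set.range fun j : Fin p =>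
      gridVec M (if h : j.val < q then g ⟨j, h⟩ else fun _ => 0)) := by
    intro j
    refine Submodule.subset_span ⟨Fin.castLE hR j, ?_⟩
    simp
  set c : EuclideanSpace ℝ (Fin q) := b.repr ⟨r, hr⟩ with hc
  have hr' : r = ∑ j, c j • (b j : Vec n) := by
    have := congrArg (fun v : R => (v : Vec n)) (b.sum_repr ⟨r, hr⟩)
    simpa using this.symm
  have hcn : ‖c‖ = ‖r‖ := by rw [hc, LinearIsometryEquiv.norm_map]; rfl
  refine ⟨∑ j, c j • gridVec M (g j), Submodule.sum_mem _ fun j _ =>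
    Submodule.smul_mem _ _ (hmem j), ?_⟩
  have h1 : r - ∑ j, c j • gridVec M (g j) = ∑ j, c j • ((b j : Vec n) - gridVec M (g j)) := by
    conv_lhs => rw [hr']
    rw [← Finset.sum_sub_distrib]
    exact Finset.sum_congr rfl fun j _ => by rw [smul_sub]
  have h2 : ‖r - ∑ j, c j • gridVec M (g j)‖
      ≤ ∑ j, |c j| * ‖(b j : Vec n) - gridVec M (g j)‖ := by
    rw [h1]
    refine (norm_sum_le _ _).trans (le_of_eq (Finset.sum_congr rfl fun j _ => ?_))
    rw [norm_smul, Real.norm_eq_abs]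
  calc ‖r - ∑ j, c j • gridVec M (g j)‖ ^ 2
      ≤ (∑ j, |c j| * ‖(b j : Vec n) - gridVec M (g j)‖) ^ 2 :=
        pow_le_pow_left₀ (norm_nonneg _) h2 2
    _ ≤ (∑ j, |c j| ^ 2) * ∑ j, ‖(b j : Vec n) - gridVec M (g j)‖ ^ 2 :=
        Finset.sum_mul_sq_le_sq_mul_sq _ _ _
    _ ≤ ‖r‖ ^ 2 * (p * n / M ^ 2) := by
        refine mul_le_mul (le_of_eq ?_) ?_ (Finset.sum_nonneg fun _ _ => sq_nonneg _) (sq_nonneg _)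
        · rw [← hcn, EuclideanSpace.real_norm_sq_eq]
          exact Finset.sum_congr rfl fun j _ => sq_abs _
        · refine (Finset.sum_le_sum fun j _ => hg j).trans ?_
          have : (q : ℝ) ≤ p := by exact_mod_cast hR
          rw [Finset.sum_const, Finset.card_univ, Fintype.card_fin, nsmul_eq_mul, mul_div_assoc]
          exact mul_le_mul_of_nonneg_right this (by positivity)
    _ = _ := mul_comm _ _

/-! ### High-probability events for the data -/

theorem abs_sum_norm_sq_toEuclideanLin_sub_le {nx nu m N T : ℕ} {S : Matrix (Fin nx) (Fin nx) ℝ}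
    {D : Matrix (Fin m) (Fin nx) ℝ} {d : Fin N → Traj nx nu T} {a b : ℝ}
    (h : ∀ l, |∑ i, ∑ t, inner ℝ (rowVec D l) (d i t).1 ^ 2 - a * qf S (rowVec D l)|
      ≤ b * qf S (rowVec D l)) :
    |∑ i, ∑ t, ‖toEuclideanLin D (d i t).1‖ ^ 2 - a * wsq S D| ≤ b * wsq S D := by
  have e1 : ∑ i, ∑ t, ‖toEuclideanLin D (d i t).1‖ ^ 2
      = ∑ l, ∑ i, ∑ t, inner ℝ (rowVec D l) (d i t).1 ^ 2 := by
    simp only [norm_sq_toEuclideanLin]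
    rw [Finset.sum_comm (s := Finset.univ (α := Fin m))]
    refine Finset.sum_congr rfl fun i _ => ?_
    exact Finset.sum_comm
  rw [e1, wsq, Finset.mul_sum, Finset.mul_sum, ← Finset.sum_sub_distrib]
  exact (Finset.abs_sum_le_sum_abs _ _).trans (Finset.sum_le_sum fun l _ => h l)

namespace Problem

variable {nx nu k H : ℕ} {P : Problem nx nu k H}

theorem measurable_demo_resid (h : Fin (H + 1)) {T : ℕ} (t : Fin T) :
    Measurable fun e : Traj nx nu T => resid (P.K h) (e t) :=
  (measurable_resid (P.K h)).comp (measurable_pi_apply t)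

theorem measurable_score (h : Fin (H + 1)) {T : ℕ} (G : Matrix (Fin nu) (Fin nx) ℝ) :
    Measurable fun e : Traj nx nu T => ∑ t, (inner ℝ (resid (P.K h) (e t))
      (toEuclideanLin G (e t).1) - P.sigz ^ 2 / 2 * ‖toEuclideanLin G (e t).1‖ ^ 2) := by
  refine Finset.measurable_sum _ fun t _ => ?_
  have h1 : Measurable fun e : Traj nx nu T => toEuclideanLin G (e t).1 :=
    (measurable_toEuclideanLin G).comp (measurable_fst.comp (measurable_pi_apply t))
  exact ((measurable_demo_resid h t).inner h1).sub ((h1.norm.pow_const 2).const_mul _)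

theorem lintegral_eexp_score_pi_le (h : Fin (H + 1)) (N T : ℕ) (G : Matrix (Fin nu) (Fin nx) ℝ) :
    ∫⁻ d, eexp (∑ i, ∑ t, (inner ℝ (resid (P.K h) (d i t)) (toEuclideanLin G (d i t).1)
        - P.sigz ^ 2 / 2 * ‖toEuclideanLin G (d i t).1‖ ^ 2))
      ∂(Measure.pi fun _ : Fin N => P.demoLaw h T) ≤ 1 := by
  simp only [eexp_sum (Finset.univ : Finset (Fin N))]
  rw [lintegral_pi_prod (fun _ : Fin N => P.demoLaw h T)
    (f := fun _ e => eexp (∑ t, (inner ℝ (resid (P.K h) (e t)) (toEuclideanLin G (e t).1)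
      - P.sigz ^ 2 / 2 * ‖toEuclideanLin G (e t).1‖ ^ 2)))
    fun _ => (measurable_score h G).eexp]
  exact Finset.prod_le_one' fun _ _ => lintegral_eexp_score_le h T G

theorem lintegral_eexp_score_sourceLaw_le (N T : ℕ) (G : Fin H → Matrix (Fin nu) (Fin nx) ℝ) :
    ∫⁻ s, eexp (∑ h, ∑ i, ∑ t, (inner ℝ (resid (P.K h.castSucc) (s h i t))
        (toEuclideanLin (G h) (s h i t).1)
        - P.sigz ^ 2 / 2 * ‖toEuclideanLin (G h) (s h i t).1‖ ^ 2))
      ∂(P.sourceLaw N T) ≤ 1 := by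
  simp only [eexp_sum (Finset.univ : Finset (Fin H))]
  rw [sourceLaw, lintegral_pi_prod (fun h : Fin H => Measure.pi fun _ : Fin N =>
      P.demoLaw h.castSucc T)
    (f := fun h d => eexp (∑ i, ∑ t, (inner ℝ (resid (P.K h.castSucc) (d i t))
      (toEuclideanLin (G h) (d i t).1)
      - P.sigz ^ 2 / 2 * ‖toEuclideanLin (G h) (d i t).1‖ ^ 2)))
    fun h => Measurable.eexp (Finset.measurable_sum _ fun i _ =>
      (measurable_score h.castSucc (G h)).comp (measurable_pi_apply i))]
  exact Finset.prod_le_one' fun h _ => lintegral_eexp_score_pi_le h.castSucc N T (G h)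

/-- Two-sided comparison of the empirical covariances of all source tasks with the true ones. -/
def SourceIsometry (P : Problem nx nu k H) {N T : ℕ} (s : Fin H → Fin N → Traj nx nu T) : Prop :=
  ∀ (h : Fin H) (r : Vec nx), |∑ i, ∑ t, inner ℝ r (s h i t).1 ^ 2
    - N * T * qf (P.Sx h.castSucc) r| ≤ (N * T : ℝ) / 2 * qf (P.Sx h.castSucc) r

theorem measure_not_sourceIsometry_le (hn : 0 < nx) (hP : P.Valid) (N T : ℕ) :
    P.sourceLaw N T {s | ¬ P.SourceIsometry s} ≤ ∑ h : Fin H, eexp (nx * Real.log 5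
      + (Real.log 2 - N * T / (32768 * P.mixing h.castSucc))) := by
  have hsub : {s : Fin H → Fin N → Traj nx nu T | ¬ P.SourceIsometry s}
      ⊆ ⋃ h ∈ (Finset.univ : Finset (Fin H)), (fun s => s h) ⁻¹' {e : Fin N → Traj nx nu T |
        ∃ r ∈ (⊤ : Submodule ℝ (Vec nx)), (N * T : ℝ) / 2 * qf (P.Sx h.castSucc) r
        < |∑ i, ∑ t, inner ℝ r (e i t).1 ^ 2 - N * T * qf (P.Sx h.castSucc) r|} := by
    intro s hs
    simp only [SourceIsometry, Set.mem_ofPred_eq, not_forall, not_le] at hs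
    obtain ⟨h, r, hr⟩ := hs
    simp only [Set.mem_iUnion]
    exact ⟨h, Finset.mem_univ _, r, trivial, hr⟩
  refine (measure_mono hsub).trans ((measure_biUnion_finset_le _ _).trans
    (Finset.sum_le_sum fun h _ => ?_))
  have hmp : MeasurePreserving (fun s : Fin H → Fin N → Traj nx nu T => s h) (P.sourceLaw N T)
      (Measure.pi fun _ : Fin N => P.demoLaw h.castSucc T) :=
    measurePreserving_eval (fun h : Fin H => Measure.pi fun _ : Fin N => P.demoLaw h.castSucc T) h
  -- the event is not shown to be measurable, hence only an inequality
  refine (Measure.le_map_apply hmp.aemeasurable _).trans ?_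
  rw [hmp.map_eq]
  have := measure_exists_sum_inner_sq_deviation_le hn hP h.castSucc N T ⊤
  rwa [finrank_top, finrank_euclideanSpace_fin] at this

/-- Uniform control of the noise term over all tuples of coefficient matrices with rows in one
subspace spanned by `p` grid vectors. -/
def SourceNoise (P : Problem nx nu k H) {N T : ℕ} (p M : ℕ) (A : ℝ)
    (s : Fin H → Fin N → Traj nx nu T) : Prop :=
  ∀ (g : Fin p → Fin nx → Fin (2 * M + 1)) (G : Fin H → Matrix (Fin nu) (Fin nx) ℝ),
    (∀ h i, rowVec (G h) i ∈ Submodule.span ℝ (Set.range fun j => gridVec M (g j))) →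
    (∑ h, ∑ i, ∑ t, inner ℝ (resid (P.K h.castSucc) (s h i t))
      (toEuclideanLin (G h) (s h i t).1)) ^ 2 ≤ A * ∑ h, wsq (P.Sx h.castSucc) (G h)

/-- Union bound over the grid subspaces; each contributes the self-normalized bound with `H nu p`
coefficients. -/
theorem measure_not_sourceNoise_le (hP : P.Valid) {N T : ℕ} (hNT : 0 < (N * T : ℝ)) (p M : ℕ)
    {A : ℝ} :
    P.sourceLaw N T {s | P.SourceIsometry s ∧ ¬ P.SourceNoise p M A s}
      ≤ eexp (p * nx * Real.log (2 * M + 1) + H * nu * p * (Real.log 2 / 2)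
          - A / (8 * P.sigz ^ 2 * (N * T))) := by
  let R : (Fin p → Fin nx → Fin (2 * M + 1)) → Submodule ℝ (Vec nx) := fun g =>
    Submodule.span ℝ (Set.range fun j => gridVec M (g j))
  let bad : (Fin p → Fin nx → Fin (2 * M + 1)) → Set (Fin H → Fin N → Traj nx nu T) := fun g =>
    {s | (∀ h : Fin H, ∀ r ∈ R g, ∑ j : Fin N × Fin T, inner ℝ r (s h j.1 j.2).1 ^ 2
          ≤ 2 * (N * T) * qf (P.Sx h.castSucc) r) ∧
        ∃ G : Fin H → Matrix (Fin nu) (Fin nx) ℝ, (∀ h i, rowVec (G h) i ∈ R g) ∧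
          A * ∑ h, wsq (P.Sx h.castSucc) (G h)
            < (∑ h, ∑ j : Fin N × Fin T, inner ℝ (resid (P.K h.castSucc) (s h j.1 j.2))
              (toEuclideanLin (G h) (s h j.1 j.2).1)) ^ 2}
  have hsub : {s : Fin H → Fin N → Traj nx nu T | P.SourceIsometry s ∧ ¬ P.SourceNoise p M A s}
      ⊆ ⋃ g ∈ (Finset.univ : Finset (Fin p → Fin nx → Fin (2 * M + 1))), bad g := by
    rintro s ⟨hiso, hs⟩
    simp only [SourceNoise, not_forall, not_le] at hs
    obtain ⟨g, G, hG, hlt⟩ := hs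
    simp only [Set.mem_iUnion]
    refine ⟨g, Finset.mem_univ _, fun h r _ => ?_, G, hG, ?_⟩
    · have h1 := (abs_le.1 (hiso h r)).2
      have h2 := qf_nonneg (hP.posDef_Sx h.castSucc).posSemidef r
      rw [Fintype.sum_prod_type]
      nlinarith
    · simpa only [Fintype.sum_prod_type] using hlt
  have hbad : ∀ g, P.sourceLaw N T (bad g) ≤ eexp (H * nu * p * (Real.log 2 / 2)
      - A / (8 * P.sigz ^ 2 * (N * T))) := by
    intro g
    have hx : ∀ (h : Fin H) (j : Fin N × Fin T),
        Measurable fun s : Fin H → Fin N → Traj nx nu T => (s h j.1 j.2).1 := by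
      intro h j; fun_prop
    have hz : ∀ (h : Fin H) (j : Fin N × Fin T), Measurable
        fun s : Fin H → Fin N → Traj nx nu T => resid (P.K h.castSucc) (s h j.1 j.2) := by
      intro h j
      exact (measurable_resid _).comp (by fun_prop)
    refine (measure_exists_score_sq_gt_le (μ := P.sourceLaw N T) hx hz
      (S := fun h : Fin H => P.Sx h.castSucc) (fun h => hP.posDef_Sx h.castSucc) (R g)
      hP.sigz_pos hNT (fun G => ?_) A).trans (eexp_mono ?_)
    · simp only [Fintype.sum_prod_type]
      exact lintegral_eexp_score_sourceLaw_le N T G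
    · rw [Fintype.card_fin]
      have h1 : (Module.finrank ℝ (R g) : ℝ) ≤ p := by
        exact_mod_cast (finrank_range_le_card (R := ℝ) fun j => gridVec M (g j)).trans
          (Fintype.card_fin p).le
      have h2 : 0 ≤ Real.log 2 := Real.log_nonneg (by norm_num)
      gcongr
  refine (measure_mono hsub).trans ((measure_biUnion_finset_le _ _).trans
    ((Finset.sum_le_sum fun g _ => hbad g).trans (le_of_eq ?_)))
  have hcard : ((2 * M + 1 : ℕ) : ENNReal) = eexp (Real.log (2 * M + 1)) := by
    rw [eexp, Real.exp_log (by positivity), ← ENNReal.ofReal_natCast]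
    push_cast; rfl
  rw [Finset.sum_const, Finset.card_univ, nsmul_eq_mul]
  simp only [Fintype.card_fun, Fintype.card_fin]
  rw [← pow_mul, Nat.cast_pow, hcard, ← eexp_nsmul, ← eexp_add]
  congr 1
  push_cast
  ring

/-- The total energy of the actuator noise in the source data. -/
theorem measure_sum_resid_sq_gt_le (hP : P.Valid) (N T : ℕ) (Z : ℝ) :
    P.sourceLaw N T {s | Z < ∑ h, ∑ i, ∑ t, ‖resid (P.K h.castSucc) (s h i t)‖ ^ 2}
      ≤ eexp (H * (N * T) * nu * (Real.log 2 / 2) - Z / (4 * P.sigz ^ 2)) := by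
  have hs := hP.sigz_pos
  have hm1 : ∀ h : Fin H, Measurable fun e : Traj nx nu T =>
      ∑ t, 1 / (4 * P.sigz ^ 2) * ‖resid (P.K h.castSucc) (e t)‖ ^ 2 := fun h =>
    Finset.measurable_sum _ fun t _ =>
      ((measurable_demo_resid h.castSucc t).norm.pow_const 2).const_mul _
  have hm2 : ∀ h : Fin H, Measurable fun d : Fin N → Traj nx nu T =>
      ∑ i, ∑ t, 1 / (4 * P.sigz ^ 2) * ‖resid (P.K h.castSucc) (d i t)‖ ^ 2 := fun h =>
    Finset.measurable_sum _ fun i _ => (hm1 h).comp (measurable_pi_apply i)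
  have hm3 : Measurable fun s : Fin H → Fin N → Traj nx nu T =>
      ∑ h, ∑ i, ∑ t, 1 / (4 * P.sigz ^ 2) * ‖resid (P.K h.castSucc) (s h i t)‖ ^ 2 :=
    Finset.measurable_sum _ fun h _ => (hm2 h).comp (measurable_pi_apply h)
  have h1 : ∫⁻ s, eexp (∑ h, ∑ i, ∑ t,
      1 / (4 * P.sigz ^ 2) * ‖resid (P.K h.castSucc) (s h i t)‖ ^ 2) ∂(P.sourceLaw N T)
      ≤ eexp (H * (N * T) * nu * (Real.log 2 / 2)) := by
    simp only [eexp_sum (Finset.univ : Finset (Fin H))]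
    rw [sourceLaw, lintegral_pi_prod (fun h : Fin H => Measure.pi fun _ : Fin N =>
        P.demoLaw h.castSucc T) (f := fun h d => eexp (∑ i, ∑ t,
        1 / (4 * P.sigz ^ 2) * ‖resid (P.K h.castSucc) (d i t)‖ ^ 2)) fun h => (hm2 h).eexp]
    have h2 : ∀ h : Fin H, ∫⁻ d, eexp (∑ i, ∑ t,
        1 / (4 * P.sigz ^ 2) * ‖resid (P.K h.castSucc) (d i t)‖ ^ 2)
        ∂(Measure.pi fun _ : Fin N => P.demoLaw h.castSucc T)
        ≤ eexp (N * (T * (nu * (Real.log 2 / 2)))) := by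
      intro h
      simp only [eexp_sum (Finset.univ : Finset (Fin N))]
      rw [lintegral_pi_prod (fun _ : Fin N => P.demoLaw h.castSucc T) (f := fun _ e => eexp (∑ t,
        1 / (4 * P.sigz ^ 2) * ‖resid (P.K h.castSucc) (e t)‖ ^ 2)) fun _ => (hm1 h).eexp,
        eexp_nsmul]
      simp only [Finset.prod_const, Finset.card_univ, Fintype.card_fin]
      exact pow_le_pow_left' (lintegral_eexp_resid_sq_le hP h.castSucc T) N
    refine (Finset.prod_le_prod' fun h _ => h2 h).trans (le_of_eq ?_)
    rw [Finset.prod_const, Finset.card_univ, Fintype.card_fin, ← eexp_nsmul]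
    congr 1
    ring
  refine (measure_mono fun s hs' => ?_).trans
    (measure_le_of_lintegral_eexp_le hm3 h1 (Z / (4 * P.sigz ^ 2)))
  simp only [Set.mem_ofPred_eq, ← Finset.mul_sum] at hs' ⊢
  rw [one_div_mul_eq_div]
  gcongr

/-- Isometry and noise bound for the target data, on the space of matrices whose row space is
contained in the sum of those of `Φ` and of the true representation. -/
def TargetGood (P : Problem nx nu k H) {N T : ℕ} (A : ℝ) (Φ : Matrix (Fin k) (Fin nx) ℝ)
    (d : Fin N → Traj nx nu T) : Prop :=
  ∀ C C' : Matrix (Fin nu) (Fin k) ℝ,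
    |∑ i, ∑ t, ‖toEuclideanLin (C * Φ + C' * P.Phi) (d i t).1‖ ^ 2
        - N * T * wsq (P.Sx (Fin.last H)) (C * Φ + C' * P.Phi)|
      ≤ (N * T : ℝ) / 2 * wsq (P.Sx (Fin.last H)) (C * Φ + C' * P.Phi) ∧
    (∑ i, ∑ t, inner ℝ (resid (P.K (Fin.last H)) (d i t))
        (toEuclideanLin (C * Φ + C' * P.Phi) (d i t).1)) ^ 2
      ≤ A * wsq (P.Sx (Fin.last H)) (C * Φ + C' * P.Phi)

/-- For a fixed representation, the relevant matrices have their rows in a fixed subspace of dimension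
at most `2 k`. -/
theorem measure_not_targetGood_le (hn : 0 < nx) (hP : P.Valid) {N T : ℕ} (hNT : 0 < (N * T : ℝ))
    (A : ℝ) (Φ : Matrix (Fin k) (Fin nx) ℝ) :
    P.targetLaw N T {d | ¬ P.TargetGood A Φ d}
      ≤ eexp (2 * k * Real.log 5 + (Real.log 2 - N * T / (32768 * P.mixing (Fin.last H))))
        + eexp (nu * (2 * k) * (Real.log 2 / 2) - A / (8 * P.sigz ^ 2 * (N * T))) := by
  let R : Submodule ℝ (Vec nx) :=
    Submodule.span ℝ (Set.range (Sum.elim (rowVec Φ) (rowVec P.Phi)))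
  have hR : (Module.finrank ℝ R : ℝ) ≤ 2 * k := by
    have := finrank_range_le_card (R := ℝ) (Sum.elim (rowVec Φ) (rowVec P.Phi))
    rw [Fintype.card_sum, Fintype.card_fin] at this
    have h2 : Module.finrank ℝ R ≤ 2 * k := this.trans (by omega)
    exact_mod_cast h2
  have hrow : ∀ (C C' : Matrix (Fin nu) (Fin k) ℝ) i, rowVec (C * Φ + C' * P.Phi) i ∈ R := by
    intro C C' i
    have : rowVec (C * Φ + C' * P.Phi) i = rowVec (C * Φ) i + rowVec (C' * P.Phi) i := by
      ext l; simp [rowVec]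
    rw [this, rowVec_mul, rowVec_mul]
    refine R.add_mem (R.sum_mem fun j _ => R.smul_mem _ (Submodule.subset_span ⟨Sum.inl j, rfl⟩))
      (R.sum_mem fun j _ => R.smul_mem _ (Submodule.subset_span ⟨Sum.inr j, rfl⟩))
  set E1 : Set (Fin N → Traj nx nu T) := {e | ∃ r ∈ R, (N * T : ℝ) / 2
    * qf (P.Sx (Fin.last H)) r < |∑ i, ∑ t, inner ℝ r (e i t).1 ^ 2
      - N * T * qf (P.Sx (Fin.last H)) r|} with hE1
  set E2 : Set (Fin N → Traj nx nu T) := {d | (∀ _ : Unit, ∀ r ∈ R, ∑ j : Fin N × Fin T,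
      inner ℝ r (d j.1 j.2).1 ^ 2 ≤ 2 * (N * T) * qf (P.Sx (Fin.last H)) r) ∧
    ∃ G : Unit → Matrix (Fin nu) (Fin nx) ℝ, (∀ a i, rowVec (G a) i ∈ R) ∧
      A * ∑ a, wsq (P.Sx (Fin.last H)) (G a)
        < (∑ a, ∑ j : Fin N × Fin T, inner ℝ (resid (P.K (Fin.last H)) (d j.1 j.2))
          (toEuclideanLin (G a) (d j.1 j.2).1)) ^ 2} with hE2
  have hsub : {d : Fin N → Traj nx nu T | ¬ P.TargetGood A Φ d} ⊆ E1 ∪ E2 := by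
    intro d hd
    by_contra hcon
    rw [Set.mem_union, not_or] at hcon
    obtain ⟨h1, h2⟩ := hcon
    simp only [hE1, Set.mem_ofPred_eq, not_exists, not_and, not_lt] at h1
    refine hd fun C C' => ⟨abs_sum_norm_sq_toEuclideanLin_sub_le fun l => h1 _ (hrow C C' l), ?_⟩
    · by_contra! hlt
      refine h2 ⟨fun _ r hr => ?_, fun _ => C * Φ + C' * P.Phi, fun _ => hrow C C', ?_⟩
      · have h3 := (abs_le.1 (h1 r hr)).2
        have h4 := qf_nonneg (hP.posDef_Sx (Fin.last H)).posSemidef r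
        rw [Fintype.sum_prod_type]
        nlinarith
      · simpa [Fintype.sum_prod_type] using hlt
  refine (measure_mono hsub).trans ((measure_union_le _ _).trans (add_le_add ?_ ?_))
  · refine (measure_exists_sum_inner_sq_deviation_le hn hP (Fin.last H) N T R).trans
      (eexp_mono ?_)
    have : 0 ≤ Real.log 5 := Real.log_nonneg (by norm_num)
    gcongr
  · have hx : ∀ (_ : Unit) (j : Fin N × Fin T),
        Measurable fun d : Fin N → Traj nx nu T => (d j.1 j.2).1 := by
      intro _ j; fun_prop
    have hz : ∀ (_ : Unit) (j : Fin N × Fin T), Measurable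
        fun d : Fin N → Traj nx nu T => resid (P.K (Fin.last H)) (d j.1 j.2) := by
      intro _ j
      exact (measurable_resid _).comp (by fun_prop)
    refine (measure_exists_score_sq_gt_le (μ := P.targetLaw N T) hx hz
      (S := fun _ : Unit => P.Sx (Fin.last H)) (fun _ => hP.posDef_Sx (Fin.last H)) R
      hP.sigz_pos hNT (fun G => ?_) A).trans (eexp_mono ?_)
    · simp only [Fintype.sum_prod_type, Finset.univ_unique, Finset.sum_singleton]
      exact lintegral_eexp_score_pi_le (Fin.last H) N T (G _)
    · have : 0 ≤ Real.log 2 := Real.log_nonneg (by norm_num)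
      simp only [Fintype.card_unit, Nat.cast_one, one_mul]
      gcongr

/-- The good event for the target data is closed jointly in the representation and the data, hence
measurable. -/
theorem isClosed_targetGood {N T : ℕ} (A : ℝ) :
    IsClosed {p : (Fin k → Fin nx → ℝ) × (Fin N → Traj nx nu T) |
      P.TargetGood A (Matrix.of p.1) p.2} := by
  simp only [TargetGood, Set.ofPred_forall, Set.ofPred_and]
  refine isClosed_iInter fun C => isClosed_iInter fun C' => ?_
  have hG : ∀ a b, Continuous fun p : (Fin k → Fin nx → ℝ) × (Fin N → Traj nx nu T) => (C * Matrix.of p.1 + C' * P.Phi) a b := by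
    intro a b
    simp only [Matrix.add_apply, Matrix.mul_apply, Matrix.of_apply]
    fun_prop
  have hL : ∀ i t, Continuous fun p : (Fin k → Fin nx → ℝ) × (Fin N → Traj nx nu T) =>
      toEuclideanLin (C * Matrix.of p.1 + C' * P.Phi) (p.2 i t).1 := by
    intro i t
    refine (PiLp.continuous_toLp 2 _).comp (continuous_pi fun a => ?_)
    have h1 : Continuous fun p : (Fin k → Fin nx → ℝ) × (Fin N → Traj nx nu T) =>
        ∑ b, (C * Matrix.of p.1 + C' * P.Phi) a b * (p.2 i t).1 b :=
      continuous_finsetSum _ fun b _ => (hG a b).mul (by fun_prop)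
    exact h1
  have hR : ∀ i t, Continuous fun p : (Fin k → Fin nx → ℝ) × (Fin N → Traj nx nu T) => resid (P.K (Fin.last H)) (p.2 i t) := by
    intro i t
    unfold resid
    exact Continuous.sub (by fun_prop) ((LinearMap.continuous_of_finiteDimensional _).comp
      (by fun_prop))
  have hW : Continuous fun p : (Fin k → Fin nx → ℝ) × (Fin N → Traj nx nu T) =>
      wsq (P.Sx (Fin.last H)) (C * Matrix.of p.1 + C' * P.Phi) := by
    have hr : ∀ a, Continuous fun p : (Fin k → Fin nx → ℝ) × (Fin N → Traj nx nu T) => rowVec (C * Matrix.of p.1 + C' * P.Phi) a := fun a =>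
      (PiLp.continuous_toLp 2 _).comp (continuous_pi fun b => hG a b)
    unfold wsq qf
    exact continuous_finsetSum _ fun a _ => (hr a).inner
      ((LinearMap.continuous_of_finiteDimensional _).comp (hr a))
  refine IsClosed.inter (isClosed_le ?_ (hW.const_mul _)) (isClosed_le ?_ (hW.const_mul _))
  · exact ((continuous_finsetSum _ fun i _ => continuous_finsetSum _ fun t _ =>
      (hL i t).norm.pow 2).sub (hW.const_mul _)).abs
  · exact (continuous_finsetSum _ fun i _ => continuous_finsetSum _ fun t _ =>
      (hR i t).inner (hL i t)).pow 2

end Problem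


/-! ### Empirical risk minimization on the good events -/

theorem sq_sum_inner_le {E J : Type*} [NormedAddCommGroup E] [InnerProductSpace ℝ E] [Fintype J]
    (u v : J → E) : (∑ j, inner ℝ (u j) (v j)) ^ 2 ≤ (∑ j, ‖u j‖ ^ 2) * ∑ j, ‖v j‖ ^ 2 := by
  have h1 : |∑ j, inner ℝ (u j) (v j)| ≤ ∑ j, ‖u j‖ * ‖v j‖ :=
    (Finset.abs_sum_le_sum_abs _ _).trans
      (Finset.sum_le_sum fun j _ => abs_real_inner_le_norm _ _)
  rw [← sq_abs]
  exact (pow_le_pow_left₀ (abs_nonneg _) h1 2).trans (Finset.sum_mul_sq_le_sq_mul_sq _ _ _)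

/-- Solution of the basic inequality, with the noise term split into a main part `a` and a
remainder `b`. -/
theorem sq_mul_le_of_mul_le {n W a b A B : ℝ} (hn : 0 ≤ n) (hW : 0 < W) (ha : a ^ 2 ≤ 4 * A * W)
    (hb : b ^ 2 ≤ 3 / 2 * B * W) (h : n / 2 * W ≤ 2 * (a + b)) :
    n ^ 2 * W ≤ 128 * A + 48 * B := by
  have h1 : (n / 2 * W) ^ 2 ≤ (2 * (a + b)) ^ 2 := pow_le_pow_left₀ (by positivity) h 2
  have h2 : (2 * (a + b)) ^ 2 ≤ 8 * (a ^ 2 + b ^ 2) := by nlinarith [sq_nonneg (a - b)]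
  refine le_of_mul_le_mul_right ?_ hW
  have h3 : n ^ 2 * W * W = 4 * (n / 2 * W) ^ 2 := by ring
  rw [h3]
  linarith

theorem wsq_neg {n m : ℕ} (S : Matrix (Fin n) (Fin n) ℝ) (D : Matrix (Fin m) (Fin n) ℝ) :
    wsq S (-D) = wsq S D := by
  refine Finset.sum_congr rfl fun i _ => ?_
  have h : rowVec (-D) i = -rowVec D i := rfl
  rw [h, qf, qf, map_neg, inner_neg_neg]

namespace Problem

variable {nx nu k H : ℕ} {P : Problem nx nu k H}

theorem sqLoss_eq {nx nu T N : ℕ} (K G : Matrix (Fin nu) (Fin nx) ℝ) (d : Fin N → Traj nx nu T) :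
    sqLoss G d = ∑ i, ∑ t, ‖toEuclideanLin (G - K) (d i t).1‖ ^ 2
      - 2 * ∑ i, ∑ t, inner ℝ (resid K (d i t)) (toEuclideanLin (G - K) (d i t).1)
      + ∑ i, ∑ t, ‖resid K (d i t)‖ ^ 2 := by
  simp only [sqLoss, Finset.mul_sum, ← Finset.sum_sub_distrib, ← Finset.sum_add_distrib]
  refine Finset.sum_congr rfl fun i _ => Finset.sum_congr rfl fun t _ => ?_
  have h : toEuclideanLin G (d i t).1 - (d i t).2
      = toEuclideanLin (G - K) (d i t).1 - resid K (d i t) := by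
    rw [map_sub, LinearMap.sub_apply, resid]; abel
  rw [h, norm_sub_sq_real, real_inner_comm]

theorem lamUnder_le (h : Fin H) : P.lamUnder ≤ lamMin (P.Sx h.castSucc) :=
  ciInf_le (Set.finite_range _).bddBelow h

theorem le_lamBar (h : Fin H) : lamMax (P.Sx h.castSucc) ≤ P.lamBar :=
  le_ciSup (f := fun h : Fin H => lamMax (P.Sx h.castSucc)) (Set.finite_range _).bddAbove h

theorem coverage_le (h : Fin H) : P.coverage ≤ lamMin (invSqrt (P.Sx (Fin.last H))
    * P.Sx h.castSucc * invSqrt (P.Sx (Fin.last H))) :=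
  ciInf_le (Set.finite_range _).bddBelow h

theorem lamUnder_pos (hn : 0 < nx) (hH : 0 < H) (hP : P.Valid) : 0 < P.lamUnder := by
  have : Nonempty (Fin H) := ⟨⟨0, hH⟩⟩
  obtain ⟨h, hh⟩ := exists_eq_ciInf_of_finite (f := fun h : Fin H => lamMin (P.Sx h.castSucc))
  rw [lamUnder, ← hh]
  exact lamMin_pos hn (hP.posDef_Sx _)

theorem coverage_pos (hn : 0 < nx) (hH : 0 < H) (hP : P.Valid) : 0 < P.coverage := by
  have : Nonempty (Fin H) := ⟨⟨0, hH⟩⟩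
  obtain ⟨h, hh⟩ := exists_eq_ciInf_of_finite (f := fun h : Fin H => lamMin (invSqrt
    (P.Sx (Fin.last H)) * P.Sx h.castSucc * invSqrt (P.Sx (Fin.last H))))
  rw [coverage, ← hh]
  exact lamMin_whitened_pos hn (hP.posDef_Sx _) (hP.posDef_Sx _)

theorem lamUnder_le_lamBar (hn : 0 < nx) (hH : 0 < H) (hP : P.Valid) : P.lamUnder ≤ P.lamBar :=
  (lamUnder_le ⟨0, hH⟩).trans ((lamMin_le_lamMax hn (hP.posDef_Sx _).isHermitian).trans
    (le_lamBar ⟨0, hH⟩))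

/-- Sum over the source tasks of the population prediction errors of the gains `F h * Φ`. -/
noncomputable def sourceError (P : Problem nx nu k H) (Φ : Matrix (Fin k) (Fin nx) ℝ)
    (F : Fin H → Matrix (Fin nu) (Fin k) ℝ) : ℝ :=
  ∑ h : Fin H, wsq (P.Sx h.castSucc) (F h * Φ - P.K h.castSucc)

theorem sourceError_nonneg (hP : P.Valid) (Φ : Matrix (Fin k) (Fin nx) ℝ)
    (F : Fin H → Matrix (Fin nu) (Fin k) ℝ) : 0 ≤ P.sourceError Φ F :=
  Finset.sum_nonneg fun h _ => wsq_nonneg (hP.posDef_Sx h.castSucc).posSemidef _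

/-- Error of the pre-trained gains. The rows of all error matrices lie in the sum of two row spaces
of dimension at most `k`; they are replaced by their approximations in a grid subspace, to which the
uniform noise bound applies, and the remainder is controlled by Cauchy-Schwarz. -/
theorem sourceError_le (hn : 0 < nx) (hH : 0 < H) (hP : P.Valid) {N T M : ℕ} (hM : 0 < M)
    (hNT : 0 < (N * T : ℝ)) {A Z ρ : ℝ} (hA : 0 ≤ A)
    (hρ : P.lamBar / P.lamUnder * (2 * k * nx / M ^ 2) ≤ ρ) (hρ1 : ρ ≤ 1)
    {s : Fin H → Fin N → Traj nx nu T} (hiso : P.SourceIsometry s)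
    (hnoise : P.SourceNoise (2 * k) M A s)
    (hZ : ∑ h, ∑ i, ∑ t, ‖resid (P.K h.castSucc) (s h i t)‖ ^ 2 ≤ Z)
    {Φ : Matrix (Fin k) (Fin nx) ℝ} {F : Fin H → Matrix (Fin nu) (Fin k) ℝ}
    (hERM : IsPretrained s Φ F) :
    (N * T : ℝ) ^ 2 * P.sourceError Φ F ≤ 128 * A + 48 * Z * (N * T) * ρ := by
  set Δ : Fin H → Matrix (Fin nu) (Fin nx) ℝ := fun h => F h * Φ - P.K h.castSucc with hΔ
  set W := P.sourceError Φ F with hW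
  have hWΔ : W = ∑ h, wsq (P.Sx h.castSucc) (Δ h) := rfl
  have hW0 : 0 ≤ W := sourceError_nonneg hP Φ F
  have hlu := lamUnder_pos hn hH hP
  have hlb : 0 < P.lamBar := hlu.trans_le (lamUnder_le_lamBar hn hH hP)
  have hen : ∀ G : Fin H → Matrix (Fin nu) (Fin nx) ℝ,
      |∑ h, ∑ i, ∑ t, ‖toEuclideanLin (G h) (s h i t).1‖ ^ 2
        - N * T * ∑ h, wsq (P.Sx h.castSucc) (G h)|
      ≤ (N * T : ℝ) / 2 * ∑ h, wsq (P.Sx h.castSucc) (G h) := by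
    intro G
    rw [Finset.mul_sum, Finset.mul_sum, ← Finset.sum_sub_distrib]
    exact (Finset.abs_sum_le_sum_abs _ _).trans (Finset.sum_le_sum fun h _ =>
      abs_sum_norm_sq_toEuclideanLin_sub_le fun l => hiso h _)
  -- basic inequality of the least squares estimator, compared with the true gains
  have hbasic : ∑ h, ∑ i, ∑ t, ‖toEuclideanLin (Δ h) (s h i t).1‖ ^ 2
      ≤ 2 * ∑ h, ∑ i, ∑ t, inner ℝ (resid (P.K h.castSucc) (s h i t))
        (toEuclideanLin (Δ h) (s h i t).1) := by
    have h1 := hERM P.Phi fun h => P.F h.castSucc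
    have h2 : ∀ h : Fin H, sqLoss (P.F h.castSucc * P.Phi) (s h)
        = ∑ i, ∑ t, ‖resid (P.K h.castSucc) (s h i t)‖ ^ 2 := by
      intro h
      rw [sqLoss_eq (P.K h.castSucc)]
      simp [Problem.K]
    simp only [h2, fun h => sqLoss_eq (P.K h.castSucc) (F h * Φ) (s h)] at h1
    rw [Finset.sum_add_distrib, Finset.sum_sub_distrib, ← Finset.mul_sum] at h1
    linarith
  -- approximation of the error matrices by matrices with rows in a grid subspace
  let R : Submodule ℝ (Vec nx) :=
    Submodule.span ℝ (Set.range (Sum.elim (rowVec Φ) (rowVec P.Phi)))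
  have hR : Module.finrank ℝ R ≤ 2 * k := by
    have := finrank_range_le_card (R := ℝ) (Sum.elim (rowVec Φ) (rowVec P.Phi))
    rw [Fintype.card_sum, Fintype.card_fin] at this
    exact this.trans (by omega)
  have hrow : ∀ h i, rowVec (Δ h) i ∈ R := by
    intro h i
    rw [hΔ, rowVec_sub, Problem.K, rowVec_mul, rowVec_mul]
    refine R.sub_mem (R.sum_mem fun j _ => R.smul_mem _ (Submodule.subset_span ⟨Sum.inl j, rfl⟩))
      (R.sum_mem fun j _ => R.smul_mem _ (Submodule.subset_span ⟨Sum.inr j, rfl⟩))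
  obtain ⟨g, hg⟩ := exists_grid_approx hM hR
  choose r' hr'mem hr' using fun h i => hg _ (hrow h i)
  let G : Fin H → Matrix (Fin nu) (Fin nx) ℝ := fun h => Matrix.of fun i l => r' h i l
  have hGrow : ∀ h i, rowVec (G h) i = r' h i := fun _ _ => rfl
  have hWr : ∑ h, wsq (P.Sx h.castSucc) (Δ h - G h) ≤ ρ * W := by
    rw [hWΔ, Finset.mul_sum]
    refine Finset.sum_le_sum fun h _ => ?_
    rw [wsq, wsq, Finset.mul_sum]
    refine Finset.sum_le_sum fun i _ => ?_
    rw [rowVec_sub, hGrow]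
    have hS := hP.posDef_Sx h.castSucc
    have h1 := qf_le_lamMax_mul hS.isHermitian (rowVec (Δ h) i - r' h i)
    have h2 := lamMin_mul_le_qf hS.isHermitian (rowVec (Δ h) i)
    have h3 := hr' h i
    push_cast at h3
    calc qf (P.Sx h.castSucc) (rowVec (Δ h) i - r' h i)
        ≤ P.lamBar * ‖rowVec (Δ h) i - r' h i‖ ^ 2 :=
          h1.trans (mul_le_mul_of_nonneg_right (le_lamBar h) (sq_nonneg _))
      _ ≤ P.lamBar * (2 * k * nx / M ^ 2 * ‖rowVec (Δ h) i‖ ^ 2) :=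
          mul_le_mul_of_nonneg_left h3 hlb.le
      _ = P.lamBar / P.lamUnder * (2 * k * nx / M ^ 2)
          * (P.lamUnder * ‖rowVec (Δ h) i‖ ^ 2) := by field_simp
      _ ≤ ρ * (P.lamUnder * ‖rowVec (Δ h) i‖ ^ 2) :=
          mul_le_mul_of_nonneg_right hρ (by positivity)
      _ ≤ ρ * qf (P.Sx h.castSucc) (rowVec (Δ h) i) := by
          refine mul_le_mul_of_nonneg_left ?_ (le_trans (by positivity) hρ)
          exact (mul_le_mul_of_nonneg_right (lamUnder_le h) (sq_nonneg _)).trans h2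
  have hWr0 : 0 ≤ ∑ h, wsq (P.Sx h.castSucc) (Δ h - G h) :=
    Finset.sum_nonneg fun h _ => wsq_nonneg (hP.posDef_Sx h.castSucc).posSemidef _
  have hWG : ∑ h, wsq (P.Sx h.castSucc) (G h) ≤ 4 * W := by
    have h1 : ∑ h, wsq (P.Sx h.castSucc) (G h)
        ≤ 2 * W + 2 * ∑ h, wsq (P.Sx h.castSucc) (Δ h - G h) := by
      rw [hWΔ, Finset.mul_sum, Finset.mul_sum, ← Finset.sum_add_distrib]
      refine Finset.sum_le_sum fun h _ => ?_
      have := wsq_sub_le (hP.posDef_Sx h.castSucc).posSemidef (Δ h) (Δ h - G h)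
      rwa [sub_sub_cancel] at this
    nlinarith
  set a := ∑ h, ∑ i, ∑ t, inner ℝ (resid (P.K h.castSucc) (s h i t))
    (toEuclideanLin (G h) (s h i t).1) with ha
  set b := ∑ h, ∑ i, ∑ t, inner ℝ (resid (P.K h.castSucc) (s h i t))
    (toEuclideanLin (Δ h - G h) (s h i t).1) with hb
  have hab : ∑ h, ∑ i, ∑ t, inner ℝ (resid (P.K h.castSucc) (s h i t))
      (toEuclideanLin (Δ h) (s h i t).1) = a + b := by
    simp only [ha, hb, ← Finset.sum_add_distrib]
    refine Finset.sum_congr rfl fun h _ => Finset.sum_congr rfl fun i _ =>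
      Finset.sum_congr rfl fun t _ => ?_
    rw [← inner_add_right, ← LinearMap.add_apply, ← map_add, add_sub_cancel]
  have ha2 : a ^ 2 ≤ 4 * A * W := by
    have := hnoise g G fun h i => by rw [hGrow]; exact hr'mem h i
    nlinarith
  have hb2 : b ^ 2 ≤ 3 / 2 * Z * (N * T) * ρ * W := by
    have h1 := sq_sum_inner_le (J := Fin H × Fin N × Fin T)
      (fun p => resid (P.K p.1.castSucc) (s p.1 p.2.1 p.2.2))
      (fun p => toEuclideanLin (Δ p.1 - G p.1) (s p.1 p.2.1 p.2.2).1)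
    simp only [Fintype.sum_prod_type] at h1
    have h2 := (abs_le.1 (hen fun h => Δ h - G h)).2
    have hZ0 : 0 ≤ ∑ h, ∑ i, ∑ t, ‖resid (P.K h.castSucc) (s h i t)‖ ^ 2 := by positivity
    have h4 : ∑ h, ∑ i, ∑ t, ‖toEuclideanLin (Δ h - G h) (s h i t).1‖ ^ 2
        ≤ 3 / 2 * (N * T) * (ρ * W) := by nlinarith
    refine h1.trans ((mul_le_mul hZ h4 (by positivity) (hZ0.trans hZ)).trans (le_of_eq ?_))
    ring
  have hmain : (N * T : ℝ) / 2 * W ≤ 2 * (a + b) := by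
    have h1 := (abs_le.1 (hen Δ)).1
    rw [← hWΔ] at h1
    rw [← hab]
    linarith
  rcases hW0.eq_or_lt with hW1 | hW1
  · have hZ0 : 0 ≤ Z := le_trans (by positivity) hZ
    have hρ0 : 0 ≤ ρ := le_trans (by positivity) hρ
    rw [← hW1, mul_zero]
    positivity
  · have hb3 : b ^ 2 ≤ 3 / 2 * (Z * (N * T) * ρ) * W := hb2.trans (le_of_eq (by ring))
    refine (sq_mul_le_of_mul_le hNT.le hW1 ha2 hb3 hmain).trans (le_of_eq (by ring))

/-- Transfer to the target task: some head on top of the pre-trained representation has a small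
error, because the target weights are combinations of the source weights. -/
theorem exists_wsq_mul_sub_le {D : ℝ} (hn : 0 < nx) (hH : 0 < H) (hP : P.Valid)
    (hD : P.DiverseSources D) (Φ : Matrix (Fin k) (Fin nx) ℝ)
    (F : Fin H → Matrix (Fin nu) (Fin k) ℝ) :
    ∃ F' : Matrix (Fin nu) (Fin k) ℝ, wsq (P.Sx (Fin.last H)) (F' * Φ - P.K (Fin.last H))
      ≤ D / (H * P.coverage) * P.sourceError Φ F := by
  obtain ⟨h1, h2⟩ := hD
  set L := P.F (Fin.last H) * pinv P.stackedF with hL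
  let Fs : Matrix (Fin H × Fin nu) (Fin k) ℝ := Matrix.of fun p j => F p.1 p.2 j
  have hS := (hP.posDef_Sx (Fin.last H))
  have hc := coverage_pos hn hH hP
  have hH' : (0 : ℝ) < H := by exact_mod_cast hH
  refine ⟨L * Fs, ?_⟩
  have h3 : L * Fs * Φ - P.K (Fin.last H) = L * (Fs * Φ - P.stackedF * P.Phi) := by
    rw [Matrix.mul_sub, ← Matrix.mul_assoc, ← Matrix.mul_assoc, h1, Problem.K]
  have hrow : ∀ p : Fin H × Fin nu, rowVec (Fs * Φ - P.stackedF * P.Phi) p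
      = rowVec (F p.1 * Φ - P.K p.1.castSucc) p.2 := fun p => rfl
  have h4 : ∑ p, qf (P.Sx (Fin.last H)) (rowVec (Fs * Φ - P.stackedF * P.Phi) p)
      ≤ P.sourceError Φ F / P.coverage := by
    rw [le_div_iff₀ hc, mul_comm, Finset.mul_sum, Fintype.sum_prod_type, sourceError]
    refine Finset.sum_le_sum fun h _ => Finset.sum_le_sum fun i _ => ?_
    rw [hrow]
    exact (mul_le_mul_of_nonneg_right (coverage_le h) (qf_nonneg hS.posSemidef _)).trans
      (lamMin_whitened_mul_le hS (hP.posDef_Sx _).isHermitian _)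
  have h5 : 0 ≤ P.sourceError Φ F / P.coverage :=
    div_nonneg (sourceError_nonneg hP Φ F) hc.le
  rw [h3]
  refine (wsq_mul_le hS.posSemidef _ _).trans
    ((mul_le_mul_of_nonneg_left h4 (sq_nonneg _)).trans
    ((mul_le_mul_of_nonneg_right h2 h5).trans (le_of_eq ?_)))
  field_simp

/-- Error of the learned target gain in terms of that of the best gain with the same
representation. -/
theorem wsq_target_le (hP : P.Valid) {N T : ℕ} (hNT : 0 < (N * T : ℝ)) {A : ℝ} (hA : 0 ≤ A)
    {Φ : Matrix (Fin k) (Fin nx) ℝ} {d : Fin N → Traj nx nu T} (hgood : P.TargetGood A Φ d)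
    {F : Matrix (Fin nu) (Fin k) ℝ} (hERM : IsTargetTrained d Φ F)
    (F' : Matrix (Fin nu) (Fin k) ℝ) :
    wsq (P.Sx (Fin.last H)) (F * Φ - P.K (Fin.last H))
      ≤ 5 * wsq (P.Sx (Fin.last H)) (F' * Φ - P.K (Fin.last H)) + 43 * (A / (N * T) ^ 2) := by
  have hS := (hP.posDef_Sx (Fin.last H)).posSemidef
  have hform : ∀ E : Matrix (Fin nu) (Fin k) ℝ,
      E * Φ - P.K (Fin.last H) = E * Φ + (-P.F (Fin.last H)) * P.Phi := by
    intro E; rw [Matrix.neg_mul, ← sub_eq_add_neg]; rfl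
  have hF := (abs_le.1 (hgood F (-P.F (Fin.last H))).1).1
  have hF' := (abs_le.1 (hgood F' (-P.F (Fin.last H))).1).2
  have hdiff := (hgood (F - F') 0).2
  have e1 : (F - F') * Φ + (0 : Matrix (Fin nu) (Fin k) ℝ) * P.Phi
      = (F * Φ - P.K (Fin.last H)) - (F' * Φ - P.K (Fin.last H)) := by
    rw [Matrix.zero_mul, add_zero, Matrix.sub_mul]; abel
  rw [e1] at hdiff
  rw [← hform] at hF hF'
  have hERM' := hERM F'
  rw [sqLoss_eq (P.K (Fin.last H)) (F * Φ), sqLoss_eq (P.K (Fin.last H)) (F' * Φ)] at hERM'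
  set X := F * Φ - P.K (Fin.last H)
  set Y := F' * Φ - P.K (Fin.last H)
  set w := wsq (P.Sx (Fin.last H)) X
  set w' := wsq (P.Sx (Fin.last H)) Y
  have hw : 0 ≤ w := wsq_nonneg hS _
  have hw' : 0 ≤ w' := wsq_nonneg hS _
  have hsub := wsq_sub_le hS X Y
  set b := ∑ i, ∑ t, inner ℝ (resid (P.K (Fin.last H)) (d i t)) (toEuclideanLin (X - Y) (d i t).1)
    with hb
  have hb' : b = ∑ i, ∑ t, inner ℝ (resid (P.K (Fin.last H)) (d i t)) (toEuclideanLin X (d i t).1)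
      - ∑ i, ∑ t, inner ℝ (resid (P.K (Fin.last H)) (d i t)) (toEuclideanLin Y (d i t).1) := by
    simp only [hb, ← Finset.sum_sub_distrib]
    refine Finset.sum_congr rfl fun i _ => Finset.sum_congr rfl fun t _ => ?_
    rw [← inner_sub_right, map_sub, LinearMap.sub_apply]
  have hb2 : b ^ 2 ≤ 2 * A * (w + w') := by nlinarith
  set n := (N * T : ℝ)
  -- weighted arithmetic-geometric mean inequality
  have hamgm : 2 * b ≤ n / 8 * (w + w') + 16 * (A / n) := by
    have h1 : 0 ≤ n / 8 * (w + w') := by positivity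
    have h2 : 0 ≤ 16 * (A / n) := by positivity
    refine abs_le_of_sq_le_sq' (b := n / 8 * (w + w') + 16 * (A / n)) ?_ (by linarith) |>.2
    have h3 : (n / 8 * (w + w')) * (16 * (A / n)) = 2 * A * (w + w') := by field_simp; ring
    nlinarith [sq_nonneg (n / 8 * (w + w') - 16 * (A / n))]
  have hfin : n * (3 / 8 * w) ≤ n * (13 / 8 * w' + 16 * (A / n ^ 2)) := by
    have e2 : n * (13 / 8 * w' + 16 * (A / n ^ 2)) = 13 / 8 * n * w' + 16 * (A / n) := by
      field_simp
    rw [e2]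
    linarith
  have hfin' := le_of_mul_le_mul_left hfin hNT
  have : 0 ≤ A / n ^ 2 := by positivity
  linarith

theorem excessRisk_eq (hP : P.Valid) {T : ℕ} (hT : 0 < T) (Khat : Matrix (Fin nu) (Fin nx) ℝ) :
    P.excessRisk T Khat = wsq (P.Sx (Fin.last H)) (Khat - P.K (Fin.last H)) / 2 := by
  have hT' : (0 : ℝ) < T := by exact_mod_cast hT
  set D := P.K (Fin.last H) - Khat with hD
  have hint : ∀ (t : Fin T) i, Integrable (fun ω : Noise nx nu T =>
      inner ℝ (rowVec D i) (P.expertState (Fin.last H) ω t) ^ 2) (P.noiseLaw (Fin.last H) T) := by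
    intro t i
    simp only [sq]
    exact integrable_mul_of_isLinearMap _ (isLinearMap_inner_state _ t _)
      (isLinearMap_inner_state _ t _)
  have hval : ∀ (t : Fin T) i, ∫ ω : Noise nx nu T,
      inner ℝ (rowVec D i) (P.expertState (Fin.last H) ω t) ^ 2 ∂(P.noiseLaw (Fin.last H) T)
      = qf (P.Sx (Fin.last H)) (rowVec D i) := by
    intro t i
    have := integral_state_mul_state hP (Fin.last H) (T := T) (s := t) 0 (by omega)
      (rowVec D i) (rowVec D i)
    simp only [sq]
    rw [add_zero, pow_zero, Matrix.one_mul] at this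
    exact this
  rw [excessRisk]
  simp only [norm_sq_toEuclideanLin]
  rw [integral_finsetSum _ fun t _ => integrable_finsetSum _ fun i _ => hint t i]
  have h1 : ∀ t : Fin T, ∫ ω : Noise nx nu T, ∑ i, inner ℝ (rowVec D i)
      (P.expertState (Fin.last H) ω t) ^ 2 ∂(P.noiseLaw (Fin.last H) T)
      = wsq (P.Sx (Fin.last H)) D := by
    intro t
    rw [integral_finsetSum _ fun i _ => hint t i, wsq]
    exact Finset.sum_congr rfl fun i _ => hval t i
  rw [Finset.sum_congr rfl fun t _ => h1 t, Finset.sum_const, Finset.card_univ, Fintype.card_fin,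
    nsmul_eq_mul, ← wsq_neg, hD, neg_sub]
  field_simp

end Problem


/-! ### Perturbation of the closed loop and of the LQR cost -/

section Coupling

variable {nx nu T : ℕ}

theorem norm_le_of_linear_recursion {M : Matrix (Fin nx) (Fin nx) ℝ} (hM : IsSchurStable M)
    {e d : ℕ → Vec nx} (h0 : e 0 = 0) {T : ℕ}
    (hs : ∀ t < T, e (t + 1) = toEuclideanLin M (e t) + d t) {a : ℝ} :
    ∀ t ≤ T, (∀ s < t, ‖d s‖ ≤ a) → 0 ≤ a → ‖e t‖ ≤ calJ M * a := by
  have hform : ∀ t ≤ T, e t = ∑ i ∈ Finset.range t, toEuclideanLin (M ^ i) (d (t - 1 - i)) := by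
    intro t
    induction t with
    | zero => intro _; simpa using h0
    | succ t ih =>
      intro ht
      rw [hs t (by omega), ih (by omega), Finset.sum_range_succ', map_sum, pow_zero,
        toEuclideanLin_one]
      congr 1
      refine Finset.sum_congr rfl fun i hi => ?_
      rw [← toEuclideanLin_mul, ← pow_succ']
      congr 2
      omega
  intro t ht hd ha
  rw [hform t ht]
  calc ‖∑ i ∈ Finset.range t, toEuclideanLin (M ^ i) (d (t - 1 - i))‖
      ≤ ∑ i ∈ Finset.range t, ‖M ^ i‖ * a := by
        refine (norm_sum_le _ _).trans (Finset.sum_le_sum fun i hi => ?_)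
        have := Finset.mem_range.1 hi
        exact (norm_toEuclideanLin_le _ _).trans
          (mul_le_mul_of_nonneg_left (hd _ (by omega)) (norm_nonneg _))
    _ ≤ calJ M * a := by
        rw [← Finset.sum_mul]
        exact mul_le_mul_of_nonneg_right (hM.sum_le_calJ _) ha

/-- Two closed loops driven by the same noise stay close, relative to the prediction error along
the first one, when the gain perturbation is small compared with the stability margin. -/
theorem norm_state_sub_le {A : Matrix (Fin nx) (Fin nx) ℝ} {B : Matrix (Fin nx) (Fin nu) ℝ}
    {K K' : Matrix (Fin nu) (Fin nx) ℝ} (hM : IsSchurStable (A + B * K))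
    (hb : calJ (A + B * K) * ‖B‖ * ‖K' - K‖ ≤ 1 / 2) (ω : Noise nx nu T) {m : ℝ} (hm : 0 ≤ m)
    (hΔ : ∀ t < T, ‖toEuclideanLin (K' - K) (state A B K ω t)‖ ≤ m) :
    ∀ t ≤ T, ‖state A B K' ω t - state A B K ω t‖ ≤ 2 * (calJ (A + B * K) * ‖B‖) * m := by
  have hJ := calJ_nonneg (A + B * K)
  have hrec : ∀ t < T, state A B K' ω (t + 1) - state A B K ω (t + 1)
      = toEuclideanLin (A + B * K) (state A B K' ω t - state A B K ω t)
        + toEuclideanLin (B * (K' - K)) (state A B K' ω t) := by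
    intro t ht
    rw [state_succ A B K' ht, state_succ A B K ht]
    have h1 : toEuclideanLin (A + B * K') (state A B K' ω t)
        = toEuclideanLin (A + B * K) (state A B K' ω t)
          + toEuclideanLin (B * (K' - K)) (state A B K' ω t) := by
      rw [← LinearMap.add_apply, ← map_add, Matrix.mul_sub]
      congr 2
      abel
    rw [h1, map_sub]
    abel
  intro t
  induction t using Nat.strong_induction_on with
  | _ t ih =>
    intro ht
    set c := 2 * (calJ (A + B * K) * ‖B‖) * m with hc
    have hc0 : 0 ≤ c := by positivity
    have hd : ∀ s < t, ‖toEuclideanLin (B * (K' - K)) (state A B K' ω s)‖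
        ≤ ‖B‖ * (m + ‖K' - K‖ * c) := by
      intro s hst
      have h1 : toEuclideanLin (K' - K) (state A B K' ω s)
          = toEuclideanLin (K' - K) (state A B K ω s)
            + toEuclideanLin (K' - K) (state A B K' ω s - state A B K ω s) := by
        rw [← map_add, add_sub_cancel]
      rw [toEuclideanLin_mul, h1]
      refine (norm_toEuclideanLin_le _ _).trans (mul_le_mul_of_nonneg_left ?_ (norm_nonneg _))
      refine (norm_add_le _ _).trans (add_le_add (hΔ s (by omega)) ?_)
      exact (norm_toEuclideanLin_le _ _).trans
        (mul_le_mul_of_nonneg_left (ih s hst (by omega)) (norm_nonneg _))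
    refine (norm_le_of_linear_recursion hM (e := fun t => state A B K' ω t - state A B K ω t)
      (d := fun s => toEuclideanLin (B * (K' - K)) (state A B K' ω s)) (by simp [state])
      hrec t ht hd (by positivity)).trans ?_
    have h2 : calJ (A + B * K) * (‖B‖ * (m + ‖K' - K‖ * c))
        = c / 2 + (calJ (A + B * K) * ‖B‖ * ‖K' - K‖) * c := by rw [hc]; ring
    rw [h2]
    nlinarith

end Coupling

section Cost

variable {n m : ℕ}

theorem sqrt_sq_add_sq_le (a b c d : ℝ) :
    √(a ^ 2 + b ^ 2) ≤ √(c ^ 2 + d ^ 2) + (|a - c| + |b - d|) := by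
  set s := √(c ^ 2 + d ^ 2) with hs
  have hs2 : s ^ 2 = c ^ 2 + d ^ 2 := Real.sq_sqrt (by positivity)
  have hs0 : 0 ≤ s := Real.sqrt_nonneg _
  have hc : |c| ≤ s := Real.abs_le_sqrt (by nlinarith)
  have hd : |d| ≤ s := Real.abs_le_sqrt (by nlinarith)
  rw [Real.sqrt_le_left (by positivity)]
  have ha : a ^ 2 ≤ (|c| + |a - c|) ^ 2 := by
    rw [← sq_abs a]
    refine pow_le_pow_left₀ (abs_nonneg _) ?_ 2
    have := abs_add_le c (a - c)
    rwa [add_sub_cancel] at this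
  have hb : b ^ 2 ≤ (|d| + |b - d|) ^ 2 := by
    rw [← sq_abs b]
    refine pow_le_pow_left₀ (abs_nonneg _) ?_ 2
    have := abs_add_le d (b - d)
    rwa [add_sub_cancel] at this
  have h1 := mul_le_mul_of_nonneg_right hc (abs_nonneg (a - c))
  have h2 := mul_le_mul_of_nonneg_right hd (abs_nonneg (b - d))
  have h3 := mul_nonneg (abs_nonneg (a - c)) (abs_nonneg (b - d))
  nlinarith [sq_abs c, sq_abs d]

theorem sqrt_qf_le {S : Matrix (Fin n) (Fin n) ℝ} (hS : S.PosSemidef) (y : Vec n) :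
    √(qf S y) ≤ √(lamMax S) * ‖y‖ := by
  rw [← Real.sqrt_sq (norm_nonneg y), ← Real.sqrt_mul (lamMax_nonneg hS)]
  exact Real.sqrt_le_sqrt (qf_le_lamMax_mul hS.isHermitian y)

theorem qf_stage {Q : Matrix (Fin n) (Fin n) ℝ} {R : Matrix (Fin m) (Fin m) ℝ}
    (K : Matrix (Fin m) (Fin n) ℝ) (x : Vec n) :
    qf (Q + Kᵀ * R * K) x = qf Q x + qf R (toEuclideanLin K x) := by
  have h : inner ℝ x (toEuclideanLin (Kᵀ * R * K) x) = qf R (toEuclideanLin K x) := by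
    rw [Matrix.mul_assoc, toEuclideanLin_mul, toEuclideanLin_mul, inner_toEuclideanLin,
      Matrix.transpose_transpose, qf]
  rw [qf, map_add, LinearMap.add_apply, inner_add_right, h]
  rfl

theorem sqrt_qf_stage_le {Q : Matrix (Fin n) (Fin n) ℝ} (hQ : Q.PosSemidef)
    {R : Matrix (Fin m) (Fin m) ℝ} (hR : R.PosSemidef) (K K' : Matrix (Fin m) (Fin n) ℝ)
    (x x' : Vec n) :
    √(qf (Q + K'ᵀ * R * K') x') ≤ √(qf (Q + Kᵀ * R * K) x)
      + (√(lamMax Q) * ‖x' - x‖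
        + √(lamMax R) * ‖toEuclideanLin K' x' - toEuclideanLin K x‖) := by
  rw [qf_stage, qf_stage, qf_eq_norm_sq_matSqrt hQ, qf_eq_norm_sq_matSqrt hR,
    qf_eq_norm_sq_matSqrt hQ, qf_eq_norm_sq_matSqrt hR]
  refine (sqrt_sq_add_sq_le _ _ _ _).trans (add_le_add le_rfl (add_le_add ?_ ?_))
  · refine (abs_norm_sub_norm_le _ _).trans ?_
    have := sqrt_qf_le hQ (x' - x)
    rwa [qf_eq_norm_sq_matSqrt hQ, Real.sqrt_sq (norm_nonneg _), map_sub] at this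
  · refine (abs_norm_sub_norm_le _ _).trans ?_
    have := sqrt_qf_le hR (toEuclideanLin K' x' - toEuclideanLin K x)
    rwa [qf_eq_norm_sq_matSqrt hR, Real.sqrt_sq (norm_nonneg _), map_sub] at this

theorem lqrCost_eq (T : ℕ) (Q : Matrix (Fin n) (Fin n) ℝ) (R : Matrix (Fin m) (Fin m) ℝ)
    (K : Matrix (Fin m) (Fin n) ℝ) (x : ℕ → Vec n) :
    lqrCost T Q R K x = ⨆ t : Fin T, √(qf (Q + Kᵀ * R * K) (x (t + 1))) := by
  simp only [lqrCost, qf_eq_dotProduct]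

theorem lqrCost_le_add {T : ℕ} (hT : 0 < T) {Q : Matrix (Fin n) (Fin n) ℝ} (hQ : Q.PosSemidef)
    {R : Matrix (Fin m) (Fin m) ℝ} (hR : R.PosSemidef) (K K' : Matrix (Fin m) (Fin n) ℝ)
    (x x' : ℕ → Vec n) {a b : ℝ} (ha : ∀ t ≤ T, ‖x' t - x t‖ ≤ a)
    (hb : ∀ t ≤ T, ‖toEuclideanLin K' (x' t) - toEuclideanLin K (x t)‖ ≤ b) :
    lqrCost T Q R K' x' ≤ lqrCost T Q R K x + (√(lamMax Q) * a + √(lamMax R) * b) := by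
  have : Nonempty (Fin T) := ⟨⟨0, hT⟩⟩
  rw [lqrCost_eq, lqrCost_eq]
  refine ciSup_le fun t => (sqrt_qf_stage_le hQ hR K K' (x (t + 1)) (x' (t + 1))).trans
    (add_le_add ?_ (add_le_add ?_ ?_))
  · exact le_ciSup (f := fun t : Fin T => √(qf (Q + Kᵀ * R * K) (x (t + 1))))
      (Set.finite_range _).bddAbove t
  · exact mul_le_mul_of_nonneg_left (ha _ (by omega)) (Real.sqrt_nonneg _)
  · exact mul_le_mul_of_nonneg_left (hb _ (by omega)) (Real.sqrt_nonneg _)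

end Cost

namespace Problem

variable {nx nu k H : ℕ} {P : Problem nx nu k H}

theorem sqrt_lamMax_le_lqrConst (hn : 0 < nx) (hP : P.Valid) (Q : Matrix (Fin nx) (Fin nx) ℝ)
    (R : Matrix (Fin nu) (Fin nu) ℝ) :
    calJ (P.Acl (Fin.last H)) * ‖P.B‖ * (√(lamMax Q) + √(lamMax R) * ‖P.K (Fin.last H)‖)
      + √(lamMax R) ≤ P.lqrConst Q R := by
  have hS := hP.posDef_Sx (Fin.last H)
  have h1 : 1 ≤ √((P.Sx (Fin.last H)).trace / lamMin (P.Sx (Fin.last H))) := by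
    rw [Real.one_le_sqrt, one_le_div (lamMin_pos hn hS)]
    exact lamMin_le_trace hn hS
  rw [lqrConst]
  have := mul_le_mul_of_nonneg_left h1 (Real.sqrt_nonneg (lamMax R))
  linarith

theorem lqrConst_nonneg (hn : 0 < nx) (hP : P.Valid) (Q : Matrix (Fin nx) (Fin nx) ℝ)
    (R : Matrix (Fin nu) (Fin nu) ℝ) : 0 ≤ P.lqrConst Q R := by
  refine le_trans ?_ (sqrt_lamMax_le_lqrConst hn hP Q R)
  have := calJ_nonneg (P.Acl (Fin.last H))
  positivity

/-- Pathwise comparison of the costs of the learned and of the expert closed loop, driven by the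
same noise. -/
theorem abs_lqrCost_sub_le (hn : 0 < nx) (hP : P.Valid) {T : ℕ} (hT : 0 < T)
    {Q : Matrix (Fin nx) (Fin nx) ℝ} (hQ : Q.PosSemidef) {R : Matrix (Fin nu) (Fin nu) ℝ}
    (hR : R.PosSemidef) {Khat : Matrix (Fin nu) (Fin nx) ℝ}
    (hb : calJ (P.Acl (Fin.last H)) * ‖P.B‖ * ‖Khat - P.K (Fin.last H)‖ ≤ 1 / 2)
    (ω : Noise nx nu T) {m : ℝ} (hm : 0 ≤ m)
    (hΔ : ∀ t ≤ T, ‖toEuclideanLin (Khat - P.K (Fin.last H))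
      (P.expertState (Fin.last H) ω t)‖ ≤ m) :
    |lqrCost T Q R Khat (state P.A P.B Khat ω)
        - lqrCost T Q R (P.K (Fin.last H)) (P.expertState (Fin.last H) ω)|
      ≤ 2 * P.lqrConst Q R * m := by
  set K := P.K (Fin.last H) with hK
  set g := calJ (P.Acl (Fin.last H)) * ‖P.B‖ with hg
  have hg0 : 0 ≤ g := mul_nonneg (calJ_nonneg _) (norm_nonneg _)
  set x := P.expertState (Fin.last H) ω
  set x' := state P.A P.B Khat ω
  have he : ∀ t ≤ T, ‖x' t - x t‖ ≤ 2 * g * m :=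
    norm_state_sub_le (hP.stable (Fin.last H)) hb ω hm fun t ht => hΔ t ht.le
  have hu : ∀ t ≤ T, ‖toEuclideanLin Khat (x' t) - toEuclideanLin K (x t)‖
      ≤ 2 * m + ‖K‖ * (2 * g * m) := by
    intro t ht
    have h1 : toEuclideanLin Khat (x' t) - toEuclideanLin K (x t)
        = toEuclideanLin (Khat - K) (x t) + toEuclideanLin (Khat - K) (x' t - x t)
          + toEuclideanLin K (x' t - x t) := by
      simp only [map_sub, LinearMap.sub_apply]; abel
    have h2 : ‖toEuclideanLin (Khat - K) (x' t - x t)‖ ≤ ‖Khat - K‖ * (2 * g * m) :=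
      (norm_toEuclideanLin_le _ _).trans (mul_le_mul_of_nonneg_left (he t ht) (norm_nonneg _))
    have h3 : ‖toEuclideanLin K (x' t - x t)‖ ≤ ‖K‖ * (2 * g * m) :=
      (norm_toEuclideanLin_le _ _).trans (mul_le_mul_of_nonneg_left (he t ht) (norm_nonneg _))
    have h4 : ‖Khat - K‖ * (2 * g * m) ≤ m := by
      have : ‖Khat - K‖ * (2 * g * m) = 2 * m * (g * ‖Khat - K‖) := by ring
      rw [this]
      nlinarith
    rw [h1]
    refine (norm_add_le _ _).trans ((add_le_add (norm_add_le _ _) le_rfl).trans ?_)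
    have := hΔ t ht
    linarith
  have hfin : √(lamMax Q) * (2 * g * m) + √(lamMax R) * (2 * m + ‖K‖ * (2 * g * m))
      ≤ 2 * P.lqrConst Q R * m := by
    have h5 := mul_le_mul_of_nonneg_right (sqrt_lamMax_le_lqrConst hn hP Q R)
      (by linarith : 0 ≤ 2 * m)
    refine le_trans (le_of_eq ?_) (h5.trans (le_of_eq ?_)) <;> ring
  rw [abs_sub_le_iff]
  constructor
  · have := lqrCost_le_add hT hQ hR K Khat x x' he hu
    linarith
  · have := lqrCost_le_add hT hQ hR Khat K x' x
      (fun t ht => by rw [norm_sub_rev]; exact he t ht)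
      (fun t ht => by rw [norm_sub_rev]; exact hu t ht)
    linarith

theorem integrable_norm_state (h : Fin (H + 1)) {T : ℕ} (K : Matrix (Fin nu) (Fin nx) ℝ) (t : ℕ) :
    Integrable (fun ω => ‖state P.A P.B K ω t‖) (P.noiseLaw h T) := by
  obtain ⟨L, hL⟩ := exists_stateCLM (T := T) P.A P.B K t
  simp only [hL]
  exact (L.integrable_comp IsGaussian.integrable_id).norm

theorem integrable_lqrCost {T : ℕ} (hT : 0 < T) {Q : Matrix (Fin nx) (Fin nx) ℝ}
    (hQ : Q.PosSemidef) {R : Matrix (Fin nu) (Fin nu) ℝ} (hR : R.PosSemidef)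
    (K : Matrix (Fin nu) (Fin nx) ℝ) :
    Integrable (fun ω => lqrCost T Q R K (state P.A P.B K ω)) (P.noiseLaw (Fin.last H) T) := by
  have hne : Nonempty (Fin T) := ⟨⟨0, hT⟩⟩
  have hpsd : (Q + Kᵀ * R * K).PosSemidef := by
    refine hQ.add ?_
    have := hR.conjTranspose_mul_mul_same K
    rwa [conjTranspose_eq_transpose_of_trivial] at this
  have hmeas : Measurable fun ω : Noise nx nu T => lqrCost T Q R K (state P.A P.B K ω) := by
    simp only [lqrCost_eq]
    refine Measurable.iSup fun t => ?_
    have h1 := measurable_state (T := T) P.A P.B K (t + 1)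
    exact (h1.inner ((measurable_toEuclideanLin _).comp h1)).sqrt
  refine Integrable.mono' (g := fun ω => ∑ t : Fin T,
    √(lamMax (Q + Kᵀ * R * K)) * ‖state P.A P.B K ω (t + 1)‖)
    (integrable_finsetSum _ fun t _ => (integrable_norm_state _ K _).const_mul _)
    hmeas.aestronglyMeasurable (ae_of_all _ fun ω => ?_)
  rw [lqrCost_eq, Real.norm_of_nonneg (Real.iSup_nonneg fun _ => Real.sqrt_nonneg _)]
  refine ciSup_le fun t => (sqrt_qf_le hpsd _).trans ?_
  exact Finset.single_le_sum (f := fun t : Fin T =>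
    √(lamMax (Q + Kᵀ * R * K)) * ‖state P.A P.B K ω (t + 1)‖)
    (fun _ _ => by positivity) (Finset.mem_univ t)

/-! ### Maximal inequality for the prediction error along an expert trajectory -/

theorem lintegral_eexp_norm_sq_toEuclideanLin_state_le (hP : P.Valid) (h : Fin (H + 1)) {T t : ℕ}
    (ht : t ≤ T) (D : Matrix (Fin nu) (Fin nx) ℝ) {v : ℝ} (hv : 0 < v)
    (hD : wsq (P.Sx h) D ≤ v) :
    ∫⁻ ω, eexp (‖toEuclideanLin D (P.expertState h ω t)‖ ^ 2 / (4 * v)) ∂(P.noiseLaw h T)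
      ≤ eexp (3 / 8) := by
  have hS := (hP.posDef_Sx h).posSemidef
  have hYlin : IsLinearMap ℝ fun ω : Noise nx nu T => toEuclideanLin D (P.expertState h ω t) := by
    have h1 := isLinearMap_state (T := T) P.A P.B (P.K h) t
    exact ((toEuclideanLin D).comp (h1.mk' _)).isLinear
  set G := D * P.Sx h * Dᵀ with hG
  have hGH : G.IsHermitian := by
    have := (hS.mul_mul_conjTranspose_same D).isHermitian
    rwa [conjTranspose_eq_transpose_of_trivial] at this
  have hqf : ∀ u, qf G u = qf (P.Sx h) (toEuclideanLin Dᵀ u) := by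
    intro u
    rw [qf, hG, Matrix.mul_assoc, toEuclideanLin_mul, toEuclideanLin_mul, inner_toEuclideanLin, qf]
  have hmean : ∀ u, ∫ ω, inner ℝ u (toEuclideanLin D (P.expertState h ω t))
      ∂(P.noiseLaw h T) = 0 := by
    intro u
    simp only [inner_toEuclideanLin]
    exact integral_inner_state h t _
  have hcov : ∀ u, ∫ ω, inner ℝ u (toEuclideanLin D (P.expertState h ω t)) ^ 2
      ∂(P.noiseLaw h T) = qf G u := by
    intro u
    have := integral_state_mul_state hP h (T := T) (s := t) 0 (by omega)
      (toEuclideanLin Dᵀ u) (toEuclideanLin Dᵀ u)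
    rw [add_zero, pow_zero, Matrix.one_mul] at this
    simp only [inner_toEuclideanLin, sq]
    rw [this, hqf, qf]
  obtain ⟨hpsd, hlaw⟩ := map_eq_multivariateGaussian
    (hasGaussianLaw_of_isLinearMap h hYlin) hGH hmean hcov
  have htr : G.trace = wsq (P.Sx h) D := by
    rw [Matrix.trace, wsq]
    refine Finset.sum_congr rfl fun i _ => ?_
    rw [Matrix.diag_apply, qf_eq_dotProduct, hG, Matrix.mul_assoc, Matrix.mul_apply]
    simp only [dotProduct]
    refine Finset.sum_congr rfl fun j _ => ?_
    rw [Matrix.mul_apply]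
    simp [rowVec, Matrix.mulVec, dotProduct]
  have hqfv : ∀ u, qf G u ≤ v * ‖u‖ ^ 2 := by
    intro u
    have h1 : toEuclideanLin Dᵀ u = ∑ i, u i • rowVec D i := by
      ext j
      simp [rowVec, Matrix.mulVec, dotProduct, mul_comm]
    have h2 : ‖toEuclideanLin (matSqrt (P.Sx h)) (∑ i, u i • rowVec D i)‖
        ≤ ∑ i, |u i| * ‖toEuclideanLin (matSqrt (P.Sx h)) (rowVec D i)‖ := by
      rw [map_sum]
      refine (norm_sum_le _ _).trans (le_of_eq (Finset.sum_congr rfl fun i _ => ?_))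
      rw [map_smul, norm_smul, Real.norm_eq_abs]
    have h3 : ∑ i, ‖toEuclideanLin (matSqrt (P.Sx h)) (rowVec D i)‖ ^ 2 = wsq (P.Sx h) D := by
      simp only [wsq, qf_eq_norm_sq_matSqrt hS]
    have h4 : ∑ i, |u i| ^ 2 = ‖u‖ ^ 2 := by
      rw [EuclideanSpace.real_norm_sq_eq]; simp only [sq_abs]
    rw [hqf, h1, qf_eq_norm_sq_matSqrt hS]
    refine (pow_le_pow_left₀ (norm_nonneg _) h2 2).trans
      ((Finset.sum_mul_sq_le_sq_mul_sq _ _ _).trans ?_)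
    rw [h3, h4, mul_comm]
    exact mul_le_mul_of_nonneg_right hD (sq_nonneg _)
  have hs : |1 / (4 * v)| * v ≤ 1 / 4 := by
    rw [abs_of_pos (by positivity)]
    field_simp; exact le_rfl
  have hmain := lintegral_eexp_norm_sq_le_trace hpsd hqfv hs
  have hYm : Measurable fun ω : Noise nx nu T => toEuclideanLin D (P.expertState h ω t) :=
    (measurable_toEuclideanLin D).comp (measurable_state _ _ _ _)
  rw [← hlaw, lintegral_map (Measurable.eexp (by fun_prop)) hYm, htr] at hmain
  simp only [one_div_mul_eq_div] at hmain
  refine hmain.trans (eexp_mono ?_)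
  have h5 : 1 / (4 * v) + 2 * (1 / (4 * v)) ^ 2 * v = 3 / 8 / v := by field_simp; norm_num
  rw [h5, div_mul_eq_mul_div, div_le_iff₀ hv]
  exact mul_le_mul_of_nonneg_left hD (by norm_num)

/-- The maximum of the prediction errors `‖D x[t]‖`, `t ≤ T`, along an expert trajectory is dominated
by a random variable with expectation of order `√(v log T)`. -/
theorem exists_integrable_bound (hP : P.Valid) (h : Fin (H + 1)) {T : ℕ} (hT : 2 ≤ T)
    (D : Matrix (Fin nu) (Fin nx) ℝ) {v : ℝ} (hv : 0 < v) (hD : wsq (P.Sx h) D ≤ v) :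
    ∃ U : Noise nx nu T → ℝ, Integrable U (P.noiseLaw h T) ∧ (∀ ω, 0 ≤ U ω) ∧
      (∀ ω, ∀ t ≤ T, ‖toEuclideanLin D (P.expertState h ω t)‖ ≤ U ω) ∧
      ∫ ω, U ω ∂(P.noiseLaw h T) ≤ 5 * √(Real.log T) * √v := by
  set L := Real.log (T + 1) with hL
  have hT' : (2 : ℝ) ≤ T := by exact_mod_cast hT
  have hlog2 : Real.log 2 ≤ Real.log T := Real.log_le_log two_pos hT'
  have hl2 := Real.log_two_gt_d9
  have hLle : L ≤ 2 * Real.log T := by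
    rw [hL, ← Real.log_rpow (by linarith)]
    refine Real.log_le_log (by linarith) ?_
    rw [Real.rpow_two]
    nlinarith
  have hL0 : 0 ≤ L := Real.log_nonneg (by linarith)
  let X : Fin (T + 1) → Noise nx nu T → ℝ := fun t ω =>
    ‖toEuclideanLin D (P.expertState h ω t)‖ ^ 2 / (4 * v)
  have hXm : ∀ t, Measurable (X t) := fun t =>
    (((measurable_toEuclideanLin D).comp (measurable_state _ _ _ _)).norm.pow_const 2).div_const _
  have hXint : ∀ t, Integrable (fun ω => Real.exp (X t ω)) (P.noiseLaw h T) ∧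
      ∫ ω, Real.exp (X t ω) ∂(P.noiseLaw h T) ≤ Real.exp (3 / 8) := by
    intro t
    have h1 := lintegral_eexp_norm_sq_toEuclideanLin_state_le hP h (T := T) (t := t)
      (by omega) D hv hD
    have h2 : Integrable (fun ω => Real.exp (X t ω)) (P.noiseLaw h T) := by
      refine ⟨(Real.measurable_exp.comp (hXm t)).aestronglyMeasurable, ?_⟩
      rw [hasFiniteIntegral_iff_ofReal (ae_of_all _ fun _ => Real.exp_nonneg _)]
      exact h1.trans_lt ENNReal.ofReal_lt_top
    refine ⟨h2, ?_⟩
    rw [integral_eq_lintegral_of_nonneg_ae (ae_of_all _ fun _ => Real.exp_nonneg _)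
      h2.aestronglyMeasurable]
    exact ENNReal.toReal_le_of_le_ofReal (Real.exp_nonneg _) h1
  -- the parameter of the arithmetic-geometric mean inequality `y ≤ (y² / b + b) / 2`
  set b := √(4 * v * (L + 2)) with hb
  have hb2 : b ^ 2 = 4 * v * (L + 2) := Real.sq_sqrt (by positivity)
  have hb0 : 0 < b := Real.sqrt_pos.2 (by positivity)
  let U : Noise nx nu T → ℝ := fun ω =>
    (4 * v / b * (L + ∑ t, Real.exp (X t ω) * Real.exp (-L)) + b) / 2
  have hint : Integrable (fun ω => ∑ t, Real.exp (X t ω) * Real.exp (-L)) (P.noiseLaw h T) :=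
    integrable_finsetSum _ fun t _ => (hXint t).1.mul_const _
  have hint2 : Integrable (fun ω => 4 * v / b * (L + ∑ t, Real.exp (X t ω) * Real.exp (-L)))
      (P.noiseLaw h T) := ((integrable_const _).add hint).const_mul _
  refine ⟨U, (hint2.add (integrable_const _)).div_const _, fun ω => ?_, fun ω t ht => ?_, ?_⟩
  · have : 0 ≤ ∑ t, Real.exp (X t ω) * Real.exp (-L) := by positivity
    simp only [U]
    positivity
  · have h1 : X ⟨t, by omega⟩ ω ≤ L + ∑ t, Real.exp (X t ω) * Real.exp (-L) := by
      have h2 : Real.exp (X ⟨t, by omega⟩ ω) * Real.exp (-L)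
          ≤ ∑ t, Real.exp (X t ω) * Real.exp (-L) :=
        Finset.single_le_sum (f := fun t => Real.exp (X t ω) * Real.exp (-L))
          (fun _ _ => by positivity) (Finset.mem_univ _)
      have h3 := Real.add_one_le_exp (X ⟨t, by omega⟩ ω + -L)
      rw [Real.exp_add] at h3
      linarith
    have h4 : ‖toEuclideanLin D (P.expertState h ω t)‖ ^ 2
        ≤ 4 * v * (L + ∑ t, Real.exp (X t ω) * Real.exp (-L)) := by
      have : X ⟨t, by omega⟩ ω = ‖toEuclideanLin D (P.expertState h ω t)‖ ^ 2 / (4 * v) := rfl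
      rw [this, div_le_iff₀ (by positivity)] at h1
      linarith
    set y := ‖toEuclideanLin D (P.expertState h ω t)‖
    have h5 : y ≤ (y ^ 2 / b + b) / 2 := by
      rw [le_div_iff₀ two_pos, ← sub_nonneg]
      have : y ^ 2 / b + b - y * 2 = (y - b) ^ 2 / b := by field_simp; ring
      rw [this]; positivity
    refine h5.trans ?_
    simp only [U]
    have h6 : y ^ 2 / b ≤ 4 * v / b * (L + ∑ t, Real.exp (X t ω) * Real.exp (-L)) := by
      rw [div_mul_eq_mul_div]
      exact div_le_div_of_nonneg_right h4 hb0.le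
    linarith
  · have h1 : ∫ ω, ∑ t, Real.exp (X t ω) * Real.exp (-L) ∂(P.noiseLaw h T) ≤ 2 := by
      rw [integral_finsetSum _ fun t _ => (hXint t).1.mul_const _]
      have h2 : ∀ t : Fin (T + 1), ∫ ω, Real.exp (X t ω) * Real.exp (-L) ∂(P.noiseLaw h T)
          ≤ Real.exp (3 / 8) * Real.exp (-L) := fun t => by
        rw [integral_mul_const]
        exact mul_le_mul_of_nonneg_right (hXint t).2 (Real.exp_nonneg _)
      refine (Finset.sum_le_sum fun t _ => h2 t).trans ?_
      rw [Finset.sum_const, Finset.card_univ, Fintype.card_fin, nsmul_eq_mul, Real.exp_neg, hL,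
        Real.exp_log (by linarith)]
      have h3 : ((T + 1 : ℕ) : ℝ) * (Real.exp (3 / 8) * ((T : ℝ) + 1)⁻¹) = Real.exp (3 / 8) := by
        push_cast; field_simp
      rw [h3]
      refine (Real.le_log_iff_exp_le two_pos).1 ?_
      linarith
    have h4 : ∫ ω, U ω ∂(P.noiseLaw h T)
        = (4 * v / b * (L + ∫ ω, ∑ t, Real.exp (X t ω) * Real.exp (-L) ∂(P.noiseLaw h T)) + b)
          / 2 := by
      simp only [U]
      rw [integral_div, integral_add hint2 (integrable_const _), integral_const_mul,
        integral_add (integrable_const _) hint]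
      simp
    have h5 : ∫ ω, U ω ∂(P.noiseLaw h T) ≤ b := by
      rw [h4]
      have h6 : 4 * v / b * (L + ∫ ω, ∑ t, Real.exp (X t ω) * Real.exp (-L) ∂(P.noiseLaw h T))
          ≤ 4 * v / b * (L + 2) := mul_le_mul_of_nonneg_left (by linarith) (by positivity)
      have h7 : 4 * v / b * (L + 2) = b := by
        rw [div_mul_eq_mul_div, ← hb2]; field_simp
      linarith
    refine h5.trans ?_
    rw [hb, Real.sqrt_le_iff]
    refine ⟨by positivity, ?_⟩
    rw [mul_pow, mul_pow, Real.sq_sqrt (by linarith), Real.sq_sqrt hv.le]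
    nlinarith

/-- Difference of the expected costs in terms of the population prediction error of the learned
gain. -/
theorem abs_expectedCost_sub_le (hn : 0 < nx) (hP : P.Valid) {T : ℕ} (hT : 2 ≤ T)
    {Q : Matrix (Fin nx) (Fin nx) ℝ} (hQ : Q.PosSemidef) {R : Matrix (Fin nu) (Fin nu) ℝ}
    (hR : R.PosSemidef) {Khat : Matrix (Fin nu) (Fin nx) ℝ} {v : ℝ} (hv : 0 < v)
    (hwsq : wsq (P.Sx (Fin.last H)) (Khat - P.K (Fin.last H)) ≤ v)
    (hburn : 4 * calJ (P.Acl (Fin.last H)) ^ 2 * ‖P.B‖ ^ 2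
      * wsq (P.Sx (Fin.last H)) (Khat - P.K (Fin.last H)) ≤ lamMin (P.Sx (Fin.last H))) :
    |P.expectedCost T Q R Khat - P.expectedCost T Q R (P.K (Fin.last H))|
      ≤ 10 * P.lqrConst Q R * √(Real.log T) * √v := by
  have hS := hP.posDef_Sx (Fin.last H)
  set Δ := Khat - P.K (Fin.last H) with hΔ
  set J := calJ (P.Acl (Fin.last H)) with hJ
  have hJ0 : 0 ≤ J := calJ_nonneg _
  have hb : J * ‖P.B‖ * ‖Δ‖ ≤ 1 / 2 := by
    have h1 := lamMin_mul_norm_sq_le_wsq hn hS Δ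
    have h2 := lamMin_pos hn hS
    have h3 : (2 * (J * ‖P.B‖ * ‖Δ‖)) ^ 2 ≤ 1 := by
      refine le_of_mul_le_mul_right ?_ h2
      calc (2 * (J * ‖P.B‖ * ‖Δ‖)) ^ 2 * lamMin (P.Sx (Fin.last H))
          = 4 * J ^ 2 * ‖P.B‖ ^ 2 * (lamMin (P.Sx (Fin.last H)) * ‖Δ‖ ^ 2) := by ring
        _ ≤ 4 * J ^ 2 * ‖P.B‖ ^ 2 * wsq (P.Sx (Fin.last H)) Δ :=
          mul_le_mul_of_nonneg_left h1 (by positivity)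
        _ ≤ 1 * lamMin (P.Sx (Fin.last H)) := by linarith
    have h4 := (sq_le_one_iff₀ (by positivity)).1 h3
    linarith
  obtain ⟨U, hUi, hU0, hU, hUint⟩ := exists_integrable_bound hP (Fin.last H) hT Δ hv hwsq
  have h1 := integrable_lqrCost (P := P) (by omega : 0 < T) hQ hR Khat
  have h2 := integrable_lqrCost (P := P) (by omega : 0 < T) hQ hR (P.K (Fin.last H))
  rw [expectedCost, expectedCost, ← integral_sub h1 h2]
  rw [← Real.norm_eq_abs]
  refine (norm_integral_le_integral_norm _).trans ?_
  have h3 : ∫ ω, ‖lqrCost T Q R Khat (state P.A P.B Khat ω)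
      - lqrCost T Q R (P.K (Fin.last H)) (state P.A P.B (P.K (Fin.last H)) ω)‖
      ∂(P.noiseLaw (Fin.last H) T) ≤ ∫ ω, 2 * P.lqrConst Q R * U ω ∂(P.noiseLaw (Fin.last H) T) :=
    integral_mono (h1.sub h2).norm (hUi.const_mul _) fun ω =>
      abs_lqrCost_sub_le hn hP (by omega) hQ hR hb ω (hU0 ω) (hU ω)
  refine h3.trans ?_
  rw [integral_const_mul]
  have h4 := lqrConst_nonneg hn hP Q R
  refine (mul_le_mul_of_nonneg_left hUint (by positivity)).trans (le_of_eq (by ring))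

end Problem


/-! ### Choice of the parameters and error bound with high probability -/

namespace Problem

variable {nx nu k H : ℕ} {P : Problem nx nu k H}

/-- Inverse mesh size of the grid used for the source tasks: fine enough to compensate the
conditioning of the source covariances, with a logarithm comparable to the one in the rate. -/
noncomputable def gridScale (P : Problem nx nu k H) (N T : ℕ) : ℕ :=
  ⌈(N * T * (P.lamBar / P.lamUnder)) ^ 2⌉₊

/-- Noise level of the pre-training problem. -/
noncomputable def sourceLevel (P : Problem nx nu k H) (N T : ℕ) (δ : ℝ) : ℝ :=
  8 * P.sigz ^ 2 * (N * T) * (2 * k * nx * Real.log (2 * P.gridScale N T + 1)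
    + H * nu * (2 * k) * (Real.log 2 / 2) + Real.log (8 / δ))

/-- Bound for the total energy of the actuator noise in the source data. -/
noncomputable def energyLevel (P : Problem nx nu k H) (N T : ℕ) (δ : ℝ) : ℝ :=
  4 * P.sigz ^ 2 * (H * (N * T) * nu * (Real.log 2 / 2) + Real.log (8 / δ))

/-- Noise level of the target training problem. -/
noncomputable def targetLevel (P : Problem nx nu k H) (N T : ℕ) (δ : ℝ) : ℝ :=
  8 * P.sigz ^ 2 * (N * T) * (nu * (2 * k) * (Real.log 2 / 2) + Real.log (8 / δ))

/-- The good event for the source data. -/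
def SourceGood (P : Problem nx nu k H) (δ : ℝ) {N T : ℕ} (s : Fin H → Fin N → Traj nx nu T) :
    Prop :=
  P.SourceIsometry s ∧ P.SourceNoise (2 * k) (P.gridScale N T) (P.sourceLevel N T δ) s ∧
    ∑ h, ∑ i, ∑ t, ‖resid (P.K h.castSucc) (s h i t)‖ ^ 2 ≤ P.energyLevel N T δ

theorem log_five_le : Real.log 5 ≤ 2 := by
  rw [Real.log_le_iff_le_exp (by norm_num), show (2 : ℝ) = 1 + 1 by norm_num, Real.exp_add]
  have := Real.exp_one_gt_d9
  nlinarith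

theorem log_eight_div {δ : ℝ} (hδ : 0 < δ) :
    Real.log (8 / δ) = 3 * Real.log 2 + Real.log (1 / δ) := by
  rw [div_eq_mul_one_div, Real.log_mul (by norm_num) (by positivity),
    show (8 : ℝ) = 2 ^ 3 by norm_num, Real.log_pow]
  norm_num

theorem eexp_neg_log_eight_div {δ : ℝ} (hδ : 0 < δ) :
    eexp (-Real.log (8 / δ)) = ENNReal.ofReal (δ / 8) := by
  rw [eexp, Real.exp_neg, Real.exp_log (by positivity), inv_div]

/-- The sample size requirement, in the form in which it enters the deviation bounds. The constant
is `7 * 2 * 32768`, where `2` comes from `mixing`. -/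
theorem le_div_mixing (hn : 0 < nx) (hP : P.Valid) (h : Fin (H + 1)) {a b : ℝ} (ha : 0 ≤ a)
    (hb : 458752 * (calJ (P.Acl h) ^ 2 * MTIL.cond (P.Sx h) * a) ≤ b) :
    7 * a ≤ b / (32768 * P.mixing h) := by
  have h1 := one_le_cond hn (hP.posDef_Sx h)
  have h2 := (hP.stable h).one_le_calJ hn
  rw [le_div_iff₀ (mul_pos (by norm_num) (mixing_pos hn hP h)), mixing]
  refine le_trans ?_ hb
  have h3 : calJ (P.Acl h) * (MTIL.cond (P.Sx h) * a)
      ≤ calJ (P.Acl h) ^ 2 * (MTIL.cond (P.Sx h) * a) :=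
    mul_le_mul_of_nonneg_right (by nlinarith) (by positivity)
  nlinarith

theorem seven_mul_le_of_enough (hn : 0 < nx) (hP : P.Valid) (h : Fin (H + 1)) {a b : ℝ} (ha : 0 ≤ a)
    (hb : 458752 * (calJ (P.Acl h) ^ 2 * MTIL.cond (P.Sx h) * a) ≤ b) : 7 * a ≤ b := by
  have h1 := one_le_cond hn (hP.posDef_Sx h)
  have h2 := (hP.stable h).one_le_calJ hn
  have h3 : a ≤ calJ (P.Acl h) ^ 2 * MTIL.cond (P.Sx h) * a :=
    le_mul_of_one_le_left ha (one_le_mul_of_one_le_of_one_le (one_le_pow₀ h2) h1)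
  linarith

theorem measure_not_sourceGood_le (hn : 0 < nx) (hH : 0 < H) (hP : P.Valid) {N T : ℕ}
    (hNT : 0 < (N * T : ℝ)) {δ : ℝ} (hδ : 0 < δ) (hδ1 : δ < 1)
    (hN : ∀ h : Fin H, 7 * (nx + Real.log (H / δ)) ≤ N * T / (32768 * P.mixing h.castSucc)) :
    P.sourceLaw N T {s | ¬ P.SourceGood δ s} ≤ ENNReal.ofReal (3 * δ / 8) := by
  have hs := hP.sigz_pos
  have hH' : (1 : ℝ) ≤ H := by exact_mod_cast hH
  have hn' : (1 : ℝ) ≤ nx := by exact_mod_cast hn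
  have e1 : P.sourceLaw N T {s | ¬ P.SourceIsometry s} ≤ ENNReal.ofReal (δ / 8) := by
    have h1 : ∀ h : Fin H, eexp (nx * Real.log 5 + (Real.log 2
        - N * T / (32768 * P.mixing h.castSucc))) ≤ ENNReal.ofReal (δ / (8 * H)) := by
      intro h
      have h2 : ENNReal.ofReal (δ / (8 * H)) = eexp (-(3 * Real.log 2 + Real.log (H / δ))) := by
        rw [eexp, Real.exp_neg, Real.exp_add, Real.exp_log (by positivity), mul_comm (3 : ℝ),
          Real.exp_mul, Real.exp_log two_pos]
        congr 1
        norm_num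
        field_simp
      rw [h2]
      refine eexp_mono ?_
      have h3 := hN h
      have h4 : 0 ≤ Real.log (H / δ) := Real.log_nonneg ((one_le_div hδ).2 (by linarith))
      have h5 := mul_le_mul_of_nonneg_left log_five_le (by linarith : (0 : ℝ) ≤ nx)
      have h6 := Real.log_two_lt_d9
      linarith
    refine (measure_not_sourceIsometry_le hn hP N T).trans
      ((Finset.sum_le_sum fun h _ => h1 h).trans (le_of_eq ?_))
    rw [Finset.sum_const, Finset.card_univ, Fintype.card_fin, ← ENNReal.ofReal_nsmul, nsmul_eq_mul]
    congr 1
    field_simp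
  have e2 : P.sourceLaw N T {s | P.SourceIsometry s ∧ ¬ P.SourceNoise (2 * k)
      (P.gridScale N T) (P.sourceLevel N T δ) s} ≤ ENNReal.ofReal (δ / 8) := by
    refine (measure_not_sourceNoise_le hP hNT _ _).trans (le_of_eq ?_)
    rw [← eexp_neg_log_eight_div hδ]
    congr 1
    have : P.sourceLevel N T δ / (8 * P.sigz ^ 2 * (N * T)) = 2 * k * nx
        * Real.log (2 * P.gridScale N T + 1) + H * nu * (2 * k) * (Real.log 2 / 2)
        + Real.log (8 / δ) := mul_div_cancel_left₀ _ (by positivity)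
    rw [this]
    push_cast
    ring
  have e3 : P.sourceLaw N T {s | P.energyLevel N T δ
      < ∑ h, ∑ i, ∑ t, ‖resid (P.K h.castSucc) (s h i t)‖ ^ 2} ≤ ENNReal.ofReal (δ / 8) := by
    refine (measure_sum_resid_sq_gt_le hP N T _).trans (le_of_eq ?_)
    rw [← eexp_neg_log_eight_div hδ]
    congr 1
    have : P.energyLevel N T δ / (4 * P.sigz ^ 2) = H * (N * T) * nu * (Real.log 2 / 2)
        + Real.log (8 / δ) := mul_div_cancel_left₀ _ (by positivity)
    rw [this]
    ring
  have hsub : {s : Fin H → Fin N → Traj nx nu T | ¬ P.SourceGood δ s}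
      ⊆ {s | ¬ P.SourceIsometry s} ∪ {s | P.SourceIsometry s ∧ ¬ P.SourceNoise (2 * k)
        (P.gridScale N T) (P.sourceLevel N T δ) s} ∪ {s | P.energyLevel N T δ
        < ∑ h, ∑ i, ∑ t, ‖resid (P.K h.castSucc) (s h i t)‖ ^ 2} := by
    intro s hs
    simp only [Set.mem_union, Set.mem_ofPred_eq] at hs ⊢
    by_contra hcon
    push Not at hcon
    exact hs ⟨hcon.1.1, hcon.1.2 hcon.1.1, hcon.2⟩
  refine (measure_mono hsub).trans ((measure_union_le _ _).trans
    ((add_le_add ((measure_union_le _ _).trans (add_le_add e1 e2)) e3).trans (le_of_eq ?_)))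
  rw [← ENNReal.ofReal_add (by positivity) (by positivity),
    ← ENNReal.ofReal_add (by positivity) (by positivity)]
  congr 1
  ring

theorem measure_not_targetGood_le_of_enough (hk : 0 < k) (hn : 0 < nx) (hP : P.Valid) {N T : ℕ}
    (hNT : 0 < (N * T : ℝ)) {δ : ℝ} (hδ : 0 < δ) (hδ1 : δ < 1)
    (hN : 7 * (k + Real.log (1 / δ)) ≤ N * T / (32768 * P.mixing (Fin.last H)))
    (Φ : Matrix (Fin k) (Fin nx) ℝ) :
    P.targetLaw N T {d | ¬ P.TargetGood (P.targetLevel N T δ) Φ d}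
      ≤ ENNReal.ofReal (2 * δ / 8) := by
  have hs := hP.sigz_pos
  have hk' : (1 : ℝ) ≤ k := by exact_mod_cast hk
  have h0 : 0 ≤ Real.log (1 / δ) := Real.log_nonneg ((one_le_div hδ).2 hδ1.le)
  refine (measure_not_targetGood_le hn hP hNT _ Φ).trans
    ((add_le_add (b := ENNReal.ofReal (δ / 8)) (d := ENNReal.ofReal (δ / 8)) ?_ ?_).trans
      (le_of_eq ?_))
  · rw [← eexp_neg_log_eight_div hδ]
    refine eexp_mono ?_
    rw [log_eight_div hδ]
    have h5 := mul_le_mul_of_nonneg_left log_five_le (by linarith : (0 : ℝ) ≤ k)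
    have h6 := Real.log_two_lt_d9
    linarith
  · rw [← eexp_neg_log_eight_div hδ]
    refine eexp_mono (le_of_eq ?_)
    have : P.targetLevel N T δ / (8 * P.sigz ^ 2 * (N * T)) = nu * (2 * k) * (Real.log 2 / 2)
        + Real.log (8 / δ) := mul_div_cancel_left₀ _ (by positivity)
    rw [this]
    ring
  · rw [← ENNReal.ofReal_add (by positivity) (by positivity)]
    congr 1
    ring

theorem log_gridScale_le {N T : ℕ} (hx : 4 ≤ N * T * (P.lamBar / P.lamUnder)) :
    Real.log (2 * P.gridScale N T + 1) ≤ 3 * Real.log (N * T * (P.lamBar / P.lamUnder)) := by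
  set x := (N * T : ℝ) * (P.lamBar / P.lamUnder) with hxdef
  have h1 : (P.gridScale N T : ℝ) < x ^ 2 + 1 := Nat.ceil_lt_add_one (by positivity)
  have h2 : (3 : ℝ) * Real.log x = Real.log (x ^ 3) := by rw [Real.log_pow]; norm_num
  rw [h2]
  refine Real.log_le_log (by positivity) ?_
  nlinarith [mul_nonneg (sub_nonneg.2 hx) (sq_nonneg x)]

/-- The pre-trained representation is accurate on average over the source tasks. -/
theorem sourceError_le_of_sourceGood (hk : 0 < k) (hnu : 0 < nu) (hn : 0 < nx) (hH : 0 < H)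
    (hP : P.Valid) {N T : ℕ} (hNT : 7 * nx ≤ (N * T : ℝ)) {δ : ℝ} (hδ : 0 < δ) (hδ1 : δ < 1)
    {s : Fin H → Fin N → Traj nx nu T} (hs : P.SourceGood δ s)
    {Φ : Matrix (Fin k) (Fin nx) ℝ} {F : Fin H → Matrix (Fin nu) (Fin k) ℝ}
    (hERM : IsPretrained s Φ F) :
    P.sourceError Φ F ≤ 7296 * P.sigz ^ 2 / (N * T)
      * (k * nx * Real.log (N * T * (P.lamBar / P.lamUnder))
        + H * (k * nu + Real.log (1 / δ))) := by
  have hk' : (1 : ℝ) ≤ k := by exact_mod_cast hk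
  have hnu' : (1 : ℝ) ≤ nu := by exact_mod_cast hnu
  have hn' : (1 : ℝ) ≤ nx := by exact_mod_cast hn
  have hH' : (1 : ℝ) ≤ H := by exact_mod_cast hH
  have hdim : (2 * k : ℝ) ≤ nx := by exact_mod_cast hP.dim
  have hlu := lamUnder_pos hn hH hP
  have hratio : 1 ≤ P.lamBar / P.lamUnder := (one_le_div hlu).2 (lamUnder_le_lamBar hn hH hP)
  set n := (N * T : ℝ) with hndef
  have hn7 : 7 ≤ n := by linarith
  set q := P.lamBar / P.lamUnder with hq
  have hxn : n ≤ n * q := le_mul_of_one_le_right (by linarith) hratio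
  set M := P.gridScale N T with hM
  have hMx : (n * q) ^ 2 ≤ M := Nat.le_ceil _
  have hM1 : (1 : ℝ) ≤ M := le_trans (by nlinarith) hMx
  have hM0 : 0 < M := by exact_mod_cast (lt_of_lt_of_le one_pos hM1)
  -- the mesh makes the discretization error negligible
  have hρ : q * (2 * k * nx / M ^ 2) ≤ 1 / n := by
    have h1 : (2 * k * nx : ℝ) ≤ n * n :=
      mul_le_mul (by linarith) (by linarith) (by linarith) (by linarith)
    have h2 : n * q * (n * n) ≤ (M : ℝ) ^ 2 := by
      calc n * q * (n * n) ≤ n * q * ((n * q) * (n * q)) :=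
            mul_le_mul_of_nonneg_left (mul_le_mul hxn hxn (by linarith) (by linarith)) (by linarith)
        _ ≤ n * q * ((n * q) * (n * q)) * (n * q) :=
            le_mul_of_one_le_right (by positivity) (by linarith)
        _ = ((n * q) ^ 2) ^ 2 := by ring
        _ ≤ (M : ℝ) ^ 2 := pow_le_pow_left₀ (by positivity) hMx 2
    rw [← mul_div_assoc, div_le_div_iff₀ (by positivity) (by linarith)]
    have h3 := mul_le_mul_of_nonneg_left h1 (by positivity : 0 ≤ n * q)
    linarith
  have h0 : 0 ≤ Real.log (1 / δ) := Real.log_nonneg ((one_le_div hδ).2 hδ1.le)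
  have hl8 := log_eight_div hδ
  have hl2 := Real.log_two_lt_d9
  have hl2' : 0 ≤ Real.log 2 := Real.log_nonneg (by norm_num)
  have hlM : 0 ≤ Real.log (2 * M + 1) := Real.log_nonneg (by linarith)
  have hlev : 0 ≤ P.sourceLevel N T δ := by
    rw [sourceLevel, hl8, ← hM]
    positivity
  have hmain := sourceError_le hn hH hP hM0 (by linarith) hlev hρ
    ((div_le_one (by linarith)).2 (by linarith)) hs.1 hs.2.1 hs.2.2 hERM
  rw [← hndef] at hmain
  have hlog : Real.log (2 * M + 1) ≤ 3 * Real.log (n * q) := log_gridScale_le (by linarith)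
  set l := Real.log (n * q) with hl
  have hl0 : 0 ≤ l := by linarith
  set B := k * nx * l + H * (k * nu + Real.log (1 / δ)) with hB
  have hkm : (1 : ℝ) ≤ k * nu := by nlinarith
  have hHk : k * nu ≤ H * (k * nu : ℝ) := le_mul_of_one_le_left (by linarith) hH'
  have hHl : Real.log (1 / δ) ≤ H * Real.log (1 / δ) := le_mul_of_one_le_left h0 hH'
  have hA : P.sourceLevel N T δ ≤ 48 * P.sigz ^ 2 * n * B := by
    have h1 : 2 * k * nx * Real.log (2 * M + 1) + H * nu * (2 * k) * (Real.log 2 / 2)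
        + Real.log (8 / δ) ≤ 6 * B := by
      have h2 : 2 * k * nx * Real.log (2 * M + 1) ≤ 6 * (k * nx * l) := by
        have := mul_le_mul_of_nonneg_left hlog (by positivity : (0 : ℝ) ≤ 2 * k * nx)
        linarith
      have h3 : H * nu * (2 * k) * (Real.log 2 / 2) ≤ H * (k * nu : ℝ) := by
        have := mul_le_mul_of_nonneg_left (by linarith : Real.log 2 ≤ 1)
          (by positivity : (0 : ℝ) ≤ H * (k * nu))
        linarith
      rw [hl8, hB]
      linarith
    rw [sourceLevel, ← hM, ← hndef]
    have := mul_le_mul_of_nonneg_left h1 (by positivity : 0 ≤ 8 * P.sigz ^ 2 * n)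
    linarith
  have hZ : P.energyLevel N T δ ≤ 24 * P.sigz ^ 2 * n * B := by
    have h1 : H * n * nu * (Real.log 2 / 2) + Real.log (8 / δ) ≤ n * (6 * B) := by
      have h2 : H * n * nu * (Real.log 2 / 2) ≤ n * (H * (k * nu)) := by
        have h3 : (nu : ℝ) * (Real.log 2 / 2) ≤ k * nu := by nlinarith
        have := mul_le_mul_of_nonneg_left h3 (by positivity : (0 : ℝ) ≤ H * n)
        linarith
      have h4 : Real.log (8 / δ) ≤ n * (3 * (H * (k * nu)) + H * Real.log (1 / δ)) := by
        rw [hl8]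
        refine le_trans ?_ (le_mul_of_one_le_left (by positivity) (by linarith))
        linarith
      have h5 : 0 ≤ n * (k * nx * l) := by positivity
      have h6 : 0 ≤ n * (H * Real.log (1 / δ)) := by positivity
      have h7 : 0 ≤ n * (H * (k * nu)) := by positivity
      rw [hB]
      linarith
    rw [energyLevel, ← hndef]
    have := mul_le_mul_of_nonneg_left h1 (by positivity : 0 ≤ 4 * P.sigz ^ 2)
    linarith
  have hZ' : 48 * P.energyLevel N T δ * n * (1 / n) = 48 * P.energyLevel N T δ := by
    field_simp
  rw [hZ'] at hmain
  have hfin : n ^ 2 * P.sourceError Φ F ≤ n ^ 2 * (7296 * P.sigz ^ 2 / n * B) := by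
    have e : n ^ 2 * (7296 * P.sigz ^ 2 / n * B) = 7296 * (P.sigz ^ 2 * n * B) := by
      field_simp
    rw [e]
    linarith
  exact le_of_mul_le_mul_left hfin (by positivity)

theorem rate_pos (hk : 0 < k) (hnu : 0 < nu) (hn : 0 < nx) (hH : 0 < H) (hP : P.Valid)
    {N₁ N₂ T : ℕ} (h₁ : 1 ≤ (N₁ * T : ℝ)) (h₂ : 0 < (N₂ * T : ℝ)) {δ : ℝ} (hδ : 0 < δ)
    (hδ1 : δ < 1) : 0 < P.rate N₁ N₂ T δ := by
  have hc := coverage_pos hn hH hP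
  have hratio : 1 ≤ P.lamBar / P.lamUnder :=
    (one_le_div (lamUnder_pos hn hH hP)).2 (lamUnder_le_lamBar hn hH hP)
  have hN₁ : (0 : ℝ) < N₁ := pos_of_mul_pos_left (by linarith) (Nat.cast_nonneg T)
  have hN₂ : (0 : ℝ) < N₂ := pos_of_mul_pos_left h₂ (Nat.cast_nonneg T)
  have hT : (0 : ℝ) < T := pos_of_mul_pos_right h₂ hN₂.le
  have hl : 0 ≤ Real.log (N₁ * T * (P.lamBar / P.lamUnder)) :=
    Real.log_nonneg (one_le_mul_of_one_le_of_one_le h₁ hratio)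
  have h0 : 0 ≤ Real.log (1 / δ) := Real.log_nonneg ((one_le_div hδ).2 hδ1.le)
  have hmin : 0 < min (N₂ : ℝ) (P.coverage * N₁) := lt_min hN₂ (by positivity)
  have hk' : (0 : ℝ) < k := by exact_mod_cast hk
  have hnu' : (0 : ℝ) < nu := by exact_mod_cast hnu
  rw [rate]
  positivity

/-- On the good events, the population prediction error of the learned target gain is bounded by
the rate. -/
theorem wsq_le_rate (hk : 0 < k) (hnu : 0 < nu) (hn : 0 < nx) (hH : 0 < H) (hP : P.Valid) {D : ℝ}
    (hD0 : 0 < D) (hD : P.DiverseSources D) {N₁ N₂ T : ℕ} (h₁ : 7 * nx ≤ (N₁ * T : ℝ))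
    (h₂ : 0 < (N₂ * T : ℝ)) {δ : ℝ} (hδ : 0 < δ) (hδ1 : δ < 1)
    {s : Fin H → Fin N₁ → Traj nx nu T} (hs : P.SourceGood δ s)
    {Φ : Matrix (Fin k) (Fin nx) ℝ} {Fs : Fin H → Matrix (Fin nu) (Fin k) ℝ}
    (hERM : IsPretrained s Φ Fs) {d : Fin N₂ → Traj nx nu T}
    (hd : P.TargetGood (P.targetLevel N₂ T δ) Φ d) {F : Matrix (Fin nu) (Fin k) ℝ}
    (hERM' : IsTargetTrained d Φ F) :
    wsq (P.Sx (Fin.last H)) (F * Φ - P.K (Fin.last H))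
      ≤ 36480 * (D + 1) * P.sigz ^ 2 * P.rate N₁ N₂ T δ := by
  have hk' : (1 : ℝ) ≤ k := by exact_mod_cast hk
  have hnu' : (1 : ℝ) ≤ nu := by exact_mod_cast hnu
  have hn' : (1 : ℝ) ≤ nx := by exact_mod_cast hn
  have hH' : (1 : ℝ) ≤ H := by exact_mod_cast hH
  have hc := coverage_pos hn hH hP
  have hN₁ : (0 : ℝ) < N₁ := pos_of_mul_pos_left (by linarith) (Nat.cast_nonneg T)
  have hN₂ : (0 : ℝ) < N₂ := pos_of_mul_pos_left h₂ (Nat.cast_nonneg T)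
  have hT : (0 : ℝ) < T := pos_of_mul_pos_right h₂ hN₂.le
  have h0 : 0 ≤ Real.log (1 / δ) := Real.log_nonneg ((one_le_div hδ).2 hδ1.le)
  have hl2 := Real.log_two_lt_d9
  have hl2' : 0 ≤ Real.log 2 := Real.log_nonneg (by norm_num)
  have hkm : (1 : ℝ) ≤ k * nu := by nlinarith
  have hratio : 1 ≤ P.lamBar / P.lamUnder :=
    (one_le_div (lamUnder_pos hn hH hP)).2 (lamUnder_le_lamBar hn hH hP)
  have hl0 : 0 ≤ Real.log (N₁ * T * (P.lamBar / P.lamUnder)) :=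
    Real.log_nonneg (one_le_mul_of_one_le_of_one_le (by linarith) hratio)
  set l := Real.log (N₁ * T * (P.lamBar / P.lamUnder)) with hl
  set g := k * nu + Real.log (1 / δ) with hg
  have hg0 : 0 < g := by linarith
  have hmin : 0 < min (N₂ : ℝ) (P.coverage * N₁) := lt_min hN₂ (by positivity)
  have hr1 : k * nx * l / (P.coverage * N₁ * T * H) + g / (P.coverage * N₁ * T)
      ≤ P.rate N₁ N₂ T δ := by
    rw [rate]
    gcongr
    exact min_le_right _ _
  have hr2 : g / (N₂ * T) ≤ P.rate N₁ N₂ T δ := by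
    have h1 : g / (N₂ * T) ≤ g / (min (N₂ : ℝ) (P.coverage * N₁) * T) := by
      gcongr
      exact min_le_left _ _
    have h2 : 0 ≤ k * nx * l / (P.coverage * N₁ * T * H) := by positivity
    rw [rate]
    linarith
  obtain ⟨F', hF'⟩ := exists_wsq_mul_sub_le hn hH hP hD Φ Fs
  have hW := sourceError_le_of_sourceGood hk hnu hn hH hP h₁ hδ hδ1 hs hERM
  have hM : wsq (P.Sx (Fin.last H)) (F' * Φ - P.K (Fin.last H))
      ≤ 7296 * D * P.sigz ^ 2 * P.rate N₁ N₂ T δ := by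
    refine hF'.trans ((mul_le_mul_of_nonneg_left hW (by positivity)).trans ?_)
    have e : D / (H * P.coverage) * (7296 * P.sigz ^ 2 / (N₁ * T) * (k * nx * l + H * g))
        = 7296 * D * P.sigz ^ 2 * (k * nx * l / (P.coverage * N₁ * T * H)
          + g / (P.coverage * N₁ * T)) := by
      field_simp
    rw [e]
    exact mul_le_mul_of_nonneg_left hr1 (by positivity)
  have hlev : P.targetLevel N₂ T δ / (N₂ * T) ^ 2 ≤ 32 * P.sigz ^ 2 * P.rate N₁ N₂ T δ := by
    have h1 : nu * (2 * k) * (Real.log 2 / 2) + Real.log (8 / δ) ≤ 4 * g := by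
      rw [log_eight_div hδ, hg]
      have := mul_le_mul_of_nonneg_left (by linarith : Real.log 2 ≤ 1)
        (by positivity : (0 : ℝ) ≤ k * nu)
      linarith
    have e : P.targetLevel N₂ T δ / (N₂ * T) ^ 2 = 8 * P.sigz ^ 2 / (N₂ * T)
        * (nu * (2 * k) * (Real.log 2 / 2) + Real.log (8 / δ)) := by
      rw [targetLevel]; field_simp
    rw [e]
    refine (mul_le_mul_of_nonneg_left h1 (by positivity)).trans ?_
    have e2 : 8 * P.sigz ^ 2 / (N₂ * T) * (4 * g) = 32 * P.sigz ^ 2 * (g / (N₂ * T)) := by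
      field_simp; ring
    rw [e2]
    exact mul_le_mul_of_nonneg_left hr2 (by positivity)
  have hlev0 : 0 ≤ P.targetLevel N₂ T δ := by
    rw [targetLevel, log_eight_div hδ]
    positivity
  have hmain := wsq_target_le hP h₂ hlev0 hd hERM' F'
  have hrp : 0 ≤ P.sigz ^ 2 * P.rate N₁ N₂ T δ :=
    mul_nonneg (sq_nonneg _)
      (rate_pos hk hnu hn hH hP (by linarith) h₂ hδ hδ1).le
  nlinarith

/-- The good event for the target data, with a representation that depends on the source data. -/
theorem measure_prod_not_targetGood_le (hk : 0 < k) (hn : 0 < nx) (hP : P.Valid) {N₁ N₂ T : ℕ}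
    (hNT : 0 < (N₂ * T : ℝ)) {δ : ℝ} (hδ : 0 < δ) (hδ1 : δ < 1)
    (hN : 7 * (k + Real.log (1 / δ)) ≤ N₂ * T / (32768 * P.mixing (Fin.last H)))
    {Φhat : (Fin H → Fin N₁ → Traj nx nu T) → Matrix (Fin k) (Fin nx) ℝ}
    (hΦ : ∀ i j, Measurable fun s => Φhat s i j) :
    ((P.sourceLaw N₁ T).prod (P.targetLaw N₂ T))
      {d | ¬ P.TargetGood (P.targetLevel N₂ T δ) (Φhat d.1) d.2} ≤ ENNReal.ofReal (2 * δ / 8) := by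
  have hΦm : Measurable fun d : (Fin H → Fin N₁ → Traj nx nu T) × (Fin N₂ → Traj nx nu T) =>
      ((fun i j => Φhat d.1 i j, d.2) :
        (Fin k → Fin nx → ℝ) × (Fin N₂ → Traj nx nu T)) :=
    (measurable_pi_lambda _ fun i => measurable_pi_lambda _ fun j =>
      (hΦ i j).comp measurable_fst).prodMk measurable_snd
  have hB : MeasurableSet {d : (Fin H → Fin N₁ → Traj nx nu T) × (Fin N₂ → Traj nx nu T) |
      ¬ P.TargetGood (P.targetLevel N₂ T δ) (Φhat d.1) d.2} :=
    (hΦm (isClosed_targetGood (P.targetLevel N₂ T δ)).measurableSet).compl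
  rw [Measure.prod_apply hB]
  refine (lintegral_mono (g := fun _ => ENNReal.ofReal (2 * δ / 8)) fun s => ?_).trans (by simp)
  exact measure_not_targetGood_le_of_enough hk hn hP hNT hδ hδ1 hN (Φhat s)

theorem measure_prod_fst_eq {α β : Type*} [MeasurableSpace α] [MeasurableSpace β] (μ : Measure α)
    [SFinite μ] (ν : Measure β) [IsProbabilityMeasure ν] (p : α → Prop) :
    (μ.prod ν) {d | p d.1} = μ {a | p a} := by
  have h : {d : α × β | p d.1} = {a | p a} ×ˢ Set.univ := by ext; simp
  rw [h, Measure.prod_prod, measure_univ, mul_one]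

end Problem

end MTIL

theorem mainTheorem3 :
    ∃ C₁ : ℝ, 0 < C₁ ∧ ∀ D : ℝ, 0 < D → ∃ C₂ : ℝ, 0 < C₂ ∧
      ∀ (nx nu k H N₁ N₂ T : ℕ) (P : MTIL.Problem nx nu k H)
        (Q : Matrix (Fin nx) (Fin nx) ℝ) (R : Matrix (Fin nu) (Fin nu) ℝ) (δ : ℝ)
        (Φhat : (Fin H → Fin N₁ → MTIL.Traj nx nu T) → Matrix (Fin k) (Fin nx) ℝ)
        (Fsrc : (Fin H → Fin N₁ → MTIL.Traj nx nu T) → Fin H → Matrix (Fin nu) (Fin k) ℝ)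
        (Fhat : (Fin H → Fin N₁ → MTIL.Traj nx nu T) → (Fin N₂ → MTIL.Traj nx nu T) →
          Matrix (Fin nu) (Fin k) ℝ),
        0 < k → 0 < H → 2 ≤ T → P.Valid → P.DiverseSources D →
        Q.PosSemidef → R.PosSemidef → 0 < δ → δ < 1 →
        P.EnoughData C₁ N₁ N₂ T δ →
        (∀ i j, Measurable fun s => Φhat s i j) →
        (∀ᵐ s ∂(P.sourceLaw N₁ T), MTIL.IsPretrained s (Φhat s) (Fsrc s)) →
        (∀ᵐ d ∂((P.sourceLaw N₁ T).prod (P.targetLaw N₂ T)),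
          MTIL.IsTargetTrained d.2 (Φhat d.1) (Fhat d.1 d.2)) →
        ((P.sourceLaw N₁ T).prod (P.targetLaw N₂ T))
          {d | ¬ (P.excessRisk T (Fhat d.1 d.2 * Φhat d.1)
                  * (8 * MTIL.calJ (P.Acl (Fin.last H)) ^ 2 * ‖P.B‖ ^ 2)
                    ≤ MTIL.lamMin (P.Sx (Fin.last H)) →
                |P.expectedCost T Q R (Fhat d.1 d.2 * Φhat d.1)
                    - P.expectedCost T Q R (P.K (Fin.last H))|
                  ≤ C₂ * P.lqrConst Q R * P.sigz * √(Real.log T) * √(P.rate N₁ N₂ T δ))}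
          ≤ ENNReal.ofReal δ := by
  -- `10` relates cost differences to the root of the prediction error, and `36480 * (D + 1)` is the
  -- constant in the bound of the latter by the rate
  refine ⟨458752, by norm_num, fun D hD => ⟨10 * √(36480 * (D + 1)), by positivity, ?_⟩⟩
  intro nx nu k H N₁ N₂ T P Q R δ Φhat Fsrc Fhat hk hH hT hP hdiv hQ hR hδ hδ1 hdata hΦ hsrc htgt
  have hn : 0 < nx := by have := hP.dim; omega
  have hlc := P.lqrConst_nonneg hn hP Q R
  have hsig := hP.sigz_pos
  rcases Nat.eq_zero_or_pos nu with rfl | hnu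
  · -- without inputs, there is only one gain
    refine le_of_eq_of_le (measure_mono_null (t := ∅) (fun d hd => hd fun _ => ?_) measure_empty)
      zero_le
    rw [Subsingleton.elim (Fhat d.1 d.2 * Φhat d.1) (P.K (Fin.last H)), sub_self, abs_zero]
    positivity
  have hH' : (1 : ℝ) ≤ H := by exact_mod_cast hH
  have hn' : (1 : ℝ) ≤ nx := by exact_mod_cast hn
  have hk' : (1 : ℝ) ≤ k := by exact_mod_cast hk
  have hl1 : 0 ≤ Real.log (H / δ) := Real.log_nonneg ((one_le_div hδ).2 (by linarith))
  have hl2 : 0 ≤ Real.log (1 / δ) := Real.log_nonneg ((one_le_div hδ).2 hδ1.le)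
  have h₁ : 7 * nx ≤ (N₁ * T : ℝ) := by
    have := MTIL.Problem.seven_mul_le_of_enough hn hP (Fin.castSucc ⟨0, hH⟩) (by positivity)
      (hdata.1 ⟨0, hH⟩)
    linarith
  have h₂ : 0 < (N₂ * T : ℝ) := by
    have := MTIL.Problem.seven_mul_le_of_enough hn hP (Fin.last H) (by positivity) hdata.2
    linarith
  set μ := P.sourceLaw N₁ T
  set ν := P.targetLaw N₂ T
  have e1 : (μ.prod ν) {d | ¬ MTIL.IsPretrained d.1 (Φhat d.1) (Fsrc d.1)} = 0 :=
    (MTIL.Problem.measure_prod_fst_eq μ ν fun s =>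
      ¬ MTIL.IsPretrained s (Φhat s) (Fsrc s)).trans hsrc
  have e2 : (μ.prod ν) {d | ¬ MTIL.IsTargetTrained d.2 (Φhat d.1) (Fhat d.1 d.2)} = 0 := htgt
  have e3 : (μ.prod ν) {d | ¬ P.SourceGood δ d.1} ≤ ENNReal.ofReal (3 * δ / 8) :=
    (MTIL.Problem.measure_prod_fst_eq μ ν fun s => ¬ P.SourceGood δ s).trans_le
      (MTIL.Problem.measure_not_sourceGood_le hn hH hP (by linarith) hδ hδ1 fun h =>
        MTIL.Problem.le_div_mixing hn hP _ (by positivity) (hdata.1 h))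
  have e4 : (μ.prod ν) {d | ¬ P.TargetGood (P.targetLevel N₂ T δ) (Φhat d.1) d.2}
      ≤ ENNReal.ofReal (2 * δ / 8) :=
    MTIL.Problem.measure_prod_not_targetGood_le hk hn hP h₂ hδ hδ1
      (MTIL.Problem.le_div_mixing hn hP _ (by positivity) hdata.2) hΦ
  refine (measure_mono (t := ({d | ¬ MTIL.IsPretrained d.1 (Φhat d.1) (Fsrc d.1)} ∪
    {d | ¬ MTIL.IsTargetTrained d.2 (Φhat d.1) (Fhat d.1 d.2)}) ∪ ({d | ¬ P.SourceGood δ d.1} ∪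
    {d | ¬ P.TargetGood (P.targetLevel N₂ T δ) (Φhat d.1) d.2})) fun d hd => ?_).trans ?_
  · by_contra hcon
    simp only [Set.mem_union, Set.mem_ofPred_eq, not_or, not_not] at hcon
    obtain ⟨⟨c1, c2⟩, c3, c4⟩ := hcon
    refine hd fun hburn => ?_
    have hw := MTIL.Problem.wsq_le_rate hk hnu hn hH hP hD hdiv h₁ h₂ hδ hδ1 c3 c1 c4 c2
    have hrate := MTIL.Problem.rate_pos (N₁ := N₁) hk hnu hn hH hP (by linarith) h₂ hδ hδ1
    rw [MTIL.Problem.excessRisk_eq hP (by omega)] at hburn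
    refine (MTIL.Problem.abs_expectedCost_sub_le hn hP hT hQ hR
      (v := 36480 * (D + 1) * P.sigz ^ 2 * P.rate N₁ N₂ T δ) (by positivity) hw
      (by linarith)).trans (le_of_eq ?_)
    rw [Real.sqrt_mul (by positivity), Real.sqrt_mul (by positivity), Real.sqrt_sq hsig.le]
    ring
  · refine (measure_union_le _ _).trans ((add_le_add (measure_union_le _ _)
      (measure_union_le _ _)).trans ?_)
    rw [e1, e2, add_zero, zero_add]
    refine (add_le_add e3 e4).trans ?_
    rw [← ENNReal.ofReal_add (by positivity) (by positivity)]
    exact ENNReal.ofReal_le_ofReal (by linarith)
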